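/- Let $(M,g)$ be a complete (second countable, smooth) Riemannian $N$-dimensional manifold without boundary, with Riemannian volume $dv_g$, and let $\Omega\subset M$ be open. Let $\rho\in W^{1,2}_{loc}(\Omega)$ be nonnegative and superharmonic in the weak sense, that is, $$\int_\Omega \nabla\rho\cdot\nabla\varphi\,dv_g\ge 0\qquad\text{for every } 0\le\varphi\in C^1_0(\Omega),$$ where $C^1_0(\Omega)$ denotes the real $C^1$ functions with compact support in $\Omega$, and assume that $\rho$ does not vanish almost everywhere on any connected component of $\Omega$ (for example, $\Omega$ is connected and $\rho\not\equiv 0$). Here $\rho\in W^{1,2}_{loc}(\Omega)$ with weak gradient $\nabla\rho$ means that, for every open $U$ with compact closure $\overline U\subset\Omega$, the pair $(\rho,\nabla\rho)$ is on $U$ the $L^2(U)$-limit of pairs $(f_n,\nabla f_n)$ with $f_n\in C^\infty(U)$ and $\int_U (f_n^2+|\nabla f_n|^2)\,dv_g<\infty$. Define $$\Lambda_1:=\inf\left\{\frac{\int_\Omega\rho|\nabla u|^2\,dv_g}{\int_\Omega\rho u^2\,dv_g}\;:\;u\in C^1_0(\Omega),\ \int_\Omega\rho u^2\,dv_g\neq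 0\right\}$$ and assume that $\Lambda_1>0$. Then for every $u\in C^1_0(\Omega)$ the function $\frac{u^2}{\rho^2}|\nabla\rho|^2$ is integrable on $\Omega$ and $$\int_\Omega|\nabla u|^2\,dv_g\;\ge\;\frac14\int_\Omega\frac{u^2}{\rho^2}|\nabla\rho|^2\,dv_g+\Lambda_1\int_\Omega u^2\,dv_g .$$ -/

import Mathlib

open MeasureTheory Set Filter Topology Manifold Bundle
open scoped ContDiff ENNReal

namespace RiemannianHardy

noncomputable section

variable {N : ℕ} {M : Type*} [TopologicalSpace M] [ChartedSpace (EuclideanSpace ℝ (Fin N)) M]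

section Volume

variable (N) [IsManifold (𝓡 N) ∞ M] [RiemannianBundle (fun x : M => TangentSpace (𝓡 N) x)]

/-- The `i`-th coordinate vector field of the chart at `x₀`, at the point with coordinates `y`:
the image of the `i`-th standard basis vector under the derivative of the inverse chart. -/
def coordVector (x₀ : M) (y : EuclideanSpace ℝ (Fin N)) (i : Fin N) :
    TangentSpace (𝓡 N) ((chartAt (EuclideanSpace ℝ (Fin N)) x₀).symm y) :=
  mfderiv (𝓡 N) (𝓡 N) (chartAt (EuclideanSpace ℝ (Fin N)) x₀).symm y
    (EuclideanSpace.single i (1 : ℝ) : EuclideanSpace ℝ (Fin N))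

/-- The matrix `g i j` of the Riemannian metric in the chart at `x₀`, as a function of the
coordinates `y`. -/
def gramMatrix (x₀ : M) (y : EuclideanSpace ℝ (Fin N)) : Matrix (Fin N) (Fin N) ℝ :=
  Matrix.of fun i j => inner ℝ (coordVector N x₀ y i) (coordVector N x₀ y j)

variable [MeasurableSpace M]

/-- The Riemannian volume of the domain of the chart at `x₀`, extended by zero to `M`:
the measure `√(det g) dy` on the target of the chart, transported to `M`. -/
def chartVolume (x₀ : M) : Measure M :=
  ((volume.restrict (chartAt (EuclideanSpace ℝ (Fin N)) x₀).target).withDensity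
    fun y => ENNReal.ofReal (Real.sqrt (gramMatrix N x₀ y).det)).map
      (chartAt (EuclideanSpace ℝ (Fin N)) x₀).symm

variable (M) in
/-- The Riemannian volume measure `dv_g`. By the change of variables formula the measures
`chartVolume N x₀` agree on overlaps of chart domains; the supremum (in the complete lattice of
measures) is the measure that restricts to `chartVolume N x₀` on each chart domain. -/
def riemannianVolume : Measure M :=
  ⨆ x₀ : M, chartVolume N x₀

end Volume

/-- `u ∈ C₀¹(Ω)`: a real `C¹` function with compact support contained in `Ω`. -/
structure IsC10 (N : ℕ) {M : Type*} [TopologicalSpace M]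
    [ChartedSpace (EuclideanSpace ℝ (Fin N)) M] (Ω : Set M) (u : M → ℝ) : Prop where
  contMDiff : ContMDiff (𝓡 N) 𝓘(ℝ, ℝ) 1 u
  hasCompactSupport : HasCompactSupport u
  tsupport_subset : tsupport u ⊆ Ω

variable (N) [IsManifold (𝓡 N) ∞ M] [RiemannianBundle (fun x : M => TangentSpace (𝓡 N) x)]

instance (x : M) : FiniteDimensional ℝ (TangentSpace (𝓡 N) x) :=
  inferInstanceAs (FiniteDimensional ℝ (EuclideanSpace ℝ (Fin N)))

instance (x : M) : CompleteSpace (TangentSpace (𝓡 N) x) :=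
  FiniteDimensional.complete ℝ (TangentSpace (𝓡 N) x)

/-- The Riemannian gradient of `f` at `x`: the tangent vector that represents the differential of
`f` through the Riemannian inner product. -/
def grad (f : M → ℝ) (x : M) : TangentSpace (𝓡 N) x :=
  (InnerProductSpace.toDual ℝ (TangentSpace (𝓡 N) x)).symm (mfderiv (𝓡 N) 𝓘(ℝ, ℝ) f x)

variable [MeasurableSpace M]

/-- `ρ ∈ W^{1,2}(U)` with weak gradient `G`, for an open set `U`: the pair `(ρ, G)` is measurable
and is the limit, in the norm `(∫_U |f|² + ∫_U |∇f|²)^{1/2}`, of smooth functions on `U` for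
which this norm is finite. -/
structure IsW12 (U : Set M) (ρ : M → ℝ) (G : (x : M) → TangentSpace (𝓡 N) x) : Prop where
  aestronglyMeasurable : AEStronglyMeasurable ρ ((riemannianVolume N M).restrict U)
  /-- the components of `G` in each chart are measurable -/
  aestronglyMeasurable_grad : ∀ x₀ : M, AEStronglyMeasurable
    (fun x => (mfderiv (𝓡 N) (𝓡 N) (chartAt (EuclideanSpace ℝ (Fin N)) x₀) x (G x) :
      EuclideanSpace ℝ (Fin N)))
    ((riemannianVolume N M).restrict (U ∩ (chartAt (EuclideanSpace ℝ (Fin N)) x₀).source))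
  exists_approx : ∃ f : ℕ → M → ℝ,
    (∀ n, ContMDiffOn (𝓡 N) 𝓘(ℝ, ℝ) ∞ (f n) U) ∧
    (∀ n, MemLp (f n) 2 ((riemannianVolume N M).restrict U)) ∧
    (∀ n, MemLp (fun x => ‖grad N (f n) x‖) 2 ((riemannianVolume N M).restrict U)) ∧
    Tendsto (fun n => eLpNorm (fun x => f n x - ρ x) 2 ((riemannianVolume N M).restrict U))
      atTop (𝓝 0) ∧
    Tendsto (fun n => eLpNorm (fun x => ‖grad N (f n) x - G x‖) 2
      ((riemannianVolume N M).restrict U)) atTop (𝓝 0)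

/-- `ρ ∈ W^{1,2}_loc(Ω)` with weak gradient `G`. -/
def IsW12Loc (Ω : Set M) (ρ : M → ℝ) (G : (x : M) → TangentSpace (𝓡 N) x) : Prop :=
  ∀ U : Set M, IsOpen U → IsCompact (closure U) → closure U ⊆ Ω → IsW12 N U ρ G

/-- `-Δρ ≥ 0` on `Ω` in the weak sense, where `G` is the weak gradient of `ρ`. -/
def IsWeaklySuperharmonic (Ω : Set M) (G : (x : M) → TangentSpace (𝓡 N) x) : Prop :=
  ∀ φ : M → ℝ, IsC10 N Ω φ → (∀ x, 0 ≤ φ x) →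
    0 ≤ ∫ x in Ω, inner ℝ (G x) (grad N φ x) ∂(riemannianVolume N M)

/-- `Λ₁`, the infimum of the quotients `∫_Ω ρ |∇u|² / ∫_Ω ρ u²` over those `u ∈ C₀¹(Ω)` for which
the denominator does not vanish. -/
def Lambda1 (Ω : Set M) (ρ : M → ℝ) : ℝ :=
  sInf {q : ℝ | ∃ u : M → ℝ, IsC10 N Ω u ∧
    ∫ x in Ω, ρ x * u x ^ 2 ∂(riemannianVolume N M) ≠ 0 ∧
    q = (∫ x in Ω, ρ x * ‖grad N u x‖ ^ 2 ∂(riemannianVolume N M)) /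
      ∫ x in Ω, ρ x * u x ^ 2 ∂(riemannianVolume N M)}

end

end RiemannianHardy

set_option linter.unusedSectionVars false
set_option linter.style.haveILetI false

/-! Let G be the weak gradient of ρ and ε > 0. Testing superharmonicity with u²/(ρ+ε) and completing
the square gives ∫|∇u − uG/(2(ρ+ε))|² + ¼∫u²|G|²/(ρ+ε)² ≤ ∫|∇u|² (`lintegral_grad_sub_add_le`). The
first integrand is (ρ+ε)|∇v|² ≥ ρ|∇v|² for v = u/√(ρ+ε), so the definition of Λ₁, applied to v,
bounds the first integral below by Λ₁∫u²ρ/(ρ+ε) (`Lambda1_mul_lintegral_le`). Fatou's lemma for ε →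
0 gives the theorem (`hardy_lintegral_le`), provided that ρ ≠ 0 almost everywhere: on {ρ = 0} the
factor ρ/(ρ+ε) does not tend to 1.

Two points need work. The first is that v is not C¹, so it has to be a limit of functions in C₀¹ in
the energy norm with weight ρ. Since ρ may be unbounded, convergence in W^{1,2} does not give this.
In a chart ρ is replaced by its mollifications F_k = φ_k * ρ. With c the derivative of (t+ε)^{-1/2},
the fields c(F_k)∇F_k = c(F_k)(φ_k * G) must converge to c(ρ)G in L² with weight ρ. The function
c(t)²t is bounded on [0,∞). Hence c(F_k)²F_k is bounded, and although c(F_k)²ρ need not be, its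
averages at the scale of the mollifier are (`exists_mollified_average_bound`). So X ↦ c(F_k)(φ_k *
X) is bounded from L² to weighted L² uniformly in k, and it suffices to treat X continuous with
compact support (`tendsto_weighted_mollification`). A partition of unity makes the result global
(`IsC10.isWeightedLimit`).

The second is the strong maximum principle. With a cutoff for u, the first inequality bounds the
local energy of log(ρ+ε) uniformly in ε. The function log((ρ+ε)/ε) vanishes on {ρ = 0} and tends to
infinity on {ρ > 0}, while a Poincaré estimate in L¹ keeps its oscillation bounded. So one of the
two sets is null in each small ball (`ae_eq_zero_or_ae_ne_zero`). Connectedness and the assumption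
that ρ is nontrivial on each component exclude the vanishing case
(`IsWeaklySuperharmonic.ae_ne_zero`). -/

namespace RiemannianHardy

noncomputable section

/-! ### The Riemannian metric in a chart. -/

section Metric

variable {N : ℕ} {M : Type*} [TopologicalSpace M] [ChartedSpace (EuclideanSpace ℝ (Fin N)) M]
  [IsManifold (𝓡 N) ∞ M]

variable (N) in
/-- The derivative of the inverse chart at `x₀`. -/
def dsymm (x₀ : M) (y : EuclideanSpace ℝ (Fin N)) : EuclideanSpace ℝ (Fin N) →L[ℝ]
    TangentSpace (𝓡 N) ((chartAt (EuclideanSpace ℝ (Fin N)) x₀).symm y) :=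
  mfderiv (𝓡 N) (𝓡 N) (chartAt (EuclideanSpace ℝ (Fin N)) x₀).symm y

variable (N) in
/-- The derivative of the chart at `x₀`. -/
def dchart (x₀ x : M) : TangentSpace (𝓡 N) x →L[ℝ] EuclideanSpace ℝ (Fin N) :=
  mfderiv (𝓡 N) (𝓡 N) (chartAt (EuclideanSpace ℝ (Fin N)) x₀) x

theorem mdifferentiableAt_chart_symm (x₀ : M) {y : EuclideanSpace ℝ (Fin N)}
    (hy : y ∈ (chartAt (EuclideanSpace ℝ (Fin N)) x₀).target) :
    MDifferentiableAt (𝓡 N) (𝓡 N) (chartAt (EuclideanSpace ℝ (Fin N)) x₀).symm y :=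
  ((contMDiffOn_chart_symm (I := 𝓡 N) (n := ∞) (x := x₀)).contMDiffAt
    ((chartAt (EuclideanSpace ℝ (Fin N)) x₀).open_target.mem_nhds hy)).mdifferentiableAt (by simp)

theorem mdifferentiableAt_chart (x₀ : M) {x : M}
    (hx : x ∈ (chartAt (EuclideanSpace ℝ (Fin N)) x₀).source) :
    MDifferentiableAt (𝓡 N) (𝓡 N) (chartAt (EuclideanSpace ℝ (Fin N)) x₀) x :=
  ((contMDiffOn_chart (I := 𝓡 N) (n := ∞) (x := x₀)).contMDiffAt
    ((chartAt (EuclideanSpace ℝ (Fin N)) x₀).open_source.mem_nhds hx)).mdifferentiableAt (by simp)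

theorem dchart_dsymm (x₀ : M) {y : EuclideanSpace ℝ (Fin N)}
    (hy : y ∈ (chartAt (EuclideanSpace ℝ (Fin N)) x₀).target) (ξ : EuclideanSpace ℝ (Fin N)) :
    dchart N x₀ ((chartAt (EuclideanSpace ℝ (Fin N)) x₀).symm y) (dsymm N x₀ y ξ) = ξ := by
  have h := (mdifferentiable_chart (I := 𝓡 N) (H := EuclideanSpace ℝ (Fin N)) x₀).comp_symm_deriv hy
  exact DFunLike.congr_fun h ξ

theorem dsymm_dchart (x₀ : M) {y : EuclideanSpace ℝ (Fin N)}
    (hy : y ∈ (chartAt (EuclideanSpace ℝ (Fin N)) x₀).target)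
    (v : TangentSpace (𝓡 N) ((chartAt (EuclideanSpace ℝ (Fin N)) x₀).symm y)) :
    dsymm N x₀ y (dchart N x₀ ((chartAt (EuclideanSpace ℝ (Fin N)) x₀).symm y) v) = v := by
  have h := (mdifferentiable_chart (I := 𝓡 N) (H := EuclideanSpace ℝ (Fin N)) x₀).symm_comp_deriv
    ((chartAt (EuclideanSpace ℝ (Fin N)) x₀).map_target hy)
  rw [(chartAt (EuclideanSpace ℝ (Fin N)) x₀).right_inv hy] at h
  exact DFunLike.congr_fun h v

theorem fderiv_comp_chart_symm (x₀ : M) {f : M → ℝ} {y : EuclideanSpace ℝ (Fin N)}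
    (hy : y ∈ (chartAt (EuclideanSpace ℝ (Fin N)) x₀).target)
    (hf : MDifferentiableAt (𝓡 N) 𝓘(ℝ, ℝ) f ((chartAt (EuclideanSpace ℝ (Fin N)) x₀).symm y))
    (ξ : EuclideanSpace ℝ (Fin N)) :
    fderiv ℝ (f ∘ (chartAt (EuclideanSpace ℝ (Fin N)) x₀).symm) y ξ =
      mfderiv (𝓡 N) 𝓘(ℝ, ℝ) f ((chartAt (EuclideanSpace ℝ (Fin N)) x₀).symm y) (dsymm N x₀ y ξ) := by
  rw [← mfderiv_eq_fderiv, mfderiv_comp y hf (mdifferentiableAt_chart_symm x₀ hy)]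
  rfl

variable [RiemannianBundle (fun x : M => TangentSpace (𝓡 N) x)]

theorem inner_grad (f : M → ℝ) (x : M) (v : TangentSpace (𝓡 N) x) :
    inner ℝ (grad N f x) v = mfderiv (𝓡 N) 𝓘(ℝ, ℝ) f x v := by
  exact InnerProductSpace.toDual_symm_apply (𝕜 := ℝ) (E := TangentSpace (𝓡 N) x)

theorem fderiv_comp_chart_symm_eq_inner (x₀ : M) {f : M → ℝ} {y : EuclideanSpace ℝ (Fin N)}
    (hy : y ∈ (chartAt (EuclideanSpace ℝ (Fin N)) x₀).target)
    (hf : MDifferentiableAt (𝓡 N) 𝓘(ℝ, ℝ) f ((chartAt (EuclideanSpace ℝ (Fin N)) x₀).symm y))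
    (ξ : EuclideanSpace ℝ (Fin N)) :
    fderiv ℝ (f ∘ (chartAt (EuclideanSpace ℝ (Fin N)) x₀).symm) y ξ =
      inner ℝ (grad N f ((chartAt (EuclideanSpace ℝ (Fin N)) x₀).symm y)) (dsymm N x₀ y ξ) := by
  rw [fderiv_comp_chart_symm x₀ hy hf, inner_grad]

theorem gramMatrix_apply (x₀ : M) (y : EuclideanSpace ℝ (Fin N)) (i j : Fin N) :
    gramMatrix N x₀ y i j = inner ℝ (dsymm N x₀ y (EuclideanSpace.single i 1))
      (dsymm N x₀ y (EuclideanSpace.single j 1)) := rfl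

theorem euclidean_eq_sum_single (ξ : EuclideanSpace ℝ (Fin N)) :
    ξ = ∑ i, ξ i • EuclideanSpace.single i (1 : ℝ) := by
  simpa using ((EuclideanSpace.basisFun (Fin N) ℝ).sum_repr ξ).symm

theorem inner_dsymm (x₀ : M) (y ξ η : EuclideanSpace ℝ (Fin N)) :
    inner ℝ (dsymm N x₀ y ξ) (dsymm N x₀ y η) =
      ∑ i, ∑ j, ξ i * η j * gramMatrix N x₀ y i j := by
  conv_lhs => rw [euclidean_eq_sum_single ξ, euclidean_eq_sum_single η]
  simp only [map_sum, map_smul, sum_inner, inner_sum, real_inner_smul_left, real_inner_smul_right,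
    gramMatrix_apply]
  rw [Finset.sum_comm]
  refine Finset.sum_congr rfl fun i _ => Finset.sum_congr rfl fun j _ => by ring

/-- The coordinate fields are images of constant fields under the tangent map of the inverse chart,
hence continuous sections along it, and the bundle metric pairs continuous sections continuously. -/
theorem continuousOn_gramMatrix [IsContMDiffRiemannianBundle (𝓡 N) ∞ (EuclideanSpace ℝ (Fin N))
      (fun x : M => TangentSpace (𝓡 N) x)] (x₀ : M) (i j : Fin N) :
    ContinuousOn (fun y => gramMatrix N x₀ y i j)
      (chartAt (EuclideanSpace ℝ (Fin N)) x₀).target := by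
  set e := chartAt (EuclideanSpace ℝ (Fin N)) x₀
  have key : ∀ k : Fin N, ContMDiffOn (𝓡 N) ((𝓡 N).tangent) 0
      (fun y => (⟨e.symm y, dsymm N x₀ y (EuclideanSpace.single k 1)⟩ :
        TotalSpace (EuclideanSpace ℝ (Fin N)) (fun x : M => TangentSpace (𝓡 N) x))) e.target := by
    intro k
    have h1 := (contMDiffOn_chart_symm (I := 𝓡 N) (n := ∞) (x := x₀)).contMDiffOn_tangentMapWithin
      (m := 0) (by simp) e.open_target.uniqueMDiffOn
    have h2 : ContMDiff (𝓡 N) ((𝓡 N).tangent) 0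
      (fun y : EuclideanSpace ℝ (Fin N) => (⟨y, (EuclideanSpace.single k 1 : EuclideanSpace ℝ (Fin N))⟩ :
        TangentBundle (𝓡 N) (EuclideanSpace ℝ (Fin N)))) := by
      exact contMDiff_vectorSpace_iff_contDiff.2 contDiff_const
    have h3 := h1.comp (s := e.target) h2.contMDiffOn (fun y hy => hy)
    refine h3.congr fun y hy => ?_
    simp only [Function.comp, tangentMapWithin, dsymm]
    rw [mfderivWithin_of_isOpen e.open_target hy]
    rfl
  have : IsContMDiffRiemannianBundle (𝓡 N) 0 (EuclideanSpace ℝ (Fin N))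
      (fun x : M => TangentSpace (𝓡 N) x) := IsContMDiffRiemannianBundle.of_le (n := ∞) (by simp)
  have := ContMDiffOn.inner_bundle (n := 0) (key i) (key j)
  exact this.continuousOn

end Metric

end

end RiemannianHardy

namespace RiemannianHardy

noncomputable section

/-! ### Bounds for the metric on compact subsets of a chart. -/

section Metric

variable {N : ℕ} {M : Type*} [TopologicalSpace M] [ChartedSpace (EuclideanSpace ℝ (Fin N)) M]
  [IsManifold (𝓡 N) ∞ M] [RiemannianBundle (fun x : M => TangentSpace (𝓡 N) x)]

theorem dsymm_injective (x₀ : M) {y : EuclideanSpace ℝ (Fin N)}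
    (hy : y ∈ (chartAt (EuclideanSpace ℝ (Fin N)) x₀).target) :
    Function.Injective (dsymm N x₀ y) := fun ξ η h => by
  rw [← dchart_dsymm x₀ hy ξ, h, dchart_dsymm x₀ hy η]

/-- The derivative of the inverse chart is injective, so the matrix is the Gram matrix of
independent vectors and is positive definite. -/
theorem gramMatrix_det_pos (x₀ : M) {y : EuclideanSpace ℝ (Fin N)}
    (hy : y ∈ (chartAt (EuclideanSpace ℝ (Fin N)) x₀).target) :
    0 < (gramMatrix N x₀ y).det := by
  have h : gramMatrix N x₀ y =
      Matrix.gram ℝ (fun i => dsymm N x₀ y (EuclideanSpace.single i 1)) := rfl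
  rw [h]
  refine (Matrix.posDef_gram_of_linearIndependent (𝕜 := ℝ) ?_).det_pos
  have hb := (EuclideanSpace.basisFun (Fin N) ℝ).toBasis.linearIndependent
  have := hb.map' (dsymm N x₀ y).toLinearMap (LinearMap.ker_eq_bot.2 (dsymm_injective x₀ hy))
  simpa [Function.comp_def] using this

variable [IsContMDiffRiemannianBundle (𝓡 N) ∞ (EuclideanSpace ℝ (Fin N))
      (fun x : M => TangentSpace (𝓡 N) x)]

theorem continuousOn_gramMatrix_det (x₀ : M) :
    ContinuousOn (fun y => (gramMatrix N x₀ y).det)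
      (chartAt (EuclideanSpace ℝ (Fin N)) x₀).target := by
  simp only [Matrix.det_apply']
  refine continuousOn_finsetSum _ fun σ _ => continuousOn_const.mul ?_
  exact continuousOn_finsetProd _ fun i _ => continuousOn_gramMatrix x₀ _ _

theorem exists_sqrt_det_bounds (x₀ : M) {K : Set (EuclideanSpace ℝ (Fin N))} (hK : IsCompact K)
    (hKt : K ⊆ (chartAt (EuclideanSpace ℝ (Fin N)) x₀).target) :
    ∃ C : ℝ, 0 < C ∧ ∀ y ∈ K, √(gramMatrix N x₀ y).det ≤ C ∧ C⁻¹ ≤ √(gramMatrix N x₀ y).det := by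
  have h1 : ContinuousOn (fun y => √(gramMatrix N x₀ y).det) K :=
    ((continuousOn_gramMatrix_det x₀).mono hKt).sqrt
  have hpos : ∀ y ∈ K, 0 < √(gramMatrix N x₀ y).det := fun y hy =>
    Real.sqrt_pos.2 (gramMatrix_det_pos x₀ (hKt hy))
  obtain ⟨C₁, hC₁⟩ := hK.exists_bound_of_continuousOn h1
  obtain ⟨C₂, hC₂⟩ := hK.exists_bound_of_continuousOn (h1.inv₀ fun y hy => (hpos y hy).ne')
  refine ⟨max (max C₁ C₂) 1, by positivity, fun y hy => ⟨?_, ?_⟩⟩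
  · exact (le_abs_self _).trans ((hC₁ y hy).trans (by simp))
  · rw [inv_le_comm₀ (by positivity) (hpos y hy)]
    exact (le_abs_self _).trans ((hC₂ y hy).trans (by simp))

/-- The norm is continuous and nonzero on the compact product of `K` with the unit sphere;
homogeneity in ξ extends the bounds from the sphere to all vectors. -/
theorem exists_norm_dsymm_bounds (x₀ : M) {K : Set (EuclideanSpace ℝ (Fin N))} (hK : IsCompact K)
    (hKt : K ⊆ (chartAt (EuclideanSpace ℝ (Fin N)) x₀).target) :
    ∃ C : ℝ, 0 < C ∧ ∀ y ∈ K, ∀ ξ : EuclideanSpace ℝ (Fin N),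
      ‖dsymm N x₀ y ξ‖ ≤ C * ‖ξ‖ ∧ ‖ξ‖ ≤ C * ‖dsymm N x₀ y ξ‖ := by
  set S := K ×ˢ Metric.sphere (0 : EuclideanSpace ℝ (Fin N)) 1
  have hS : IsCompact S := hK.prod (isCompact_sphere _ _)
  have h1 : ContinuousOn (fun p : _ × _ => ‖dsymm N x₀ p.1 p.2‖) S := by
    simp only [norm_eq_sqrt_real_inner, inner_dsymm]
    refine ContinuousOn.sqrt (continuousOn_finsetSum _ fun i _ => continuousOn_finsetSum _
      fun j _ => ContinuousOn.mul (by fun_prop) ?_)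
    exact (continuousOn_gramMatrix x₀ i j).comp continuousOn_fst fun p hp => hKt hp.1
  have hpos : ∀ p ∈ S, ‖dsymm N x₀ p.1 p.2‖ ≠ 0 := fun p hp h => by
    have h0 : p.2 = 0 := dsymm_injective x₀ (hKt hp.1) (by rw [norm_eq_zero.1 h, map_zero])
    have := hp.2
    simp [h0] at this
  obtain ⟨C₁, hC₁⟩ := hS.exists_bound_of_continuousOn h1
  obtain ⟨C₂, hC₂⟩ := hS.exists_bound_of_continuousOn (h1.inv₀ hpos)
  refine ⟨max (max C₁ C₂) 1, by positivity, fun y hy ξ => ?_⟩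
  rcases eq_or_ne ξ 0 with rfl | hξ
  · simp
  have hn : 0 < ‖ξ‖ := norm_pos_iff.2 hξ
  have hm : (y, ‖ξ‖⁻¹ • ξ) ∈ S := ⟨hy, by simp [norm_smul, hn.ne']⟩
  have hq : ‖dsymm N x₀ y (‖ξ‖⁻¹ • ξ)‖ = ‖ξ‖⁻¹ * ‖dsymm N x₀ y ξ‖ := by
    rw [map_smul, norm_smul, norm_inv, norm_norm]
  have a1 := (le_abs_self _).trans (hC₁ _ hm)
  have a2 := (le_abs_self _).trans (hC₂ _ hm)
  have p1 := hpos _ hm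
  simp only [Pi.inv_apply, hq] at a1 a2 p1
  have hd : 0 < ‖dsymm N x₀ y ξ‖ := lt_of_le_of_ne (norm_nonneg _) (by
    intro h; rw [← h] at p1; simp at p1)
  constructor
  · rw [inv_mul_le_iff₀ hn, mul_comm] at a1
    exact a1.trans (by gcongr; simp)
  · rw [mul_inv, inv_inv, ← div_eq_mul_inv, div_le_iff₀ hd] at a2
    exact a2.trans (by gcongr; simp)

end Metric

end

end RiemannianHardy

namespace RiemannianHardy

noncomputable section

/-! ### Change of charts and the volume densities. -/

section Volume

variable {N : ℕ} {M : Type*} [TopologicalSpace M] [ChartedSpace (EuclideanSpace ℝ (Fin N)) M]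
  [IsManifold (𝓡 N) ∞ M] [RiemannianBundle (fun x : M => TangentSpace (𝓡 N) x)]

/-- All tangent spaces are the same model space by definition, but their inner products depend on
the base point. This moves the base point from p to e₀⁻¹(e₀(p)), which is not definitionally equal
to p. -/
theorem inner_tangentSpace_congr {p q : M} (hpq : p = q) (v w : EuclideanSpace ℝ (Fin N)) :
    inner (E := TangentSpace (𝓡 N) p) ℝ v w = inner (E := TangentSpace (𝓡 N) q) ℝ v w := by
  subst hpq; rfl

theorem differentiableAt_chart_transition (x₀ x₁ : M) {y : EuclideanSpace ℝ (Fin N)}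
    (hy : y ∈ (chartAt (EuclideanSpace ℝ (Fin N)) x₁).target)
    (hy' : (chartAt (EuclideanSpace ℝ (Fin N)) x₁).symm y ∈
      (chartAt (EuclideanSpace ℝ (Fin N)) x₀).source) :
    DifferentiableAt ℝ ((chartAt (EuclideanSpace ℝ (Fin N)) x₀) ∘
      (chartAt (EuclideanSpace ℝ (Fin N)) x₁).symm) y :=
  ((mdifferentiableAt_chart x₀ hy').comp y
    (mdifferentiableAt_chart_symm x₁ hy)).differentiableAt

/-- Chain rule for e₁⁻¹ = e₀⁻¹ ∘ (e₀ ∘ e₁⁻¹), valid near y. -/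
theorem inner_dsymm_transition (x₀ x₁ : M) {y : EuclideanSpace ℝ (Fin N)}
    (hy : y ∈ (chartAt (EuclideanSpace ℝ (Fin N)) x₁).target)
    (hy' : (chartAt (EuclideanSpace ℝ (Fin N)) x₁).symm y ∈
      (chartAt (EuclideanSpace ℝ (Fin N)) x₀).source) (ξ η : EuclideanSpace ℝ (Fin N)) :
    inner ℝ (dsymm N x₁ y ξ) (dsymm N x₁ y η) =
      inner ℝ
        (dsymm N x₀ (chartAt (EuclideanSpace ℝ (Fin N)) x₀
          ((chartAt (EuclideanSpace ℝ (Fin N)) x₁).symm y))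
          (fderiv ℝ ((chartAt (EuclideanSpace ℝ (Fin N)) x₀) ∘
            (chartAt (EuclideanSpace ℝ (Fin N)) x₁).symm) y ξ))
        (dsymm N x₀ (chartAt (EuclideanSpace ℝ (Fin N)) x₀
          ((chartAt (EuclideanSpace ℝ (Fin N)) x₁).symm y))
          (fderiv ℝ ((chartAt (EuclideanSpace ℝ (Fin N)) x₀) ∘
            (chartAt (EuclideanSpace ℝ (Fin N)) x₁).symm) y η)) := by
  set e₀ := chartAt (EuclideanSpace ℝ (Fin N)) x₀ with he₀
  set e₁ := chartAt (EuclideanSpace ℝ (Fin N)) x₁ with he₁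
  have hev : (e₁.symm : EuclideanSpace ℝ (Fin N) → M) =ᶠ[𝓝 y] e₀.symm ∘ (e₀ ∘ e₁.symm) := by
    filter_upwards [(e₁.symm.continuousAt hy).preimage_mem_nhds (e₀.open_source.mem_nhds hy')]
      with z hz
    exact (e₀.left_inv hz).symm
  have hd : ∀ ζ : EuclideanSpace ℝ (Fin N), (dsymm N x₁ y ζ : EuclideanSpace ℝ (Fin N)) =
      dsymm N x₀ (e₀ (e₁.symm y)) (fderiv ℝ (e₀ ∘ e₁.symm) y ζ) := by
    intro ζ
    have h1 : MDifferentiableAt (𝓡 N) (𝓡 N) e₀.symm ((e₀ ∘ e₁.symm) y) :=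
      mdifferentiableAt_chart_symm x₀ (e₀.map_source hy')
    have h2 : MDifferentiableAt (𝓡 N) (𝓡 N) (e₀ ∘ e₁.symm) y :=
      (mdifferentiableAt_chart x₀ hy').comp y (mdifferentiableAt_chart_symm x₁ hy)
    have h3 := hev.mfderiv_eq (I := 𝓡 N) (I' := 𝓡 N)
    rw [mfderiv_comp y h1 h2, mfderiv_eq_fderiv] at h3
    exact DFunLike.congr_fun h3 ζ
  refine (inner_tangentSpace_congr (e₀.left_inv hy').symm _ _).trans ?_
  exact congrArg₂ (fun v w : EuclideanSpace ℝ (Fin N) =>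
    inner (E := TangentSpace (𝓡 N) (e₀.symm (e₀ (e₁.symm y)))) ℝ v w) (hd ξ) (hd η)

/-- The Gram matrices are related by JᵀgJ, with J the Jacobian matrix of the transition map. Thus
√det g transforms as the change of variables formula requires. -/
theorem sqrt_det_gramMatrix_transition (x₀ x₁ : M) {y : EuclideanSpace ℝ (Fin N)}
    (hy : y ∈ (chartAt (EuclideanSpace ℝ (Fin N)) x₁).target)
    (hy' : (chartAt (EuclideanSpace ℝ (Fin N)) x₁).symm y ∈
      (chartAt (EuclideanSpace ℝ (Fin N)) x₀).source) :
    √(gramMatrix N x₁ y).det =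
      |(fderiv ℝ ((chartAt (EuclideanSpace ℝ (Fin N)) x₀) ∘
            (chartAt (EuclideanSpace ℝ (Fin N)) x₁).symm) y).det| *
      √(gramMatrix N x₀ (chartAt (EuclideanSpace ℝ (Fin N)) x₀
          ((chartAt (EuclideanSpace ℝ (Fin N)) x₁).symm y))).det := by
  set D := fderiv ℝ ((chartAt (EuclideanSpace ℝ (Fin N)) x₀) ∘
            (chartAt (EuclideanSpace ℝ (Fin N)) x₁).symm) y
  set z := chartAt (EuclideanSpace ℝ (Fin N)) x₀
          ((chartAt (EuclideanSpace ℝ (Fin N)) x₁).symm y)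
  let b := (EuclideanSpace.basisFun (Fin N) ℝ).toBasis
  set J : Matrix (Fin N) (Fin N) ℝ := LinearMap.toMatrix b b D.toLinearMap
  have hJ : ∀ k i, J k i = D (EuclideanSpace.single i 1) k := fun k i => by
    simp [J, b, LinearMap.toMatrix_apply]
  have hdet : J.det = D.det := by
    rw [LinearMap.det_toMatrix]
  have hG : gramMatrix N x₁ y = J.transpose * gramMatrix N x₀ z * J := by
    ext i j
    rw [gramMatrix_apply, inner_dsymm_transition x₀ x₁ hy hy', inner_dsymm]
    simp only [Matrix.mul_apply, Matrix.transpose_apply, hJ, Finset.sum_mul]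
    rw [Finset.sum_comm]
    refine Finset.sum_congr rfl fun k _ => Finset.sum_congr rfl fun l _ => ?_
    simp only [D, z]
    ring
  rw [hG, Matrix.det_mul, Matrix.det_mul, Matrix.det_transpose, hdet,
    show D.det * (gramMatrix N x₀ z).det * D.det = D.det ^ 2 * (gramMatrix N x₀ z).det by ring,
    Real.sqrt_mul (sq_nonneg _), Real.sqrt_sq_eq_abs]

variable [MeasurableSpace M] [BorelSpace M]

theorem aemeasurable_chart_symm (x₀ : M) (μ : Measure (EuclideanSpace ℝ (Fin N)))
    (hμ : μ ≪ volume.restrict (chartAt (EuclideanSpace ℝ (Fin N)) x₀).target) :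
    AEMeasurable (chartAt (EuclideanSpace ℝ (Fin N)) x₀).symm μ := by
  refine AEMeasurable.mono_ac ?_ hμ
  exact (chartAt (EuclideanSpace ℝ (Fin N)) x₀).continuousOn_symm.aemeasurable
    (chartAt (EuclideanSpace ℝ (Fin N)) x₀).open_target.measurableSet

theorem measurableSet_target_inter_symm_preimage (x₀ : M) {S : Set M} (hS : MeasurableSet S) :
    MeasurableSet ((chartAt (EuclideanSpace ℝ (Fin N)) x₀).target ∩
      (chartAt (EuclideanSpace ℝ (Fin N)) x₀).symm ⁻¹' S) := by
  set e := chartAt (EuclideanSpace ℝ (Fin N)) x₀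
  have h := (continuousOn_iff_continuous_domRestrict.1 e.continuousOn_symm).measurable hS
  convert MeasurableSet.subtype_image e.open_target.measurableSet h using 1
  ext y
  simp [and_comm]

theorem chartVolume_apply (x₀ : M) {S : Set M} (hS : MeasurableSet S) :
    chartVolume N x₀ S = ∫⁻ y in (chartAt (EuclideanSpace ℝ (Fin N)) x₀).target ∩
      (chartAt (EuclideanSpace ℝ (Fin N)) x₀).symm ⁻¹' S,
      ENNReal.ofReal √(gramMatrix N x₀ y).det := by
  set e := chartAt (EuclideanSpace ℝ (Fin N)) x₀
  have hT : MeasurableSet e.target := e.open_target.measurableSet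
  have hm : MeasurableSet (e.target ∩ e.symm ⁻¹' S) := measurableSet_target_inter_symm_preimage x₀ hS
  rw [chartVolume, Measure.map_apply_of_aemeasurable
    (aemeasurable_chart_symm x₀ _ (withDensity_absolutelyContinuous _ _)) hS]
  have : e.symm ⁻¹' S =ᵐ[(volume.restrict e.target).withDensity
      fun y => ENNReal.ofReal √(gramMatrix N x₀ y).det] (e.target ∩ e.symm ⁻¹' S : Set _) := by
    have h1 : ∀ᵐ y ∂(volume.restrict e.target).withDensity
      fun y => ENNReal.ofReal √(gramMatrix N x₀ y).det, y ∈ e.target :=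
      (withDensity_absolutelyContinuous _ _).ae_le (ae_restrict_mem hT)
    filter_upwards [h1] with y hy
    exact propext ⟨fun h => ⟨hy, h⟩, fun h => h.2⟩
  rw [measure_congr this, withDensity_apply _ hm, Measure.restrict_restrict hm]
  congr 2
  ext y; simp; tauto

/-- Change of variables along the transition map turns the left side into an integral over that part
of `S` which the chart at `x₁` also sees. This part may be smaller than `S`, hence only an
inequality. -/
theorem chartVolume_apply_le (x₀ x₁ : M) {S : Set M} (hS : MeasurableSet S)
    (hS₀ : S ⊆ (chartAt (EuclideanSpace ℝ (Fin N)) x₀).source) :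
    chartVolume N x₁ S ≤ chartVolume N x₀ S := by
  rw [chartVolume_apply x₀ hS, chartVolume_apply x₁ hS]
  set e₀ := chartAt (EuclideanSpace ℝ (Fin N)) x₀ with he₀
  set e₁ := chartAt (EuclideanSpace ℝ (Fin N)) x₁ with he₁
  have hm : MeasurableSet (e₁.target ∩ e₁.symm ⁻¹' S) := measurableSet_target_inter_symm_preimage x₁ hS
  have key := lintegral_image_eq_lintegral_abs_det_fderiv_mul (μ := volume) (f := e₀ ∘ e₁.symm)
    (f' := fderiv ℝ (e₀ ∘ e₁.symm)) hm
    (fun y hy => (differentiableAt_chart_transition x₀ x₁ hy.1 (hS₀ hy.2)).hasFDerivAt.hasFDerivWithinAt)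
    (fun y hy z hz h => e₁.symm.injOn hy.1 hz.1 (e₀.injOn (hS₀ hy.2) (hS₀ hz.2) h))
    (fun y => ENNReal.ofReal √(gramMatrix N x₀ y).det)
  calc _ = ∫⁻ y in e₁.target ∩ e₁.symm ⁻¹' S, ENNReal.ofReal |(fderiv ℝ (e₀ ∘ e₁.symm) y).det| *
        ENNReal.ofReal √(gramMatrix N x₀ ((e₀ ∘ e₁.symm) y)).det := by
        refine setLIntegral_congr_fun hm fun y hy => ?_
        rw [sqrt_det_gramMatrix_transition x₀ x₁ hy.1 (hS₀ hy.2),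
          ENNReal.ofReal_mul (abs_nonneg _)]
        rfl
    _ ≤ _ := by
        rw [← key]
        refine lintegral_mono_set ?_
        rintro _ ⟨y, hy, rfl⟩
        refine ⟨e₀.map_source (hS₀ hy.2), ?_⟩
        change e₀.symm (e₀ (e₁.symm y)) ∈ S
        rw [e₀.left_inv (hS₀ hy.2)]
        exact hy.2

end Volume

end

end RiemannianHardy

namespace RiemannianHardy

noncomputable section

/-! ### The Riemannian volume near a point, compared with Lebesgue measure. -/

section Volume

variable {N : ℕ} {M : Type*} [TopologicalSpace M] [ChartedSpace (EuclideanSpace ℝ (Fin N)) M]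
  [IsManifold (𝓡 N) ∞ M] [RiemannianBundle (fun x : M => TangentSpace (𝓡 N) x)]
  [MeasurableSpace M] [BorelSpace M]

/-- A supremum of measures is not computed set by set, so an upper bound for the whole family is
exhibited: the volume of the chart at `x₀` plus the Riemannian volume restricted to the complement
of its domain. The second term does not charge `S`. -/
theorem riemannianVolume_apply_of_subset_source (x₀ : M) {S : Set M} (hS : MeasurableSet S)
    (hS₀ : S ⊆ (chartAt (EuclideanSpace ℝ (Fin N)) x₀).source) :
    riemannianVolume N M S = chartVolume N x₀ S := by
  set s := (chartAt (EuclideanSpace ℝ (Fin N)) x₀).source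
  have hs : MeasurableSet s := (chartAt (EuclideanSpace ℝ (Fin N)) x₀).open_source.measurableSet
  have hle : ∀ x : M, chartVolume N x ≤ riemannianVolume N M := fun x =>
    le_iSup (fun x : M => chartVolume N x) x
  refine le_antisymm ?_ (hle x₀ S)
  have h : riemannianVolume N M ≤ chartVolume N x₀ + (riemannianVolume N M).restrict sᶜ := by
    refine iSup_le fun x => Measure.le_iff.2 fun T hT => ?_
    rw [← measure_inter_add_sdiff T hs, Measure.add_apply, Measure.restrict_apply hT]
    exact add_le_add ((chartVolume_apply_le x₀ x (hT.inter hs) inter_subset_right).trans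
      (measure_mono inter_subset_left)) (hle x _)
  refine (h S).trans ?_
  rw [Measure.add_apply, Measure.restrict_apply hS]
  have : S ∩ sᶜ = ∅ := by
    rw [← sdiff_eq, sdiff_eq_empty.2 hS₀]
  simp [this]

/-- A ball in a chart on which the Riemannian metric is comparable to the Euclidean one. -/
structure IsGoodBall (x₀ : M) (R C : ℝ) : Prop where
  R_pos : 0 < R
  C_pos : 0 < C
  subset_target : Metric.closedBall (chartAt (EuclideanSpace ℝ (Fin N)) x₀ x₀) R ⊆
    (chartAt (EuclideanSpace ℝ (Fin N)) x₀).target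
  norm_le : ∀ y ∈ Metric.closedBall (chartAt (EuclideanSpace ℝ (Fin N)) x₀ x₀) R,
    ∀ ξ : EuclideanSpace ℝ (Fin N), ‖dsymm N x₀ y ξ‖ ≤ C * ‖ξ‖
  le_norm : ∀ y ∈ Metric.closedBall (chartAt (EuclideanSpace ℝ (Fin N)) x₀ x₀) R,
    ∀ ξ : EuclideanSpace ℝ (Fin N), ‖ξ‖ ≤ C * ‖dsymm N x₀ y ξ‖
  det_le : ∀ y ∈ Metric.closedBall (chartAt (EuclideanSpace ℝ (Fin N)) x₀ x₀) R,
    √(gramMatrix N x₀ y).det ≤ C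
  le_det : ∀ y ∈ Metric.closedBall (chartAt (EuclideanSpace ℝ (Fin N)) x₀ x₀) R,
    C⁻¹ ≤ √(gramMatrix N x₀ y).det

variable (N) in
/-- The ball of radius `R` in the chart at `x₀`, as a subset of the manifold. -/
def chartBall (x₀ : M) (R : ℝ) : Set M :=
  (chartAt (EuclideanSpace ℝ (Fin N)) x₀).source ∩ chartAt (EuclideanSpace ℝ (Fin N)) x₀ ⁻¹'
    Metric.ball (chartAt (EuclideanSpace ℝ (Fin N)) x₀ x₀) R

theorem isOpen_chartBall (x₀ : M) (R : ℝ) : IsOpen (chartBall N x₀ R) :=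
  (chartAt (EuclideanSpace ℝ (Fin N)) x₀).isOpen_inter_preimage Metric.isOpen_ball

theorem mem_chartBall_self (x₀ : M) {R : ℝ} (hR : 0 < R) : x₀ ∈ chartBall N x₀ R :=
  ⟨mem_chart_source _ _, Metric.mem_ball_self hR⟩

theorem exists_isGoodBall [IsContMDiffRiemannianBundle (𝓡 N) ∞ (EuclideanSpace ℝ (Fin N))
      (fun x : M => TangentSpace (𝓡 N) x)] (x₀ : M) {O : Set M} (hO : O ∈ 𝓝 x₀) :
    ∃ R C : ℝ, IsGoodBall (N := N) x₀ R C ∧ chartBall N x₀ R ⊆ O := by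
  set e := chartAt (EuclideanSpace ℝ (Fin N)) x₀ with he
  have h1 : e.target ∩ e.symm ⁻¹' O ∈ 𝓝 (e x₀) := by
    refine inter_mem (e.open_target.mem_nhds (mem_chart_target _ _)) ?_
    refine (e.symm.continuousAt (mem_chart_target _ _)).preimage_mem_nhds ?_
    rw [e.left_inv (mem_chart_source _ _)]; exact hO
  obtain ⟨R, hR, hRs⟩ := Metric.nhds_basis_closedBall.mem_iff.1 h1
  have hK : IsCompact (Metric.closedBall (e x₀) R) := isCompact_closedBall _ _
  obtain ⟨C₁, h₁, b₁⟩ := exists_sqrt_det_bounds x₀ hK (fun y hy => (hRs hy).1)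
  obtain ⟨C₂, h₂, b₂⟩ := exists_norm_dsymm_bounds x₀ hK (fun y hy => (hRs hy).1)
  refine ⟨R, max C₁ C₂, ⟨hR, by positivity, fun y hy => (hRs hy).1, fun y hy ξ => ?_,
    fun y hy ξ => ?_, fun y hy => ?_, fun y hy => ?_⟩, ?_⟩
  · exact (b₂ y hy ξ).1.trans (by gcongr; simp)
  · exact (b₂ y hy ξ).2.trans (by gcongr; simp)
  · exact (b₁ y hy).1.trans (by simp)
  · exact le_trans (by gcongr; simp) (b₁ y hy).2
  · rintro x ⟨hx, hx'⟩
    have := (hRs (Metric.ball_subset_closedBall hx')).2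
    rwa [mem_preimage, e.left_inv hx] at this

namespace IsGoodBall

variable {x₀ : M} {R C : ℝ}

theorem symm_mem (h : IsGoodBall (N := N) x₀ R C) {y : EuclideanSpace ℝ (Fin N)}
    (hy : y ∈ Metric.ball (chartAt (EuclideanSpace ℝ (Fin N)) x₀ x₀) R) :
    (chartAt (EuclideanSpace ℝ (Fin N)) x₀).symm y ∈ chartBall N x₀ R := by
  have ht := h.subset_target (Metric.ball_subset_closedBall hy)
  refine ⟨(chartAt (EuclideanSpace ℝ (Fin N)) x₀).map_target ht, ?_⟩
  rwa [mem_preimage, (chartAt (EuclideanSpace ℝ (Fin N)) x₀).right_inv ht]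

theorem target_inter_preimage (h : IsGoodBall (N := N) x₀ R C) (S : Set M) :
    (chartAt (EuclideanSpace ℝ (Fin N)) x₀).target ∩
      (chartAt (EuclideanSpace ℝ (Fin N)) x₀).symm ⁻¹' (S ∩ chartBall N x₀ R) =
    (chartAt (EuclideanSpace ℝ (Fin N)) x₀).symm ⁻¹' S ∩
      Metric.ball (chartAt (EuclideanSpace ℝ (Fin N)) x₀ x₀) R := by
  ext y
  constructor
  · rintro ⟨ht, hS, hy⟩
    have := hy.2
    rw [mem_preimage, (chartAt (EuclideanSpace ℝ (Fin N)) x₀).right_inv ht] at this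
    exact ⟨hS, this⟩
  · rintro ⟨hS, hy⟩
    exact ⟨h.subset_target (Metric.ball_subset_closedBall hy), hS, h.symm_mem hy⟩

theorem aemeasurable_symm (h : IsGoodBall (N := N) x₀ R C) :
    AEMeasurable (chartAt (EuclideanSpace ℝ (Fin N)) x₀).symm (volume.restrict
      (Metric.ball (chartAt (EuclideanSpace ℝ (Fin N)) x₀ x₀) R)) :=
  aemeasurable_chart_symm x₀ _ (Measure.absolutelyContinuous_of_le
    (Measure.restrict_mono (Metric.ball_subset_closedBall.trans h.subset_target) le_rfl))

theorem riemannianVolume_apply (h : IsGoodBall (N := N) x₀ R C) {S : Set M}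
    (hS : MeasurableSet S) :
    (riemannianVolume N M).restrict (chartBall N x₀ R) S =
      ∫⁻ y in (chartAt (EuclideanSpace ℝ (Fin N)) x₀).symm ⁻¹' S ∩
        Metric.ball (chartAt (EuclideanSpace ℝ (Fin N)) x₀ x₀) R,
        ENNReal.ofReal √(gramMatrix N x₀ y).det := by
  have hm := hS.inter (isOpen_chartBall (N := N) x₀ R).measurableSet
  rw [Measure.restrict_apply hS, riemannianVolume_apply_of_subset_source x₀ hm
    (inter_subset_right.trans inter_subset_left), chartVolume_apply x₀ hm, h.target_inter_preimage]

theorem measurableSet_preimage (h : IsGoodBall (N := N) x₀ R C) {S : Set M}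
    (hS : MeasurableSet S) : MeasurableSet ((chartAt (EuclideanSpace ℝ (Fin N)) x₀).symm ⁻¹' S ∩
        Metric.ball (chartAt (EuclideanSpace ℝ (Fin N)) x₀ x₀) R) := by
  rw [← h.target_inter_preimage]
  exact measurableSet_target_inter_symm_preimage x₀
    (hS.inter (isOpen_chartBall (N := N) x₀ R).measurableSet)

/-- The density lies between C⁻¹ and C on the ball. Together with `map_le_restrict` this carries L²
estimates and null sets between the manifold and the coordinate ball. -/
theorem restrict_le_map (h : IsGoodBall (N := N) x₀ R C) :
    (riemannianVolume N M).restrict (chartBall N x₀ R) ≤ ENNReal.ofReal C • (volume.restrict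
      (Metric.ball (chartAt (EuclideanSpace ℝ (Fin N)) x₀ x₀) R)).map
        (chartAt (EuclideanSpace ℝ (Fin N)) x₀).symm := by
  refine Measure.le_iff.2 fun S hS => ?_
  rw [h.riemannianVolume_apply hS, Measure.smul_apply,
    Measure.map_apply_of_aemeasurable h.aemeasurable_symm hS,
    Measure.restrict_apply₀' Metric.isOpen_ball.measurableSet.nullMeasurableSet, smul_eq_mul,
    ← setLIntegral_const]
  exact setLIntegral_mono' (h.measurableSet_preimage hS) fun y hy =>
    ENNReal.ofReal_le_ofReal (h.det_le y (Metric.ball_subset_closedBall hy.2))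

theorem map_le_restrict (h : IsGoodBall (N := N) x₀ R C) :
    (volume.restrict (Metric.ball (chartAt (EuclideanSpace ℝ (Fin N)) x₀ x₀) R)).map
        (chartAt (EuclideanSpace ℝ (Fin N)) x₀).symm ≤
      ENNReal.ofReal C • (riemannianVolume N M).restrict (chartBall N x₀ R) := by
  refine Measure.le_iff.2 fun S hS => ?_
  have hC := h.C_pos
  rw [Measure.smul_apply, h.riemannianVolume_apply hS,
    Measure.map_apply_of_aemeasurable h.aemeasurable_symm hS,
    Measure.restrict_apply₀' Metric.isOpen_ball.measurableSet.nullMeasurableSet, smul_eq_mul]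
  have h1 : ENNReal.ofReal C⁻¹ * volume ((chartAt (EuclideanSpace ℝ (Fin N)) x₀).symm ⁻¹' S ∩
        Metric.ball (chartAt (EuclideanSpace ℝ (Fin N)) x₀ x₀) R) ≤
      ∫⁻ y in (chartAt (EuclideanSpace ℝ (Fin N)) x₀).symm ⁻¹' S ∩
        Metric.ball (chartAt (EuclideanSpace ℝ (Fin N)) x₀ x₀) R,
        ENNReal.ofReal √(gramMatrix N x₀ y).det := by
    rw [← setLIntegral_const]
    exact setLIntegral_mono' (h.measurableSet_preimage hS) fun y hy =>
      ENNReal.ofReal_le_ofReal (h.le_det y (Metric.ball_subset_closedBall hy.2))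
  refine le_trans (le_of_eq ?_) (mul_le_mul_right h1 _)
  rw [← mul_assoc, ← ENNReal.ofReal_mul hC.le, mul_inv_cancel₀ hC.ne', ENNReal.ofReal_one, one_mul]

theorem quasiMeasurePreserving_symm (h : IsGoodBall (N := N) x₀ R C) :
    (volume.restrict (Metric.ball (chartAt (EuclideanSpace ℝ (Fin N)) x₀ x₀) R)).map
        (chartAt (EuclideanSpace ℝ (Fin N)) x₀).symm ≪
      (riemannianVolume N M).restrict (chartBall N x₀ R) :=
  (Measure.absolutelyContinuous_of_le h.map_le_restrict).trans
    Measure.smul_absolutelyContinuous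

theorem ae_comp_symm (h : IsGoodBall (N := N) x₀ R C) {p : M → Prop}
    (hp : ∀ᵐ x ∂(riemannianVolume N M).restrict (chartBall N x₀ R), p x) :
    ∀ᵐ y ∂volume.restrict (Metric.ball (chartAt (EuclideanSpace ℝ (Fin N)) x₀ x₀) R),
      p ((chartAt (EuclideanSpace ℝ (Fin N)) x₀).symm y) :=
  ae_of_ae_map h.aemeasurable_symm (h.quasiMeasurePreserving_symm.ae_le hp)

/-- The exceptional set in coordinates need not be measurable, and the domination by the image
measure is usable only on measurable sets. Hence the passage to a measurable hull `T`, which is then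
pulled back by the chart. -/
theorem ae_of_ae_comp_symm (h : IsGoodBall (N := N) x₀ R C) {p : M → Prop}
    (hp : ∀ᵐ y ∂volume.restrict (Metric.ball (chartAt (EuclideanSpace ℝ (Fin N)) x₀ x₀) R),
      p ((chartAt (EuclideanSpace ℝ (Fin N)) x₀).symm y)) :
    ∀ᵐ x ∂(riemannianVolume N M).restrict (chartBall N x₀ R), p x := by
  set e := chartAt (EuclideanSpace ℝ (Fin N)) x₀
  set T := toMeasurable (volume.restrict (Metric.ball (e x₀) R)) {y | ¬ p (e.symm y)}
  have hT : volume.restrict (Metric.ball (e x₀) R) T = 0 := by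
    rw [measure_toMeasurable]; exact hp
  have hm : MeasurableSet (e.source ∩ e ⁻¹' T) := by
    have h := (continuousOn_iff_continuous_domRestrict.1 e.continuousOn).measurable
      (measurableSet_toMeasurable (volume.restrict (Metric.ball (e x₀) R)) {y | ¬ p (e.symm y)})
    convert MeasurableSet.subtype_image e.open_source.measurableSet h using 1
    ext y
    simp [T, and_comm]
  have hsub : ∀ x ∈ chartBall N x₀ R, ¬ p x → x ∈ e.source ∩ e ⁻¹' T := fun x hx hpx =>
    ⟨hx.1, subset_toMeasurable _ _ (by simpa [e.left_inv hx.1] using hpx)⟩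
  have hnull : (riemannianVolume N M).restrict (chartBall N x₀ R) (e.source ∩ e ⁻¹' T) = 0 := by
    refine le_antisymm ((h.restrict_le_map _).trans ?_) bot_le
    rw [Measure.smul_apply, Measure.map_apply_of_aemeasurable h.aemeasurable_symm hm]
    have : volume.restrict (Metric.ball (e x₀) R) (e.symm ⁻¹' (e.source ∩ e ⁻¹' T)) = 0 := by
      rw [Measure.restrict_apply₀' Metric.isOpen_ball.measurableSet.nullMeasurableSet] at hT ⊢
      refine measure_mono_null ?_ hT
      rintro y ⟨⟨_, hy⟩, hyB⟩
      have := e.right_inv (h.subset_target (Metric.ball_subset_closedBall hyB))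
      exact ⟨by simpa [this] using hy, hyB⟩
    rw [smul_eq_mul]
    exact (mul_eq_zero_of_right _ this).le
  rw [ae_iff]
  refine le_antisymm ?_ bot_le
  rw [← hnull, Measure.restrict_apply₀' (isOpen_chartBall x₀ R).measurableSet.nullMeasurableSet,
    Measure.restrict_apply₀' (isOpen_chartBall x₀ R).measurableSet.nullMeasurableSet]
  exact measure_mono fun x hx => ⟨hsub x hx.2 hx.1, hx.2⟩

theorem lintegral_le (h : IsGoodBall (N := N) x₀ R C) (F : M → ℝ≥0∞) :
    ∫⁻ x in chartBall N x₀ R, F x ∂riemannianVolume N M ≤ ENNReal.ofReal C *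
      ∫⁻ y in Metric.ball (chartAt (EuclideanSpace ℝ (Fin N)) x₀ x₀) R,
        F ((chartAt (EuclideanSpace ℝ (Fin N)) x₀).symm y) := by
  refine (lintegral_mono' h.restrict_le_map le_rfl).trans ?_
  rw [lintegral_smul_measure, smul_eq_mul]
  gcongr
  exact lintegral_map_le _ _

theorem eLpNorm_comp_symm_le {F : Type*} [NormedAddCommGroup F] (h : IsGoodBall (N := N) x₀ R C)
    {f : M → F} (hf : AEStronglyMeasurable f ((riemannianVolume N M).restrict (chartBall N x₀ R))) :
    eLpNorm (f ∘ (chartAt (EuclideanSpace ℝ (Fin N)) x₀).symm) 2 (volume.restrict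
      (Metric.ball (chartAt (EuclideanSpace ℝ (Fin N)) x₀ x₀) R)) ≤
      ENNReal.ofReal C ^ (1 / 2 : ℝ) *
        eLpNorm f 2 ((riemannianVolume N M).restrict (chartBall N x₀ R)) := by
  rw [← eLpNorm_map_measure (hf.mono_ac h.quasiMeasurePreserving_symm) h.aemeasurable_symm]
  refine (eLpNorm_mono_measure f h.map_le_restrict).trans ?_
  rw [eLpNorm_smul_measure_of_ne_top (by simp)]
  simp

theorem volume_lt_top (h : IsGoodBall (N := N) x₀ R C) :
    riemannianVolume N M (chartBall N x₀ R) < ⊤ := by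
  have := h.lintegral_le (fun _ => 1)
  simp only [lintegral_const, one_mul, Measure.restrict_apply_univ] at this
  exact this.trans_lt (ENNReal.mul_lt_top ENNReal.ofReal_lt_top measure_ball_lt_top)

theorem volume_pos (h : IsGoodBall (N := N) x₀ R C) :
    0 < riemannianVolume N M (chartBall N x₀ R) := by
  rw [pos_iff_ne_zero]
  intro h0
  have h1 : (riemannianVolume N M).restrict (chartBall N x₀ R) = 0 := by simpa using h0
  have h2 := h.ae_comp_symm (p := fun _ => False) (by simp [h1])
  simp only [Filter.eventually_false_iff_eq_bot, ae_eq_bot, Measure.restrict_eq_zero] at h2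
  exact (Metric.measure_ball_pos volume _ h.R_pos).ne' h2

end IsGoodBall

end Volume

end

end RiemannianHardy

namespace RiemannianHardy

noncomputable section

/-! ### Measurable vector fields and gradients. -/

section MeasurableFields

variable {N : ℕ} {M : Type*} [TopologicalSpace M] [ChartedSpace (EuclideanSpace ℝ (Fin N)) M]
  [IsManifold (𝓡 N) ∞ M] [RiemannianBundle (fun x : M => TangentSpace (𝓡 N) x)]
  [MeasurableSpace M] [BorelSpace M]

/-- A vector field is a.e. measurable on `U` if its components in the charts are. -/
def AEMeasurableField (U : Set M) (X : (x : M) → TangentSpace (𝓡 N) x) : Prop :=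
  ∀ x₀ : M, AEStronglyMeasurable (fun x => dchart N x₀ x (X x))
    ((riemannianVolume N M).restrict (U ∩ (chartAt (EuclideanSpace ℝ (Fin N)) x₀).source))

theorem IsW12.aemeasurableField {U : Set M} {ρ : M → ℝ} {G : (x : M) → TangentSpace (𝓡 N) x}
    (h : IsW12 N U ρ G) : AEMeasurableField U G := h.aestronglyMeasurable_grad

/-- By second countability, countably many chart domains cover the manifold. -/
theorem aestronglyMeasurable_of_chart_sources [SecondCountableTopology M] {U : Set M} {F : Type*}
    [TopologicalSpace F] [TopologicalSpace.PseudoMetrizableSpace F] {f : M → F}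
    (h : ∀ x₀ : M, AEStronglyMeasurable f ((riemannianVolume N M).restrict
      (U ∩ (chartAt (EuclideanSpace ℝ (Fin N)) x₀).source))) :
    AEStronglyMeasurable f ((riemannianVolume N M).restrict U) := by
  obtain ⟨s, hsc, hs⟩ := TopologicalSpace.countable_cover_nhds
    fun x : M => chart_source_mem_nhds (EuclideanSpace ℝ (Fin N)) x
  have := hsc.to_subtype
  have hU : U = ⋃ x : s, U ∩ (chartAt (EuclideanSpace ℝ (Fin N)) (x : M)).source := by
    rw [← inter_iUnion, iUnion_subtype, hs, inter_univ]
  rw [hU]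
  exact AEStronglyMeasurable.iUnion fun x => h x

namespace AEMeasurableField

variable {U : Set M} {X Y : (x : M) → TangentSpace (𝓡 N) x}

theorem mono {V : Set M} (hX : AEMeasurableField U X) (hVU : V ⊆ U) : AEMeasurableField V X :=
  fun x₀ => (hX x₀).mono_measure (Measure.restrict_mono (inter_subset_inter_left _ hVU) le_rfl)

theorem add (hX : AEMeasurableField U X) (hY : AEMeasurableField U Y) :
    AEMeasurableField U (fun x => X x + Y x) := fun x₀ => by
  simp only [map_add]
  exact (hX x₀).add (hY x₀)

theorem sub (hX : AEMeasurableField U X) (hY : AEMeasurableField U Y) :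
    AEMeasurableField U (fun x => X x - Y x) := fun x₀ => by
  simp only [map_sub]
  exact (hX x₀).sub (hY x₀)

theorem smul {f : M → ℝ} (hf : AEStronglyMeasurable f ((riemannianVolume N M).restrict U))
    (hX : AEMeasurableField U X) : AEMeasurableField U (fun x => f x • X x) := fun x₀ => by
  simp only [map_smul]
  exact (hf.mono_measure (Measure.restrict_mono inter_subset_left le_rfl)).smul (hX x₀)

variable [SecondCountableTopology M] [IsContMDiffRiemannianBundle (𝓡 N) ∞
  (EuclideanSpace ℝ (Fin N)) (fun x : M => TangentSpace (𝓡 N) x)]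

/-- In a chart the inner product is a sum of products of measurable components with the continuous
entries of the Gram matrix. -/
theorem aestronglyMeasurable_inner (hU : MeasurableSet U) (hX : AEMeasurableField U X) (hY : AEMeasurableField U Y) :
    AEStronglyMeasurable (fun x => inner ℝ (X x) (Y x)) ((riemannianVolume N M).restrict U) := by
  refine aestronglyMeasurable_of_chart_sources fun x₀ => ?_
  set e := chartAt (EuclideanSpace ℝ (Fin N)) x₀ with he
  have hm : MeasurableSet (U ∩ e.source) := hU.inter e.open_source.measurableSet
  have hg : ∀ i j, AEStronglyMeasurable (fun x => gramMatrix N x₀ (e x) i j)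
      ((riemannianVolume N M).restrict (U ∩ e.source)) := fun i j => by
    refine (ContinuousOn.aestronglyMeasurable (s := e.source) ?_ e.open_source.measurableSet).mono_measure
      (Measure.restrict_mono inter_subset_right le_rfl)
    exact (continuousOn_gramMatrix x₀ i j).comp e.continuousOn fun x hx => e.map_source hx
  have hcoord : ∀ (Z : (x : M) → TangentSpace (𝓡 N) x) (_ : AEMeasurableField U Z) i,
      AEStronglyMeasurable (fun x => dchart N x₀ x (Z x) i)
        ((riemannianVolume N M).restrict (U ∩ e.source)) := fun Z hZ i =>
    (EuclideanSpace.proj (𝕜 := ℝ) i).continuous.comp_aestronglyMeasurable (hZ x₀)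
  have hsum : AEStronglyMeasurable (fun x => ∑ i, ∑ j, dchart N x₀ x (X x) i *
      dchart N x₀ x (Y x) j * gramMatrix N x₀ (e x) i j)
        ((riemannianVolume N M).restrict (U ∩ e.source)) :=
    Finset.aestronglyMeasurable_fun_sum _ fun i _ => Finset.aestronglyMeasurable_fun_sum _ fun j _ =>
      ((hcoord X hX i).mul (hcoord Y hY j)).mul (hg i j)
  refine hsum.congr ?_
  filter_upwards [ae_restrict_mem hm] with x hx
  obtain ⟨y, hy, rfl⟩ : ∃ y ∈ e.target, e.symm y = x := ⟨e x, e.map_source hx.2, e.left_inv hx.2⟩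
  rw [← inner_dsymm, e.right_inv hy, dsymm_dchart x₀ hy, dsymm_dchart x₀ hy]

theorem aestronglyMeasurable_norm (hU : MeasurableSet U) (hX : AEMeasurableField U X) :
    AEStronglyMeasurable (fun x => ‖X x‖) ((riemannianVolume N M).restrict U) := by
  simp only [norm_eq_sqrt_real_inner]
  exact Real.continuous_sqrt.comp_aestronglyMeasurable (aestronglyMeasurable_inner hU hX hX)

end AEMeasurableField

variable [IsContMDiffRiemannianBundle (𝓡 N) ∞
    (EuclideanSpace ℝ (Fin N)) (fun x : M => TangentSpace (𝓡 N) x)]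

/-- In coordinates the gradient is g⁻¹ applied to the partial derivatives, and g⁻¹ is continuous by
Cramer's rule because the determinant does not vanish. -/
theorem continuousOn_dchart_grad {U : Set M} (hU : IsOpen U)
    {f : M → ℝ} (hf : ContMDiffOn (𝓡 N) 𝓘(ℝ, ℝ) 1 f U) (x₀ : M) :
    ContinuousOn (fun x => dchart N x₀ x (grad N f x))
      (U ∩ (chartAt (EuclideanSpace ℝ (Fin N)) x₀).source) := by
  set e := chartAt (EuclideanSpace ℝ (Fin N)) x₀ with he
  have hopen : IsOpen (e.target ∩ e.symm ⁻¹' U) := e.isOpen_inter_preimage_symm hU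
  have hfd : ContinuousOn (fderiv ℝ (f ∘ e.symm)) (e.target ∩ e.symm ⁻¹' U) := by
    have : ContMDiffOn (𝓡 N) 𝓘(ℝ, ℝ) 1 (f ∘ e.symm) (e.target ∩ e.symm ⁻¹' U) :=
      hf.comp ((contMDiffOn_chart_symm (I := 𝓡 N) (n := 1) (x := x₀)).mono inter_subset_left)
        inter_subset_right
    exact (contMDiffOn_iff_contDiffOn.1 this).continuousOn_fderiv_of_isOpen hopen le_rfl
  set w : EuclideanSpace ℝ (Fin N) → Fin N → ℝ := fun y => Matrix.mulVec (gramMatrix N x₀ y)⁻¹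
    fun i => fderiv ℝ (f ∘ e.symm) y (EuclideanSpace.single i 1) with hwdef
  have hw : ContinuousOn w (e.target ∩ e.symm ⁻¹' U) := by
    have hG : ContinuousOn (gramMatrix N x₀) (e.target ∩ e.symm ⁻¹' U) :=
      continuousOn_pi.2 fun i => continuousOn_pi.2 fun j =>
        (continuousOn_gramMatrix x₀ i j).mono inter_subset_left
    have hGi : ContinuousOn (fun y => (gramMatrix N x₀ y)⁻¹) (e.target ∩ e.symm ⁻¹' U) := by
      simp only [Matrix.inv_def, Ring.inverse_eq_inv']
      exact (((continuousOn_gramMatrix_det x₀).mono inter_subset_left).inv₀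
        fun y hy => (gramMatrix_det_pos x₀ hy.1).ne').smul
        (continuous_id.matrix_adjugate.comp_continuousOn hG)
    refine continuousOn_pi.2 fun i => ?_
    simp only [hwdef, Matrix.mulVec, dotProduct]
    refine continuousOn_finsetSum _ fun j _ => ContinuousOn.mul ?_ ?_
    · exact continuousOn_pi.1 (continuousOn_pi.1 hGi i) j
    · exact hfd.clm_apply continuousOn_const
  have hcomp : ContinuousOn (fun x => (WithLp.toLp 2 (w (e x)) : EuclideanSpace ℝ (Fin N)))
      (U ∩ e.source) :=
    (PiLp.continuous_toLp 2 _).comp_continuousOn (hw.comp (e.continuousOn.mono inter_subset_right)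
      fun x hx => ⟨e.map_source hx.2, by simpa [e.left_inv hx.2] using hx.1⟩)
  refine hcomp.congr fun x hx => ?_
  obtain ⟨y, hy, rfl⟩ : ∃ y ∈ e.target, e.symm y = x := ⟨e x, e.map_source hx.2, e.left_inv hx.2⟩
  change _ = WithLp.toLp 2 (w (e (e.symm y)))
  rw [e.right_inv hy]
  set ξ := dchart N x₀ (e.symm y) (grad N f (e.symm y)) with hξ
  have hdiff : MDifferentiableAt (𝓡 N) 𝓘(ℝ, ℝ) f (e.symm y) :=
    (hf.contMDiffAt (hU.mem_nhds hx.1)).mdifferentiableAt (by simp)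
  have hmul : (fun i => fderiv ℝ (f ∘ e.symm) y (EuclideanSpace.single i 1)) =
      Matrix.mulVec (gramMatrix N x₀ y) ξ := by
    funext i
    rw [fderiv_comp_chart_symm_eq_inner x₀ hy hdiff,
      ← dsymm_dchart x₀ hy (grad N f (e.symm y)), ← hξ, real_inner_comm, inner_dsymm]
    simp [Matrix.mulVec, dotProduct, mul_comm]
  have : w y = ξ := by
    simp only [hwdef, hmul]
    rw [Matrix.mulVec_mulVec, Matrix.nonsing_inv_mul _ (gramMatrix_det_pos x₀ hy).ne'.isUnit,
      Matrix.one_mulVec]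
  rw [this]

theorem aemeasurableField_grad {U : Set M} (hU : IsOpen U)
    {f : M → ℝ} (hf : ContMDiffOn (𝓡 N) 𝓘(ℝ, ℝ) 1 f U) : AEMeasurableField U (grad N f) :=
  fun x₀ => (continuousOn_dchart_grad hU hf x₀).aestronglyMeasurable
    (hU.inter (chartAt (EuclideanSpace ℝ (Fin N)) x₀).open_source).measurableSet

theorem continuous_norm_grad {f : M → ℝ} (hf : ContMDiff (𝓡 N) 𝓘(ℝ, ℝ) 1 f) :
    Continuous (fun x => ‖grad N f x‖) := by
  rw [continuous_iff_continuousAt]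
  intro x₀
  set e := chartAt (EuclideanSpace ℝ (Fin N)) x₀ with he
  have h := continuousOn_dchart_grad isOpen_univ hf.contMDiffOn x₀
  rw [univ_inter, ← he] at h
  have hi : ∀ i, ContinuousOn (fun x => dchart N x₀ x (grad N f x) i) e.source := fun i =>
    (EuclideanSpace.proj (𝕜 := ℝ) i).continuous.comp_continuousOn h
  have hsum : ContinuousOn (fun x => √(∑ i, ∑ j, dchart N x₀ x (grad N f x) i *
      dchart N x₀ x (grad N f x) j * gramMatrix N x₀ (e x) i j)) e.source :=
    ContinuousOn.sqrt <| continuousOn_finsetSum _ fun i _ => continuousOn_finsetSum _ fun j _ =>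
      ((hi i).mul (hi j)).mul ((continuousOn_gramMatrix x₀ i j).comp e.continuousOn
        fun x hx => e.map_source hx)
  refine (hsum.congr fun x hx => ?_).continuousAt (e.open_source.mem_nhds (mem_chart_source _ _))
  obtain ⟨y, hy, rfl⟩ : ∃ y ∈ e.target, e.symm y = x := ⟨e x, e.map_source hx, e.left_inv hx⟩
  simp only []
  rw [norm_eq_sqrt_real_inner, ← inner_dsymm, e.right_inv hy, dsymm_dchart x₀ hy]

end MeasurableFields

end

end RiemannianHardy

namespace RiemannianHardy

noncomputable section

/-! ### Uniform weighted bounds for mollification. -/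

section Mollification

open ContinuousLinearMap Convolution

variable {E : Type*} [NormedAddCommGroup E] [NormedSpace ℝ E] [FiniteDimensional ℝ E]
  [MeasurableSpace E] [BorelSpace E] (μ : Measure E) [μ.IsAddHaarMeasure]

theorem inv_measure_closedBall_le_normed (φ : ContDiffBump (0 : E)) {x : E} (hx : ‖x‖ ≤ φ.rIn) :
    (μ.real (Metric.closedBall (0 : E) φ.rOut))⁻¹ ≤ φ.normed μ x := by
  rw [ContDiffBump.normed_def, φ.one_of_mem_closedBall (by simpa using hx), one_div]
  exact inv_anti₀ φ.integral_pos (φ.integral_le_measure_closedBall μ)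

/-- A doubling bound for mollified averages. -/
theorem exists_mollified_average_bound : ∃ A : ℝ≥0∞, A ≠ ⊤ ∧ ∀ (φ : ContDiffBump (0 : E)),
    φ.rOut = 2 * φ.rIn → ∀ (r h : E → ℝ≥0∞) (B : ℝ≥0∞), AEMeasurable r μ →
    (∀ z, h z * ∫⁻ w, ENNReal.ofReal (φ.normed μ (z - w)) * r w ∂μ ≤ B) → ∀ y,
    ∫⁻ z, ENNReal.ofReal (φ.normed μ (z - y)) * (r z * h z) ∂μ ≤ A * B := by
  -- The cover is chosen at unit scale and rescaled by δ = `φ.rIn` afterwards, so the number of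
  -- pieces does not depend on φ.
  obtain ⟨t, -, htf, ht⟩ := (isCompact_closedBall (0 : E) 2).elim_finite_subcover_image
    (b := univ) (c := fun p => Metric.ball p (1 / 2)) (fun _ _ => Metric.isOpen_ball)
    (fun x _ => mem_biUnion (mem_univ x) (Metric.mem_ball_self (by norm_num)))
  lift t to Finset E using htf
  refine ⟨t.card * 2 ^ Module.finrank ℝ E, by finiteness, fun φ hφ r h B hr hB y => ?_⟩
  set δ := φ.rIn with hδ
  have δpos : 0 < δ := φ.rIn_pos
  set V₁ := μ (Metric.closedBall (0 : E) δ) with hV₁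
  set V₂ := μ (Metric.closedBall (0 : E) φ.rOut) with hV₂
  have V₁pos : V₁ ≠ 0 := (Metric.measure_closedBall_pos μ _ δpos).ne'
  have V₁top : V₁ ≠ ⊤ := measure_closedBall_lt_top.ne
  have V₂pos : V₂ ≠ 0 := (Metric.measure_closedBall_pos μ _ φ.rOut_pos).ne'
  have V₂top : V₂ ≠ ⊤ := measure_closedBall_lt_top.ne
  have hV : V₂ = 2 ^ Module.finrank ℝ E * V₁ := by
    rw [hV₁, hV₂, hφ, Measure.addHaar_closedBall_mul μ _ (by norm_num) δpos.le,
      Measure.addHaar_closedBall_center, ENNReal.ofReal_pow (by norm_num)]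
    simp
  have hlow : ∀ x : E, ‖x‖ ≤ δ → V₂⁻¹ ≤ ENNReal.ofReal (φ.normed μ x) := fun x hx => by
    have := ENNReal.ofReal_le_ofReal (inv_measure_closedBall_le_normed μ φ hx)
    rwa [Measure.real, ENNReal.ofReal_inv_of_pos (ENNReal.toReal_pos V₂pos V₂top),
      ENNReal.ofReal_toReal V₂top] at this
  have hup : ∀ x : E, ENNReal.ofReal (φ.normed μ x) ≤ V₁⁻¹ := fun x => by
    have := ENNReal.ofReal_le_ofReal (φ.normed_le_div_measure_closedBall_rIn μ x)
    rwa [Measure.real, one_div, ENNReal.ofReal_inv_of_pos (ENNReal.toReal_pos V₁pos V₁top),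
      ENNReal.ofReal_toReal V₁top] at this
  let P : E → Set E := fun p => Metric.closedBall (y + δ • p) (δ / 2)
  have hPm : ∀ p, MeasurableSet (P p) := fun p => measurableSet_closedBall
  -- Two points of `P p` are at distance at most δ, where the kernel is at least V₂⁻¹. So the
  -- mollified `r` at any z in the piece is at least V₂⁻¹ times the mass of `r` on the piece, and
  -- this mass times `h z` is at most V₂B. Taking the supremum of `h` over the piece gives the bound
  -- on the integral.
  have hpiece : ∀ p, ∫⁻ z in P p, r z * h z ∂μ ≤ V₂ * B := by
    intro p
    have h1 : ∀ z ∈ P p, (∫⁻ w in P p, r w ∂μ) * h z ≤ V₂ * B := by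
      intro z hz
      have h2 : V₂⁻¹ * ∫⁻ w in P p, r w ∂μ ≤
          ∫⁻ w, ENNReal.ofReal (φ.normed μ (z - w)) * r w ∂μ := by
        rw [← lintegral_const_mul'' _ hr.restrict]
        refine (setLIntegral_mono' (hPm p) fun w hw => ?_).trans (setLIntegral_le_lintegral _ _)
        gcongr
        refine hlow _ ?_
        rw [← dist_eq_norm]
        have := dist_triangle_right z w (y + δ • p)
        have a := Metric.mem_closedBall.1 hz
        have b := Metric.mem_closedBall.1 hw
        linarith
      calc (∫⁻ w in P p, r w ∂μ) * h z
          = V₂ * (h z * (V₂⁻¹ * ∫⁻ w in P p, r w ∂μ)) := by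
            rw [← mul_assoc, ← mul_assoc, mul_comm V₂, mul_assoc (h z),
              ENNReal.mul_inv_cancel V₂pos V₂top, mul_one, mul_comm]
        _ ≤ V₂ * B := by
            gcongr
            exact le_trans (by gcongr) (hB z)
    calc ∫⁻ z in P p, r z * h z ∂μ ≤ ∫⁻ z in P p, r z * (⨆ z ∈ P p, h z) ∂μ :=
          setLIntegral_mono' (hPm p) fun z hz => by
            gcongr; exact le_iSup₂ (f := fun z _ => h z) z hz
      _ = (∫⁻ z in P p, r z ∂μ) * (⨆ z ∈ P p, h z) := lintegral_mul_const'' _ hr.restrict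
      _ ≤ V₂ * B := by
          rw [ENNReal.mul_iSup]
          refine iSup_le fun z => ?_
          rw [ENNReal.mul_iSup]
          exact iSup_le fun hz => h1 z hz
  have hcover : ∀ z, z ∉ (⋃ p ∈ t, P p) → φ.normed μ (z - y) = 0 := by
    intro z hz
    by_contra hne
    apply hz
    have h1 : z - y ∈ Metric.ball (0 : E) φ.rOut := by
      rw [← φ.support_normed_eq (μ := μ)]; exact hne
    have h2 : δ⁻¹ • (z - y) ∈ Metric.closedBall (0 : E) 2 := by
      rw [mem_closedBall_zero_iff, norm_smul, norm_inv, Real.norm_of_nonneg δpos.le,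
        inv_mul_le_iff₀ δpos]
      rw [mem_ball_zero_iff, hφ] at h1
      linarith
    obtain ⟨p, hp, hp'⟩ := mem_iUnion₂.1 (ht h2)
    refine mem_iUnion₂.2 ⟨p, hp, ?_⟩
    rw [Metric.mem_ball, dist_eq_norm] at hp'
    change dist z (y + δ • p) ≤ δ / 2
    have : z - (y + δ • p) = δ • (δ⁻¹ • (z - y) - p) := by
      rw [smul_sub, smul_inv_smul₀ δpos.ne']; abel
    rw [dist_eq_norm, this, norm_smul, Real.norm_of_nonneg δpos.le]
    nlinarith
  calc ∫⁻ z, ENNReal.ofReal (φ.normed μ (z - y)) * (r z * h z) ∂μ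
      ≤ ∫⁻ z in ⋃ p ∈ t, P p, V₁⁻¹ * (r z * h z) ∂μ := by
        rw [← lintegral_indicator (Finset.measurableSet_biUnion _ fun p _ => hPm p)]
        refine lintegral_mono fun z => ?_
        by_cases hz : z ∈ ⋃ p ∈ t, P p
        · rw [indicator_of_mem hz]; gcongr; exact hup _
        · simp [hcover z hz]
    _ ≤ ∑ p ∈ t, ∫⁻ z in P p, V₁⁻¹ * (r z * h z) ∂μ := by
        clear ht hcover
        classical
        induction t using Finset.induction with
        | empty => simp
        | insert a t ha ih =>
          rw [Finset.set_biUnion_insert, Finset.sum_insert ha]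
          exact (lintegral_union_le _ _ _).trans (by gcongr)
    _ ≤ ∑ p ∈ t, V₁⁻¹ * (V₂ * B) := by
        refine Finset.sum_le_sum fun p _ => ?_
        rw [lintegral_const_mul' _ _ (by simpa using V₁pos)]
        gcongr
        exact hpiece p
    _ = t.card * 2 ^ Module.finrank ℝ E * B := by
        rw [Finset.sum_const, nsmul_eq_mul, hV, show V₁⁻¹ * (2 ^ Module.finrank ℝ E * V₁ * B) =
          V₁⁻¹ * V₁ * (2 ^ Module.finrank ℝ E * B) by ring,
          ENNReal.inv_mul_cancel V₁pos V₁top, one_mul, mul_assoc]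

theorem lintegral_ofReal_normed (φ : ContDiffBump (0 : E)) (z : E) :
    ∫⁻ w, ENNReal.ofReal (φ.normed μ (z - w)) ∂μ = 1 := by
  rw [lintegral_sub_left_eq_self (fun w => ENNReal.ofReal (φ.normed μ w)) z,
    ← ofReal_integral_eq_lintegral_ofReal φ.integrable_normed
      (Eventually.of_forall φ.nonneg_normed), φ.integral_normed, ENNReal.ofReal_one]

/-- Cauchy–Schwarz against the constant 1, for the probability measure with density the translated
kernel. -/
theorem sq_lintegral_normed_le (φ : ContDiffBump (0 : E)) (z : E) {f : E → ℝ≥0∞}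
    (hf : AEMeasurable f μ) :
    (∫⁻ w, ENNReal.ofReal (φ.normed μ (z - w)) * f w ∂μ) ^ 2 ≤
      ∫⁻ w, ENNReal.ofReal (φ.normed μ (z - w)) * f w ^ 2 ∂μ := by
  have hζ : Measurable fun w => ENNReal.ofReal (φ.normed μ (z - w)) :=
    ENNReal.measurable_ofReal.comp (φ.continuous_normed.measurable.comp (measurable_const.sub measurable_id))
  set ν := μ.withDensity fun w => ENNReal.ofReal (φ.normed μ (z - w))
  have hν : ν univ = 1 := by
    rw [withDensity_apply _ MeasurableSet.univ, Measure.restrict_univ, lintegral_ofReal_normed]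
  have hfν : AEMeasurable f ν := hf.mono_ac (withDensity_absolutelyContinuous _ _)
  have h := ENNReal.lintegral_mul_le_Lp_mul_Lq ν Real.HolderConjugate.two_two hfν
    (aemeasurable_const (b := (1 : ℝ≥0∞)))
  have e1 : ∀ g : E → ℝ≥0∞, AEMeasurable g μ →
      ∫⁻ w, ENNReal.ofReal (φ.normed μ (z - w)) * g w ∂μ = ∫⁻ w, g w ∂ν := fun g hg =>
    (lintegral_withDensity_eq_lintegral_mul₀ hζ.aemeasurable hg).symm
  rw [e1 f hf, e1 _ (hf.pow_const 2)]
  simp only [Pi.mul_apply, mul_one, ENNReal.one_rpow, lintegral_const, hν] at h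
  calc (∫⁻ w, f w ∂ν) ^ 2 ≤ ((∫⁻ w, f w ^ (2 : ℝ) ∂ν) ^ (1 / 2 : ℝ)) ^ 2 := by gcongr
    _ = ∫⁻ w, f w ^ 2 ∂ν := by
        rw [← ENNReal.rpow_natCast, ← ENNReal.rpow_mul]
        norm_num

/-- Jensen's inequality moves the square inside the average, and Tonelli's theorem then leaves the
average of `r * h` against the kernel, which `exists_mollified_average_bound` controls. The point is
that only `h` times the mollified `r` is assumed bounded, not `h * r`. -/
theorem exists_lintegral_mollified_sq_bound : ∃ A : ℝ≥0∞, A ≠ ⊤ ∧ ∀ (φ : ContDiffBump (0 : E)),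
    φ.rOut = 2 * φ.rIn → ∀ (r h f : E → ℝ≥0∞) (B : ℝ≥0∞), AEMeasurable r μ → AEMeasurable h μ →
    AEMeasurable f μ →
    (∀ z, h z * ∫⁻ w, ENNReal.ofReal (φ.normed μ (z - w)) * r w ∂μ ≤ B) →
    ∫⁻ z, r z * h z * (∫⁻ w, ENNReal.ofReal (φ.normed μ (z - w)) * f w ∂μ) ^ 2 ∂μ ≤
      A * B * ∫⁻ w, f w ^ 2 ∂μ := by
  obtain ⟨A, hA, hbound⟩ := exists_mollified_average_bound μ
  refine ⟨A, hA, fun φ hφ r h f B hr hh hf hB => ?_⟩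
  have hζ : Measurable fun p : E × E => ENNReal.ofReal (φ.normed μ (p.1 - p.2)) :=
    ENNReal.measurable_ofReal.comp (φ.continuous_normed.measurable.comp (measurable_fst.sub measurable_snd))
  calc ∫⁻ z, r z * h z * (∫⁻ w, ENNReal.ofReal (φ.normed μ (z - w)) * f w ∂μ) ^ 2 ∂μ
      ≤ ∫⁻ z, r z * h z * (∫⁻ w, ENNReal.ofReal (φ.normed μ (z - w)) * f w ^ 2 ∂μ) ∂μ := by
        gcongr with z; exact sq_lintegral_normed_le μ φ z hf
    _ = ∫⁻ z, ∫⁻ w, r z * h z * (ENNReal.ofReal (φ.normed μ (z - w)) * f w ^ 2) ∂μ ∂μ := by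
        refine lintegral_congr fun z => (lintegral_const_mul'' _ ?_).symm
        exact (hζ.comp measurable_prodMk_left).aemeasurable.mul (hf.pow_const 2)
    _ = ∫⁻ w, ∫⁻ z, r z * h z * (ENNReal.ofReal (φ.normed μ (z - w)) * f w ^ 2) ∂μ ∂μ := by
        refine lintegral_lintegral_swap ?_
        exact ((hr.mul hh).comp_fst).mul (hζ.aemeasurable.mul ((hf.pow_const 2).comp_snd))
    _ = ∫⁻ w, f w ^ 2 * ∫⁻ z, ENNReal.ofReal (φ.normed μ (z - w)) * (r z * h z) ∂μ ∂μ := by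
        refine lintegral_congr fun w => ?_
        rw [← lintegral_const_mul'']
        · exact lintegral_congr fun z => by ring
        · exact (hζ.comp measurable_prodMk_right).aemeasurable.mul (hr.mul hh)
    _ ≤ ∫⁻ w, f w ^ 2 * (A * B) ∂μ := by
        gcongr with w; exact hbound φ hφ r h B hr hB w
    _ = A * B * ∫⁻ w, f w ^ 2 ∂μ := by
        rw [lintegral_mul_const'' _ (hf.pow_const 2), mul_comm]

end Mollification

end

end RiemannianHardy

namespace RiemannianHardy

noncomputable section

/-! ### Weak differentials and convolution. -/

section Mollification

open ContinuousLinearMap Convolution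

variable {E : Type*} [NormedAddCommGroup E] [NormedSpace ℝ E] [FiniteDimensional ℝ E]
  [MeasurableSpace E] [BorelSpace E] (μ : Measure E) [μ.IsAddHaarMeasure]

theorem lintegral_mul_le_eLpNorm_mul {α : Type*} [MeasurableSpace α] {ν : Measure α} {F G : Type*}
    [NormedAddCommGroup F] [NormedAddCommGroup G] {f : α → F} {g : α → G}
    (hf : AEStronglyMeasurable f ν) (hg : AEStronglyMeasurable g ν) :
    ∫⁻ x, ‖f x‖ₑ * ‖g x‖ₑ ∂ν ≤ eLpNorm f 2 ν * eLpNorm g 2 ν := by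
  have h := ENNReal.lintegral_mul_le_Lp_mul_Lq ν Real.HolderConjugate.two_two hf.enorm hg.enorm
  rw [eLpNorm_eq_lintegral_rpow_enorm_toReal (by simp) (by simp),
    eLpNorm_eq_lintegral_rpow_enorm_toReal (by simp) (by simp)]
  simpa using h

/-- At a fixed point the convolution is an L² pairing of the second factor, reflected and
translated, with a fixed continuous function of compact support. -/
theorem tendsto_convolution_of_eLpNorm {F F' F'' : Type*} [NormedAddCommGroup F] [NormedSpace ℝ F]
    [NormedAddCommGroup F'] [NormedSpace ℝ F'] [NormedAddCommGroup F''] [NormedSpace ℝ F'']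
    (L : F →L[ℝ] F' →L[ℝ] F'') {a : E → F} (ha : Continuous a)
    (hac : HasCompactSupport a) {g : ℕ → E → F'} {g₀ : E → F'} (hg : ∀ n, MemLp (g n) 2 μ)
    (hg₀ : MemLp g₀ 2 μ) (hlim : Tendsto (fun n => eLpNorm (g n - g₀) 2 μ) atTop (𝓝 0)) (x : E) :
    Tendsto (fun n => (a ⋆[L, μ] g n) x) atTop (𝓝 ((a ⋆[L, μ] g₀) x)) := by
  obtain ⟨l, hl0, hl⟩ : ∃ l : ℝ, 0 ≤ l ∧ ∀ a b, ‖L a b‖ ≤ l * ‖a‖ * ‖b‖ :=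
    ⟨‖L‖, L.opNorm_nonneg, L.le_opNorm₂⟩
  have hex : ∀ {k : E → F'}, MemLp k 2 μ → Integrable (fun t => L (a t) (k (x - t))) μ := fun hk =>
    hac.convolutionExists_left L ha (hk.locallyIntegrable (by norm_num)) x
  refine tendsto_integral_of_L1 _ (hex hg₀).aestronglyMeasurable (Eventually.of_forall fun n => hex (hg n)) ?_
  have hbound : ∀ n, ∫⁻ t, ‖L (a t) (g n (x - t)) - L (a t) (g₀ (x - t))‖ₑ ∂μ ≤
      ENNReal.ofReal l * (eLpNorm a 2 μ * eLpNorm (g n - g₀) 2 μ) := by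
    intro n
    have hm : AEStronglyMeasurable (fun t => (g n - g₀) (x - t)) μ :=
      ((hg n).sub hg₀).aestronglyMeasurable.comp_quasiMeasurePreserving
        (quasiMeasurePreserving_sub_left μ x)
    have heq : eLpNorm (fun t => (g n - g₀) (x - t)) 2 μ = eLpNorm (g n - g₀) 2 μ := by
      rw [eLpNorm_eq_lintegral_rpow_enorm_toReal (by simp) (by simp),
        eLpNorm_eq_lintegral_rpow_enorm_toReal (by simp) (by simp),
        lintegral_sub_left_eq_self (fun t => ‖(g n - g₀) t‖ₑ ^ (2 : ℝ≥0∞).toReal) x]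
    rw [← heq]
    refine le_trans ?_ (mul_le_mul_right (lintegral_mul_le_eLpNorm_mul ha.aestronglyMeasurable hm) _)
    rw [← lintegral_const_mul' _ _ (by simp)]
    refine lintegral_mono fun t => ?_
    rw [← map_sub, ← ofReal_norm, ← ofReal_norm, ← ofReal_norm,
      ← ENNReal.ofReal_mul (norm_nonneg _), ← ENNReal.ofReal_mul hl0, ← mul_assoc]
    exact ENNReal.ofReal_le_ofReal (hl _ _)
  refine tendsto_of_tendsto_of_tendsto_of_le_of_le tendsto_const_nhds ?_ (fun _ => bot_le) hbound
  have hfin : eLpNorm a 2 μ ≠ ⊤ := (ha.memLp_of_hasCompactSupport hac).eLpNorm_ne_top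
  have := ENNReal.Tendsto.const_mul (a := ENNReal.ofReal l)
    (ENNReal.Tendsto.const_mul (a := eLpNorm a 2 μ) hlim (Or.inr hfin)) (Or.inr (by simp))
  simpa using this

/-- `D` is the weak differential of `r`, in the sense that `(r, D)` is the limit in `L²` of
compactly supported `C¹` functions together with their differentials. -/
structure HasL2WeakFDeriv (r : E → ℝ) (D : E → E →L[ℝ] ℝ) : Prop where
  memLp : MemLp r 2 μ
  memLp_fderiv : MemLp D 2 μ
  exists_approx : ∃ f : ℕ → E → ℝ, (∀ n, ContDiff ℝ 1 (f n)) ∧ (∀ n, HasCompactSupport (f n)) ∧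
    Tendsto (fun n => eLpNorm (f n - r) 2 μ) atTop (𝓝 0) ∧
    Tendsto (fun n => eLpNorm (fderiv ℝ (f n) - D) 2 μ) atTop (𝓝 0)

variable {μ}

/-- For the C¹ approximations the derivative may fall on either factor. With the derivative on ζ the
limit gives the left side, with the derivative on the approximation it gives the right side. -/
theorem HasL2WeakFDeriv.fderiv_convolution {r : E → ℝ} {D : E → E →L[ℝ] ℝ}
    (h : HasL2WeakFDeriv μ r D) {ζ : E → ℝ} (hζ : ContDiff ℝ 1 ζ) (hζc : HasCompactSupport ζ)
    (x : E) : fderiv ℝ (ζ ⋆[lsmul ℝ ℝ, μ] r) x = (ζ ⋆[lsmul ℝ ℝ, μ] D) x := by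
  obtain ⟨f, hf, hfc, hfr, hfD⟩ := h.exists_approx
  have hfd : ∀ n, MemLp (fderiv ℝ (f n)) 2 μ := fun n =>
    ((hf n).continuous_fderiv one_ne_zero).memLp_of_hasCompactSupport ((hfc n).fderiv ℝ)
  have hfm : ∀ n, MemLp (f n) 2 μ := fun n => (hf n).continuous.memLp_of_hasCompactSupport (hfc n)
  have hL : ((lsmul ℝ ℝ : ℝ →L[ℝ] ℝ →L[ℝ] ℝ).precompR E) = lsmul ℝ ℝ := by
    exact ContinuousLinearMap.ext fun a => ContinuousLinearMap.ext fun T => rfl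
  have h1 : ∀ n, (fderiv ℝ ζ ⋆[(lsmul ℝ ℝ).precompL E, μ] f n) x =
      (ζ ⋆[lsmul ℝ ℝ, μ] fderiv ℝ (f n)) x := fun n => by
    rw [← hL]
    exact (hζc.hasFDerivAt_convolution_left (lsmul ℝ ℝ) hζ
      (hf n).continuous.locallyIntegrable x).unique ((hfc n).hasFDerivAt_convolution_right
        (lsmul ℝ ℝ) hζ.continuous.locallyIntegrable (hf n) x)
  have h2 := tendsto_convolution_of_eLpNorm μ ((lsmul ℝ ℝ : ℝ →L[ℝ] ℝ →L[ℝ] ℝ).precompL E)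
    (hζ.continuous_fderiv one_ne_zero) (hζc.fderiv ℝ) hfm h.memLp hfr x
  have h3 := tendsto_convolution_of_eLpNorm μ (lsmul ℝ ℝ : ℝ →L[ℝ] (E →L[ℝ] ℝ) →L[ℝ] (E →L[ℝ] ℝ))
    hζ.continuous hζc hfd h.memLp_fderiv hfD x
  simp only [h1] at h2
  rw [(hζc.hasFDerivAt_convolution_left (lsmul ℝ ℝ) hζ
    (h.memLp.locallyIntegrable (by norm_num)) x).fderiv]
  exact tendsto_nhds_unique h2 h3

end Mollification

end

end RiemannianHardy

/-! ### Convergence of mollifications in weighted L². -/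

namespace RiemannianHardy

noncomputable section

theorem eLpNorm_two_sq {α F : Type*} [MeasurableSpace α] {ν : Measure α} [NormedAddCommGroup F]
    (f : α → F) : eLpNorm f 2 ν ^ 2 = ∫⁻ x, ‖f x‖ₑ ^ 2 ∂ν := by
  rw [eLpNorm_eq_lintegral_rpow_enorm_toReal (by simp) (by simp), ← ENNReal.rpow_natCast,
    ← ENNReal.rpow_mul]
  simp

theorem eLpNorm_two_le_iff {α β F G : Type*} [MeasurableSpace α] {ν : Measure α}
    [MeasurableSpace β] {ν' : Measure β} [NormedAddCommGroup F] [NormedAddCommGroup G]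
    {f : α → F} {g : β → G} {K : ℝ≥0∞} :
    eLpNorm f 2 ν ≤ K ^ (1 / 2 : ℝ) * eLpNorm g 2 ν' ↔
      ∫⁻ x, ‖f x‖ₑ ^ 2 ∂ν ≤ K * ∫⁻ x, ‖g x‖ₑ ^ 2 ∂ν' := by
  rw [← eLpNorm_two_sq, ← eLpNorm_two_sq]
  have h : (K ^ (1 / 2 : ℝ) * eLpNorm g 2 ν') ^ 2 = K * eLpNorm g 2 ν' ^ 2 := by
    rw [mul_pow, ← ENNReal.rpow_natCast (K ^ (1 / 2 : ℝ)), ← ENNReal.rpow_mul]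
    simp
  rw [← h]
  exact (ENNReal.pow_right_strictMono two_ne_zero).le_iff_le.symm

theorem tendsto_eLpNorm_two_iff {α F ι : Type*} [MeasurableSpace α] {ν : Measure α}
    [NormedAddCommGroup F] {l : Filter ι} {f : ι → α → F} :
    Tendsto (fun i => eLpNorm (f i) 2 ν) l (𝓝 0) ↔
      Tendsto (fun i => ∫⁻ x, ‖f i x‖ₑ ^ 2 ∂ν) l (𝓝 0) := by
  simp_rw [← eLpNorm_two_sq]
  refine ⟨fun h => by simpa using ENNReal.Tendsto.pow (n := 2) h, fun h => ?_⟩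
  have := (ENNReal.continuous_rpow_const (y := (1 / 2 : ℝ))).tendsto 0 |>.comp h
  simp only [Function.comp_def] at this
  simp_rw [← ENNReal.rpow_natCast, ← ENNReal.rpow_mul] at this
  simpa using this

/-- The last step of a density argument: η is the error of approximation in the dense class, κ the
uniform operator bound, and `t` the error for the approximating element. -/
theorem tendsto_zero_of_forall_le_add {s : ℕ → ℝ≥0∞} {κ : ℝ≥0∞} (hκ : κ ≠ ⊤)
    (h : ∀ η : ℝ≥0∞, η ≠ 0 → ∃ t : ℕ → ℝ≥0∞, Tendsto t atTop (𝓝 0) ∧ ∀ k, s k ≤ κ * η + t k) :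
    Tendsto s atTop (𝓝 0) := by
  rw [ENNReal.tendsto_nhds_zero]
  intro ε hε
  have h1 : ε / 2 / (κ + 1) ≠ 0 :=
    (ENNReal.div_pos (ENNReal.half_pos hε.ne').ne' (by finiteness)).ne'
  obtain ⟨t, ht, hst⟩ := h _ h1
  filter_upwards [ENNReal.tendsto_nhds_zero.1 ht (ε / 2) (ENNReal.half_pos hε.ne')] with k hk
  refine (hst k).trans ?_
  rw [← ENNReal.add_halves ε]
  gcongr
  refine le_trans (mul_le_mul_left (le_self_add : κ ≤ κ + 1) _) ?_
  rw [ENNReal.add_halves, ENNReal.mul_div_cancel (by simp) (by finiteness)]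

section Mollification

open ContinuousLinearMap Convolution

variable {E : Type*} [NormedAddCommGroup E] [NormedSpace ℝ E] [FiniteDimensional ℝ E]
  [MeasurableSpace E] [BorelSpace E] (μ : Measure E) [μ.IsAddHaarMeasure]

theorem enorm_normed_convolution_le {G : Type*} [NormedAddCommGroup G] [NormedSpace ℝ G]
    (φ : ContDiffBump (0 : E)) (X : E → G) (z : E) :
    ‖(φ.normed μ ⋆[lsmul ℝ ℝ, μ] X) z‖ₑ ≤
      ∫⁻ w, ENNReal.ofReal (φ.normed μ (z - w)) * ‖X w‖ₑ ∂μ := by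
  rw [convolution_eq_swap]
  refine (enorm_integral_le_lintegral_enorm _).trans (le_of_eq (lintegral_congr fun w => ?_))
  rw [lsmul_apply, enorm_smul, Real.enorm_of_nonneg (φ.nonneg_normed _)]

theorem ofReal_normed_convolution (φ : ContDiffBump (0 : E)) {r : E → ℝ} (hr : LocallyIntegrable r μ)
    (hr0 : ∀ᵐ x ∂μ, 0 ≤ r x) (z : E) :
    ENNReal.ofReal ((φ.normed μ ⋆[lsmul ℝ ℝ, μ] r) z) =
      ∫⁻ w, ENNReal.ofReal (φ.normed μ (z - w)) * ENNReal.ofReal (r w) ∂μ := by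
  have hex := φ.hasCompactSupport_normed (μ := μ) |>.convolutionExists_left (lsmul ℝ ℝ)
    φ.continuous_normed hr z
  rw [convolution_eq_swap, ofReal_integral_eq_lintegral_ofReal hex.integrable_swap]
  · refine lintegral_congr fun w => ?_
    rw [lsmul_apply, smul_eq_mul, ENNReal.ofReal_mul (φ.nonneg_normed _)]
  · filter_upwards [hr0] with w hw
    exact mul_nonneg (φ.nonneg_normed _) hw

theorem normed_convolution_nonneg (φ : ContDiffBump (0 : E)) {r : E → ℝ}
    (hr0 : ∀ᵐ x ∂μ, 0 ≤ r x) (z : E) : 0 ≤ (φ.normed μ ⋆[lsmul ℝ ℝ, μ] r) z := by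
  rw [convolution_eq_swap]
  refine integral_nonneg_of_ae ?_
  filter_upwards [hr0] with w hw
  exact mul_nonneg (φ.nonneg_normed _) hw

theorem normed_convolution_sub {G : Type*} [NormedAddCommGroup G] [NormedSpace ℝ G]
    (φ : ContDiffBump (0 : E)) {X Y : E → G} (hX : LocallyIntegrable X μ)
    (hY : LocallyIntegrable Y μ) (z : E) :
    (φ.normed μ ⋆[lsmul ℝ ℝ, μ] (X - Y)) z =
      (φ.normed μ ⋆[lsmul ℝ ℝ, μ] X) z - (φ.normed μ ⋆[lsmul ℝ ℝ, μ] Y) z := by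
  have hex := fun {Z : E → G} (hZ : LocallyIntegrable Z μ) =>
    φ.hasCompactSupport_normed (μ := μ) |>.convolutionExists_left (lsmul ℝ ℝ)
      φ.continuous_normed hZ z
  simp only [convolution_def, Pi.sub_apply, map_sub]
  exact integral_sub (hex hX) (hex hY)

variable {μ}

variable (E) in
/-- A sequence of bump functions shrinking to the origin. -/
def mollifier (k : ℕ) : ContDiffBump (0 : E) :=
  ⟨1 / (2 * (k + 1)), 1 / (k + 1), by positivity, by
    apply one_div_lt_one_div_of_lt <;> linarith [(Nat.cast_nonneg k : (0 : ℝ) ≤ k)]⟩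

/-- The fixed ratio of the radii is what both the doubling bound and the almost everywhere
convergence of the mollifications rely on. -/
theorem mollifier_rOut (k : ℕ) : (mollifier E k).rOut = 2 * (mollifier E k).rIn := by
  simp only [mollifier]; field_simp

theorem tendsto_mollifier_rOut : Tendsto (fun k => (mollifier E k).rOut) atTop (𝓝 0) :=
  tendsto_one_div_add_atTop_nhds_zero_nat

theorem ae_tendsto_mollifier {r : E → ℝ} (hr : LocallyIntegrable r μ) : ∀ᵐ x ∂μ,
    Tendsto (fun k => ((mollifier E k).normed μ ⋆[lsmul ℝ ℝ, μ] r) x) atTop (𝓝 (r x)) :=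
  ContDiffBump.ae_convolution_tendsto_right_of_locallyIntegrable (K := 2) tendsto_mollifier_rOut
    (Eventually.of_forall fun k => (mollifier_rOut k).le) hr

-- With F_k the mollification of `r`, the bound on c(t)²t makes X ↦ c(F_k)(φ_k * X) bounded from
-- L²(μ) to L²(rμ) uniformly in k, by `exists_lintegral_mollified_sq_bound`. The candidate limit X ↦
-- c(r)X is bounded for the same reason. This reduces the claim to continuous X of compact support,
-- where everything is bounded and rμ is finite, so dominated convergence applies.
set_option maxHeartbeats 1000000 in
theorem tendsto_weighted_mollification {G : Type*} [NormedAddCommGroup G] [NormedSpace ℝ G]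
    [CompleteSpace G]
    {r : E → ℝ} {D : E → G} (hD : MemLp D 2 μ) (hr0 : ∀ᵐ x ∂μ, 0 ≤ r x) (hri : Integrable r μ)
    {c : ℝ → ℝ} (hc : Continuous c) {C : ℝ} (hcb : ∀ t, |c t| ≤ C)
    (hct : ∀ t, 0 ≤ t → c t ^ 2 * t ≤ C) :
    Tendsto (fun k => ∫⁻ x, ENNReal.ofReal (r x) *
        ‖c (((mollifier E k).normed μ ⋆[lsmul ℝ ℝ, μ] r) x) •
          ((mollifier E k).normed μ ⋆[lsmul ℝ ℝ, μ] D) x - c (r x) • D x‖ₑ ^ 2 ∂μ)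
      atTop (𝓝 0) := by
  let φ : ℕ → ContDiffBump (0 : E) := mollifier E
  have hφ : ∀ k, (φ k).rOut = 2 * (φ k).rIn := mollifier_rOut
  have hφ0 : Tendsto (fun k => (φ k).rOut) atTop (𝓝 0) := tendsto_mollifier_rOut
  have hrl : LocallyIntegrable r μ := hri.locallyIntegrable
  have hDl : LocallyIntegrable D μ := hD.locallyIntegrable (by norm_num)
  set F : ℕ → E → ℝ := fun k => (φ k).normed μ ⋆[lsmul ℝ ℝ, μ] r with hF
  have hFd : ∀ k, ContDiff ℝ 1 (F k) := fun k =>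
    (φ k).hasCompactSupport_normed.contDiff_convolution_left _ (φ k).contDiff_normed hrl
  have hFn : ∀ k x, 0 ≤ F k x := fun k x => normed_convolution_nonneg μ (φ k) hr0 x
  have hFt : ∀ᵐ x ∂μ, Tendsto (fun k => F k x) atTop (𝓝 (r x)) := ae_tendsto_mollifier hrl
  have hC : 0 ≤ C := (abs_nonneg _).trans (hcb 0)
  set ν := μ.withDensity fun x => ENNReal.ofReal (r x) with hν
  have hνμ : ν ≪ μ := withDensity_absolutelyContinuous _ _
  have hrm : AEMeasurable (fun x => ENNReal.ofReal (r x)) μ :=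
    hri.aestronglyMeasurable.aemeasurable.ennreal_ofReal
  have hνint : ∀ g : E → ℝ≥0∞, ∫⁻ x, g x ∂ν = ∫⁻ x, ENNReal.ofReal (r x) * g x ∂μ := fun g =>
    lintegral_withDensity_eq_lintegral_mul_non_measurable₀ _ hrm
      (Eventually.of_forall fun x => ENNReal.ofReal_lt_top) g
  set T : ℕ → (E → G) → E → G := fun k X z =>
    c (F k z) • ((φ k).normed μ ⋆[lsmul ℝ ℝ, μ] X) z with hT
  have hcF : ∀ k, Continuous fun z => c (F k z) := fun k => hc.comp (hFd k).continuous
  have hTm : ∀ k X, LocallyIntegrable X μ → AEStronglyMeasurable (T k X) ν := fun k X hX =>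
    ((hcF k).smul ((φ k).hasCompactSupport_normed.continuous_convolution_left _
      (φ k).continuous_normed hX)).aestronglyMeasurable
  have hcr : AEStronglyMeasurable (fun z => c (r z)) ν :=
    hc.comp_aestronglyMeasurable (hri.aestronglyMeasurable.mono_ac hνμ)
  -- uniform boundedness
  obtain ⟨A, hA, hAb⟩ := exists_lintegral_mollified_sq_bound μ
  have hTb : ∀ k X, AEStronglyMeasurable X μ → eLpNorm (T k X) 2 ν ≤
      (A * ENNReal.ofReal C) ^ (1 / 2 : ℝ) * eLpNorm X 2 μ := by
    intro k X hX
    rw [eLpNorm_two_le_iff, hνint]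
    refine le_trans (lintegral_mono fun z => ?_) (hAb (φ k) (hφ k) (fun x => ENNReal.ofReal (r x))
      (fun z => ENNReal.ofReal (c (F k z) ^ 2)) (fun w => ‖X w‖ₑ) (ENNReal.ofReal C) hrm
      ((hcF k).pow 2).measurable.ennreal_ofReal.aemeasurable hX.enorm fun z => ?_)
    · simp only [hT]
      rw [enorm_smul, mul_pow, mul_assoc, ← ofReal_norm (c (F k z)), ← ENNReal.ofReal_pow (norm_nonneg _),
        Real.norm_eq_abs, sq_abs]
      gcongr
      exact enorm_normed_convolution_le μ _ _ _
    · rw [← ofReal_normed_convolution μ (φ k) hrl hr0 z, ← ENNReal.ofReal_mul (sq_nonneg _)]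
      exact ENNReal.ofReal_le_ofReal (hct _ (hFn k z))
  have hcb' : ∀ X : E → G, eLpNorm (fun z => c (r z) • X z) 2 ν ≤
      (ENNReal.ofReal C) ^ (1 / 2 : ℝ) * eLpNorm X 2 μ := by
    intro X
    rw [eLpNorm_two_le_iff, hνint, ← lintegral_const_mul' _ _ ENNReal.ofReal_ne_top]
    refine lintegral_mono_ae ?_
    filter_upwards [hr0] with z hz
    rw [enorm_smul, mul_pow, ← mul_assoc, ← ofReal_norm (c (r z)), ← ENNReal.ofReal_pow (norm_nonneg _),
        Real.norm_eq_abs, sq_abs, ← ENNReal.ofReal_mul hz]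
    gcongr
    rw [mul_comm]
    exact hct _ hz
  -- convergence for continuous fields of compact support
  have hTg : ∀ g : E → G, Continuous g → HasCompactSupport g →
      Tendsto (fun k => eLpNorm (T k g - fun z => c (r z) • g z) 2 ν) atTop (𝓝 0) := by
    intro g hg hgc
    obtain ⟨S, hS⟩ := hgc.exists_bound_of_continuous hg
    have hS0 : 0 ≤ S := (norm_nonneg _).trans (hS 0)
    rw [tendsto_eLpNorm_two_iff]
    have hbd : ∀ k z, ‖((φ k).normed μ ⋆[lsmul ℝ ℝ, μ] g) z‖ ≤ S := by
      intro k z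
      have h1 := enorm_normed_convolution_le μ (φ k) g z
      have h2 : ∫⁻ w, ENNReal.ofReal ((φ k).normed μ (z - w)) * ‖g w‖ₑ ∂μ ≤ ENNReal.ofReal S := by
        calc _ ≤ ∫⁻ w, ENNReal.ofReal ((φ k).normed μ (z - w)) * ENNReal.ofReal S ∂μ := by
              gcongr with w
              rw [← ofReal_norm]; exact ENNReal.ofReal_le_ofReal (hS w)
          _ = ENNReal.ofReal S := by
              rw [lintegral_mul_const' _ _ ENNReal.ofReal_ne_top, lintegral_ofReal_normed, one_mul]
      have h3 := h1.trans h2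
      rwa [← ofReal_norm, ENNReal.ofReal_le_ofReal_iff hS0] at h3
    have hz : ∫⁻ _, (0 : ℝ≥0∞) ∂ν = 0 := lintegral_zero
    rw [← hz]
    refine tendsto_lintegral_of_dominated_convergence' (fun _ => ENNReal.ofReal (C * S + C * S) ^ 2)
      (fun k => ?_) (fun k => ?_) ?_ ?_
    · exact (((hTm k g hg.locallyIntegrable).sub (hcr.smul hg.aestronglyMeasurable)).enorm).pow_const 2
    · refine Eventually.of_forall fun z => ?_
      simp only [Pi.sub_apply, hT]
      gcongr
      rw [← ofReal_norm]
      refine ENNReal.ofReal_le_ofReal ((norm_sub_le _ _).trans ?_)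
      rw [norm_smul, norm_smul]
      exact add_le_add (mul_le_mul (hcb _) (hbd k z) (norm_nonneg _) hC)
        (mul_le_mul (hcb _) (hS z) (norm_nonneg _) hC)
    · rw [lintegral_const, hν, withDensity_apply _ MeasurableSet.univ, Measure.restrict_univ]
      exact ENNReal.mul_ne_top (by finiteness) hri.lintegral_lt_top.ne
    · filter_upwards [hνμ.ae_le hFt] with z hz
      have h1 : Tendsto (fun k => T k g z) atTop (𝓝 (c (r z) • g z)) :=
        ((hc.tendsto _).comp hz).smul
          (ContDiffBump.convolution_tendsto_right_of_continuous hφ0 hg z)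
      have h2 := (tendsto_sub_nhds_zero_iff.2 h1).enorm
      have h3 := ENNReal.Tendsto.pow (n := 2) h2
      rwa [enorm_zero, zero_pow two_ne_zero] at h3
  -- density
  have hgoal : Tendsto (fun k => eLpNorm (T k D - fun z => c (r z) • D z) 2 ν) atTop (𝓝 0) := by
    set κ := (A * ENNReal.ofReal C) ^ (1 / 2 : ℝ) + ENNReal.ofReal C ^ (1 / 2 : ℝ) with hκ
    have hκt : κ ≠ ⊤ := by
      have : A * ENNReal.ofReal C ≠ ⊤ := by finiteness
      exact ENNReal.add_ne_top.2 ⟨by finiteness, by finiteness⟩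
    refine tendsto_zero_of_forall_le_add hκt fun η hη => ?_
    obtain ⟨g, hgc, hgD, hg, hgm⟩ := hD.exists_hasCompactSupport_eLpNorm_sub_le
      (by simp) hη
    refine ⟨_, hTg g hg hgc, fun k => ?_⟩
    have hsplit : (T k D - fun z => c (r z) • D z) = T k (D - g) +
        ((T k g - fun z => c (r z) • g z) + fun z => c (r z) • (g - D) z) := by
      funext z
      simp only [hT, Pi.sub_apply, Pi.add_apply,
        normed_convolution_sub μ (φ k) hDl hg.locallyIntegrable, smul_sub]
      abel
    have hm1 := hTm k (D - g) (hDl.sub hg.locallyIntegrable)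
    have hm2 := (hTm k g hg.locallyIntegrable).sub (hcr.smul hg.aestronglyMeasurable)
    have hm3 : AEStronglyMeasurable (fun z => c (r z) • (g - D) z) ν :=
      hcr.smul ((hg.aestronglyMeasurable.sub hD.aestronglyMeasurable).mono_ac hνμ)
    rw [hsplit]
    calc _ ≤ eLpNorm (T k (D - g)) 2 ν + (eLpNorm (T k g - fun z => c (r z) • g z) 2 ν +
            eLpNorm (fun z => c (r z) • (g - D) z) 2 ν) :=
          (eLpNorm_add_le hm1 (hm2.add hm3) (by norm_num)).trans
            (by gcongr; exact eLpNorm_add_le hm2 hm3 (by norm_num))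
      _ ≤ (A * ENNReal.ofReal C) ^ (1 / 2 : ℝ) * η + (eLpNorm (T k g - fun z => c (r z) • g z) 2 ν
            + ENNReal.ofReal C ^ (1 / 2 : ℝ) * η) := by
          refine add_le_add ((hTb k _ (hD.aestronglyMeasurable.sub
            hg.aestronglyMeasurable)).trans (mul_le_mul_right hgD _)) (add_le_add le_rfl ?_)
          refine (hcb' (g - D)).trans (mul_le_mul_right ?_ _)
          rwa [eLpNorm_sub_comm]
      _ = κ * η + eLpNorm (T k g - fun z => c (r z) • g z) 2 ν := by rw [hκ]; ring
  rw [tendsto_eLpNorm_two_iff] at hgoal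
  refine hgoal.congr fun k => ?_
  rw [hνint]
  refine lintegral_congr fun z => ?_
  rfl

theorem HasL2WeakFDeriv.exists_mollification {r : E → ℝ} {D : E → E →L[ℝ] ℝ}
    (h : HasL2WeakFDeriv μ r D) (hr0 : ∀ᵐ x ∂μ, 0 ≤ r x) (hri : Integrable r μ)
    {c : ℝ → ℝ} (hc : Continuous c) {C : ℝ} (hcb : ∀ t, |c t| ≤ C)
    (hct : ∀ t, 0 ≤ t → c t ^ 2 * t ≤ C) :
    ∃ F : ℕ → E → ℝ, (∀ k, ContDiff ℝ 1 (F k)) ∧ (∀ k x, 0 ≤ F k x) ∧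
      (∀ᵐ x ∂μ, Tendsto (fun k => F k x) atTop (𝓝 (r x))) ∧
      Tendsto (fun k => ∫⁻ x, ENNReal.ofReal (r x) *
        ‖c (F k x) • fderiv ℝ (F k) x - c (r x) • D x‖ₑ ^ 2 ∂μ) atTop (𝓝 0) := by
  refine ⟨fun k => (mollifier E k).normed μ ⋆[lsmul ℝ ℝ, μ] r, fun k => ?_, fun k x => ?_,
    ae_tendsto_mollifier hri.locallyIntegrable, ?_⟩
  · exact (mollifier E k).hasCompactSupport_normed.contDiff_convolution_left _
      (mollifier E k).contDiff_normed hri.locallyIntegrable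
  · exact normed_convolution_nonneg μ _ hr0 x
  · simp_rw [h.fderiv_convolution (mollifier E _).contDiff_normed
      (mollifier E _).hasCompactSupport_normed]
    exact tendsto_weighted_mollification h.memLp_fderiv hr0 hri hc hcb hct

end Mollification

end

end RiemannianHardy

namespace RiemannianHardy

noncomputable section

/-! ### An oscillation estimate and the dichotomy it implies. -/

section Oscillation

variable {E : Type*} [NormedAddCommGroup E] [NormedSpace ℝ E] [FiniteDimensional ℝ E]
  [MeasurableSpace E] [BorelSpace E] (μ : Measure E) [μ.IsAddHaarMeasure]

/-- The increment is the integral of the derivative along the segment from x to x + h, and each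
translate x + th stays in the ball of radius 3R. Tonelli's theorem and translation invariance then
remove t. -/
theorem lintegral_translate_sub_le {w : E → ℝ} {x₀ : E} {R : ℝ}
    (hw : ContDiffOn ℝ 1 w (Metric.ball x₀ (3 * R))) {h : E} (hh : ‖h‖ < 2 * R) :
    ∫⁻ x in Metric.ball x₀ R, ‖w (x + h) - w x‖ₑ ∂μ ≤
      ENNReal.ofReal (2 * R) * ∫⁻ x in Metric.ball x₀ (3 * R), ‖fderiv ℝ w x‖ₑ ∂μ := by
  have hmem : ∀ x ∈ Metric.ball x₀ R, ∀ t ∈ Icc (0 : ℝ) 1, x + t • h ∈ Metric.ball x₀ (3 * R) := by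
    intro x hx t ht
    rw [Metric.mem_ball, dist_eq_norm] at hx ⊢
    have h1 : ‖t • h‖ ≤ ‖h‖ := by
      rw [norm_smul, Real.norm_of_nonneg ht.1]
      exact mul_le_of_le_one_left (norm_nonneg _) ht.2
    calc ‖x + t • h - x₀‖ = ‖(x - x₀) + t • h‖ := by congr 1; abel
      _ ≤ ‖x - x₀‖ + ‖t • h‖ := norm_add_le _ _
      _ < 3 * R := by linarith
  have hpt : ∀ x ∈ Metric.ball x₀ R, ‖w (x + h) - w x‖ₑ ≤
      ∫⁻ t in Icc (0 : ℝ) 1, ENNReal.ofReal (2 * R) * ‖fderiv ℝ w (x + t • h)‖ₑ := by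
    intro x hx
    have hcont : ContinuousOn (fun t : ℝ => fderiv ℝ w (x + t • h) h) (Icc 0 1) := by
      refine ContinuousOn.clm_apply ?_ continuousOn_const
      exact (hw.continuousOn_fderiv_of_isOpen Metric.isOpen_ball le_rfl).comp (by fun_prop)
        fun t ht => hmem x hx t ht
    have hder : ∀ t ∈ uIcc (0 : ℝ) 1, HasDerivAt (fun t : ℝ => w (x + t • h))
        (fderiv ℝ w (x + t • h) h) t := by
      intro t ht
      rw [uIcc_of_le zero_le_one] at ht
      have h1 : HasFDerivAt w (fderiv ℝ w (x + t • h)) (x + t • h) :=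
        ((hw.contDiffAt (Metric.isOpen_ball.mem_nhds (hmem x hx t ht))).differentiableAt
          one_ne_zero).hasFDerivAt
      have h2 : HasDerivAt (fun t : ℝ => x + t • h) h t := by
        simpa using ((hasDerivAt_id t).smul_const h).const_add x
      exact h1.comp_hasDerivAt t h2
    have hftc := intervalIntegral.integral_eq_sub_of_hasDerivAt hder
      (hcont.intervalIntegrable_of_Icc zero_le_one)
    simp only [one_smul, zero_smul, add_zero] at hftc
    rw [← hftc, intervalIntegral.integral_of_le zero_le_one, ← integral_Icc_eq_integral_Ioc]
    refine (enorm_integral_le_lintegral_enorm _).trans (lintegral_mono fun t => ?_)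
    simp only []
    rw [← ofReal_norm, ← ofReal_norm, ← ENNReal.ofReal_mul (by linarith [norm_nonneg h])]
    refine ENNReal.ofReal_le_ofReal ((ContinuousLinearMap.le_opNorm _ _).trans ?_)
    rw [mul_comm]
    gcongr
  have hmeas : Measurable fun p : E × ℝ => ‖fderiv ℝ w (p.1 + p.2 • h)‖ₑ :=
    ((measurable_fderiv ℝ w).comp (by fun_prop)).enorm
  calc ∫⁻ x in Metric.ball x₀ R, ‖w (x + h) - w x‖ₑ ∂μ
      ≤ ∫⁻ x in Metric.ball x₀ R, ∫⁻ t in Icc (0 : ℝ) 1,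
          ENNReal.ofReal (2 * R) * ‖fderiv ℝ w (x + t • h)‖ₑ ∂volume ∂μ :=
        setLIntegral_mono' measurableSet_ball hpt
    _ = ∫⁻ t in Icc (0 : ℝ) 1, ∫⁻ x in Metric.ball x₀ R,
          ENNReal.ofReal (2 * R) * ‖fderiv ℝ w (x + t • h)‖ₑ ∂μ :=
        lintegral_lintegral_swap (hmeas.const_mul _).aemeasurable
    _ ≤ ∫⁻ t in Icc (0 : ℝ) 1, ENNReal.ofReal (2 * R) *
          ∫⁻ x in Metric.ball x₀ (3 * R), ‖fderiv ℝ w x‖ₑ ∂μ := by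
        refine setLIntegral_mono' measurableSet_Icc fun t ht => ?_
        rw [lintegral_const_mul' _ _ ENNReal.ofReal_ne_top]
        refine mul_le_mul_right ?_ _
        rw [← lintegral_indicator measurableSet_ball, ← lintegral_indicator measurableSet_ball,
          ← lintegral_add_right_eq_self ((Metric.ball x₀ (3 * R)).indicator
            fun x => ‖fderiv ℝ w x‖ₑ) (t • h)]
        refine lintegral_mono fun x => ?_
        by_cases hx : x ∈ Metric.ball x₀ R
        · rw [indicator_of_mem hx, indicator_of_mem (hmem x hx t ht)]
        · rw [indicator_of_notMem hx]; exact bot_le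
    _ = _ := by simp

/-- A Poincaré inequality in L¹: write one point as the other plus a displacement h, of length less
than 2R, and integrate `lintegral_translate_sub_le` over h. -/
theorem lintegral_prod_sub_le {w : E → ℝ} {x₀ : E} {R : ℝ}
    (hw : ContDiffOn ℝ 1 w (Metric.ball x₀ (3 * R))) (hR : 0 < R) :
    ∫⁻ p, ‖w p.1 - w p.2‖ₑ ∂((μ.restrict (Metric.ball x₀ R)).prod (μ.restrict (Metric.ball x₀ R))) ≤
      μ (Metric.ball 0 (2 * R)) * (ENNReal.ofReal (2 * R) *
        ∫⁻ x in Metric.ball x₀ (3 * R), ‖fderiv ℝ w x‖ₑ ∂μ) := by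
  set B := Metric.ball x₀ R with hB
  have hBs : B ⊆ Metric.ball x₀ (3 * R) := Metric.ball_subset_ball (by linarith)
  -- a measurable representative
  have hBm : MeasurableSet B := measurableSet_ball
  set v : E → ℝ := (Metric.ball x₀ (3 * R)).indicator w with hv
  have hvm : Measurable v := by
    classical
    rw [hv, ← piecewise_eq_indicator]
    exact hw.continuousOn.measurable_piecewise continuousOn_const measurableSet_ball
  have hvw : ∀ x ∈ B, v x = w x := fun x hx => indicator_of_mem (hBs hx) _
  have hind : ∀ x, B.indicator (fun x => (1 : ℝ≥0∞)) x = B.indicator 1 x := fun _ => rfl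
  calc ∫⁻ p, ‖w p.1 - w p.2‖ₑ ∂((μ.restrict B).prod (μ.restrict B))
      = ∫⁻ p, ‖v p.1 - v p.2‖ₑ ∂((μ.restrict B).prod (μ.restrict B)) := by
        rw [Measure.prod_restrict]
        refine setLIntegral_congr_fun (hBm.prod hBm) fun p hp => ?_
        simp only [hvw _ hp.1, hvw _ hp.2]
    _ = ∫⁻ x in B, ∫⁻ y in B, ‖v x - v y‖ₑ ∂μ ∂μ :=
        lintegral_prod _ (by fun_prop)
    _ = ∫⁻ y in B, ∫⁻ h, B.indicator (fun x => ‖v x - v y‖ₑ) (y + h) ∂μ ∂μ := by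
        rw [lintegral_lintegral_swap (by fun_prop)]
        refine lintegral_congr fun y => ?_
        rw [lintegral_add_left_eq_self (fun x => B.indicator (fun x => ‖v x - v y‖ₑ) x) y,
          lintegral_indicator hBm]
    _ ≤ ∫⁻ y in B, ∫⁻ h in Metric.ball 0 (2 * R), ‖v (y + h) - v y‖ₑ * B.indicator 1 (y + h) ∂μ ∂μ := by
        refine setLIntegral_mono' hBm fun y hy => ?_
        rw [← lintegral_indicator measurableSet_ball]
        refine lintegral_mono fun h => ?_
        by_cases hyh : y + h ∈ B
        · have : h ∈ Metric.ball (0 : E) (2 * R) := by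
            rw [mem_ball_zero_iff]
            rw [hB, Metric.mem_ball, dist_eq_norm] at hyh hy
            calc ‖h‖ = ‖(y + h - x₀) - (y - x₀)‖ := by congr 1; abel
              _ ≤ ‖y + h - x₀‖ + ‖y - x₀‖ := norm_sub_le _ _
              _ < 2 * R := by linarith
          simp [indicator_of_mem hyh, indicator_of_mem this]
        · rw [indicator_of_notMem hyh]; exact bot_le
    _ = ∫⁻ h in Metric.ball 0 (2 * R), ∫⁻ y in B, ‖v (y + h) - v y‖ₑ * B.indicator 1 (y + h) ∂μ ∂μ := by
        refine lintegral_lintegral_swap (Measurable.aemeasurable ?_)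
        refine Measurable.mul (by fun_prop) ?_
        exact (measurable_one.indicator hBm).comp (by fun_prop)
    _ ≤ ∫⁻ h in Metric.ball 0 (2 * R), (ENNReal.ofReal (2 * R) *
        ∫⁻ x in Metric.ball x₀ (3 * R), ‖fderiv ℝ w x‖ₑ ∂μ) ∂μ := by
        refine setLIntegral_mono' measurableSet_ball fun h hh => ?_
        refine le_trans (setLIntegral_mono' hBm fun y hy => ?_)
          (lintegral_translate_sub_le μ hw (mem_ball_zero_iff.1 hh))
        by_cases hyh : y + h ∈ B
        · simp [indicator_of_mem hyh, hvw _ hyh, hvw _ hy]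
        · rw [indicator_of_notMem hyh, mul_zero]; exact bot_le
    _ = _ := by rw [setLIntegral_const, mul_comm]

/-- The Poincaré inequality and Fatou's lemma, first in n and then in j, bound the integral of
liminf |W_j(x) − W_j(y)| over pairs of points. The integrand is infinite at almost every pair with
r(x) ≠ 0 and r(y) = 0, so the product of {r ≠ 0} and {r = 0} is null, and hence one of the factors
is. -/
theorem ae_eq_zero_or_ae_ne_zero {r : E → ℝ} {x₀ : E} {R : ℝ} (hR : 0 < R)
    {w : ℕ → ℕ → E → ℝ}
    (hw : ∀ j n, ContDiffOn ℝ 1 (w j n) (Metric.ball x₀ (3 * R))) {W : ℕ → E → ℝ}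
    (hwW : ∀ j, ∀ᵐ x ∂μ.restrict (Metric.ball x₀ R),
      Tendsto (fun n => w j n x) atTop (𝓝 (W j x))) {K : ℝ≥0∞} (hK : K ≠ ⊤)
    (hwK : ∀ j, ∀ᶠ n in atTop, ∫⁻ x in Metric.ball x₀ (3 * R), ‖fderiv ℝ (w j n) x‖ₑ ∂μ ≤ K)
    (hW0 : ∀ j, ∀ᵐ x ∂μ.restrict (Metric.ball x₀ R), r x = 0 → W j x = 0)
    (hW1 : ∀ᵐ x ∂μ.restrict (Metric.ball x₀ R), r x ≠ 0 → Tendsto (fun j => W j x) atTop atTop) :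
    (∀ᵐ x ∂μ.restrict (Metric.ball x₀ R), r x = 0) ∨
      (∀ᵐ x ∂μ.restrict (Metric.ball x₀ R), r x ≠ 0) := by
  set ν := μ.restrict (Metric.ball x₀ R) with hν
  set K' := μ (Metric.ball 0 (2 * R)) * (ENNReal.ofReal (2 * R) * K) with hK'
  have hK't : K' ≠ ⊤ := by
    have : μ (Metric.ball 0 (2 * R)) ≠ ⊤ := measure_ball_lt_top.ne
    finiteness
  have hwm : ∀ j n, AEMeasurable (w j n) ν := fun j n =>
    (((hw j n).continuousOn.mono (Metric.ball_subset_ball (by linarith))).aemeasurable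
      measurableSet_ball)
  have hWm : ∀ j, AEMeasurable (W j) ν := fun j =>
    aemeasurable_of_tendsto_metrizable_ae atTop (hwm j) (hwW j)
  have hm2 : ∀ {f : E → ℝ}, AEMeasurable f ν →
      AEMeasurable (fun p : E × E => ‖f p.1 - f p.2‖ₑ) (ν.prod ν) := fun hf =>
    (hf.comp_fst.sub hf.comp_snd).enorm
  have h1 : ∀ j, ∫⁻ p, ‖W j p.1 - W j p.2‖ₑ ∂(ν.prod ν) ≤ K' := by
    intro j
    calc ∫⁻ p, ‖W j p.1 - W j p.2‖ₑ ∂(ν.prod ν)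
        = ∫⁻ p, liminf (fun n => ‖w j n p.1 - w j n p.2‖ₑ) atTop ∂(ν.prod ν) := by
          refine lintegral_congr_ae ?_
          filter_upwards [Measure.quasiMeasurePreserving_fst.ae (hwW j),
            Measure.quasiMeasurePreserving_snd.ae (hwW j)] with p hp1 hp2
          exact ((hp1.sub hp2).enorm.liminf_eq).symm
      _ ≤ liminf (fun n => ∫⁻ p, ‖w j n p.1 - w j n p.2‖ₑ ∂(ν.prod ν)) atTop :=
          lintegral_liminf_le' fun n => hm2 (hwm j n)
      _ ≤ K' := by
          refine liminf_le_of_le ⟨0, by simp⟩ fun b hb => ?_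
          obtain ⟨n, hn1, hn2⟩ := (hb.and (hwK j)).exists
          refine hn1.trans ((lintegral_prod_sub_le μ (hw j n) hR).trans ?_)
          rw [hK']
          gcongr
  have h2 : ∫⁻ p, liminf (fun j => ‖W j p.1 - W j p.2‖ₑ) atTop ∂(ν.prod ν) ≤ K' :=
    (lintegral_liminf_le' fun j => hm2 (hWm j)).trans
      (liminf_le_of_le ⟨0, by simp⟩ fun b hb => by
        obtain ⟨j, hj⟩ := hb.exists
        exact hj.trans (h1 j))
  have h3 : ∀ᵐ p ∂(ν.prod ν), liminf (fun j => ‖W j p.1 - W j p.2‖ₑ) atTop < ⊤ :=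
    ae_lt_top' ⟨_, Measurable.liminf fun j => (hm2 (hWm j)).measurable_mk, by
      filter_upwards [ae_all_iff.2 fun j => (hm2 (hWm j)).ae_eq_mk] with p hp
      simp only [hp]⟩ (h2.trans_lt hK't.lt_top).ne
  have h4 : ∀ᵐ p ∂(ν.prod ν), ¬ (r p.1 ≠ 0 ∧ r p.2 = 0) := by
    filter_upwards [h3, Measure.quasiMeasurePreserving_fst.ae hW1,
      Measure.quasiMeasurePreserving_snd.ae (ae_all_iff.2 hW0)] with p hp hp1 hp2 ⟨hr1, hr2⟩
    have h5 : Tendsto (fun j => ‖W j p.1 - W j p.2‖ₑ) atTop (𝓝 ⊤) := by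
      simp only [hp2 _ hr2, sub_zero]
      have := ENNReal.tendsto_ofReal_atTop.comp (tendsto_norm_atTop_atTop.comp (hp1 hr1))
      refine this.congr fun j => ?_
      exact ofReal_norm _
    rw [h5.liminf_eq] at hp
    exact lt_irrefl _ hp
  have h6 : (ν {x | r x ≠ 0}) * ν {x | r x = 0} = 0 := by
    rw [← Measure.prod_prod]
    rw [ae_iff] at h4
    refine measure_mono_null (fun p hp => ?_) h4
    simpa using hp
  rcases mul_eq_zero.1 h6 with h | h
  · left; exact h
  · right
    rw [ae_iff]
    simpa using h

end Oscillation

end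

end RiemannianHardy

namespace RiemannianHardy

noncomputable section

/-! ### Extension of functions from the half-line to the line. -/

section Extension

/-- The extension of a function on `[0, ∞)` to the real line that is affine of slope `s`
on `(-∞, 0]`. -/
def affineExtend (g : ℝ → ℝ) (s t : ℝ) : ℝ := g (max t 0) + s * min t 0

theorem affineExtend_of_nonneg (g : ℝ → ℝ) (s : ℝ) {t : ℝ} (ht : 0 ≤ t) :
    affineExtend g s t = g t := by
  simp [affineExtend, ht]

/-- The slope `g' 0` makes the two pieces meet differentiably at 0. Such extensions are needed
because smooth approximations of ρ may take negative values, where functions such as (t+ε)⁻¹ are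
singular. -/
theorem hasDerivAt_affineExtend {g g' : ℝ → ℝ} (hg : ∀ t, 0 ≤ t → HasDerivAt g (g' t) t) (t : ℝ) :
    HasDerivAt (affineExtend g (g' 0)) (g' (max t 0)) t := by
  have hlin : ∀ t, HasDerivAt (fun t => g 0 + g' 0 * t) (g' 0) t := fun t => by
    simpa using ((hasDerivAt_id t).const_mul (g' 0)).const_add (g 0)
  have hneg : ∀ s ≤ (0 : ℝ), affineExtend g (g' 0) s = g 0 + g' 0 * s := fun s hs => by
    simp [affineExtend, hs]
  rcases lt_trichotomy t 0 with ht | rfl | ht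
  · rw [max_eq_right ht.le]
    refine (hlin t).congr_of_eventuallyEq ?_
    filter_upwards [Iio_mem_nhds ht] with s hs using hneg s (le_of_lt hs)
  · rw [max_self, ← hasDerivWithinAt_univ, ← Iic_union_Ici (a := (0 : ℝ))]
    exact ((hlin 0).hasDerivWithinAt.congr (fun s hs => hneg s hs) (hneg 0 le_rfl)).union
      ((hg 0 le_rfl).hasDerivWithinAt.congr (fun s hs => affineExtend_of_nonneg _ _ hs)
        (affineExtend_of_nonneg _ _ le_rfl))
  · rw [max_eq_left ht.le]
    refine (hg t ht.le).congr_of_eventuallyEq ?_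
    filter_upwards [Ioi_mem_nhds ht] with s hs using affineExtend_of_nonneg _ _ (le_of_lt hs)

theorem contDiff_one_of_hasDerivAt {g g' : ℝ → ℝ} (hg : ∀ t, HasDerivAt g (g' t) t)
    (hg' : Continuous g') : ContDiff ℝ 1 g := by
  rw [contDiff_one_iff_deriv]
  refine ⟨fun t => (hg t).differentiableAt, ?_⟩
  have : deriv g = g' := funext fun t => (hg t).deriv
  rwa [this]

theorem abs_sub_le_of_hasDerivAt {g g' : ℝ → ℝ} (hg : ∀ t, HasDerivAt g (g' t) t) {L : ℝ}
    (hL : ∀ t, |g' t| ≤ L) (a b : ℝ) : |g a - g b| ≤ L * |a - b| := by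
  have := Convex.norm_image_sub_le_of_norm_hasDerivWithin_le (f := g) (f' := g') (s := univ)
    (x := b) (y := a) (C := L) (fun t _ => (hg t).hasDerivWithinAt) (fun t _ => hL t) convex_univ
    (mem_univ _) (mem_univ _)
  simpa using this

end Extension

/-! ### Calculus of test functions and gradients. -/

section Calculus

variable {N : ℕ} {M : Type*} [TopologicalSpace M] [ChartedSpace (EuclideanSpace ℝ (Fin N)) M]

/-- The second factor is regular only on `U`; the product vanishes near every point outside the
support of the first. -/
theorem IsC10.mul_contMDiffOn {U : Set M} (hU : IsOpen U) {u f : M → ℝ} (hu : IsC10 N U u)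
    (hf : ContMDiffOn (𝓡 N) 𝓘(ℝ, ℝ) 1 f U) : IsC10 N U (fun x => u x * f x) := by
  refine ⟨?_, hu.hasCompactSupport.mul_right, (tsupport_mul_subset_left).trans hu.tsupport_subset⟩
  refine contMDiff_of_tsupport fun x hx => ?_
  have hxU : x ∈ U := hu.tsupport_subset (tsupport_mul_subset_left hx)
  exact hu.contMDiff.contMDiffAt.mul (hf.contMDiffAt (hU.mem_nhds hxU))

theorem IsC10.mono {U V : Set M} (h : U ⊆ V) {u : M → ℝ} (hu : IsC10 N U u) : IsC10 N V u :=
  ⟨hu.contMDiff, hu.hasCompactSupport, hu.tsupport_subset.trans h⟩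

theorem IsC10.add {U : Set M} {u v : M → ℝ} (hu : IsC10 N U u) (hv : IsC10 N U v) :
    IsC10 N U (fun x => u x + v x) :=
  ⟨hu.contMDiff.add hv.contMDiff, hu.hasCompactSupport.add hv.hasCompactSupport,
    (tsupport_add u v).trans (union_subset hu.tsupport_subset hv.tsupport_subset)⟩

variable [IsManifold (𝓡 N) ∞ M] [RiemannianBundle (fun x : M => TangentSpace (𝓡 N) x)]

theorem grad_eq_of_forall_inner {f : M → ℝ} {x : M} {Y : TangentSpace (𝓡 N) x}
    (h : ∀ v : TangentSpace (𝓡 N) x, mfderiv (𝓡 N) 𝓘(ℝ, ℝ) f x v = inner ℝ Y v) :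
    grad N f x = Y :=
  ext_inner_right ℝ fun v => by rw [inner_grad, h]

theorem grad_add {f g : M → ℝ} {x : M} (hf : MDifferentiableAt (𝓡 N) 𝓘(ℝ, ℝ) f x)
    (hg : MDifferentiableAt (𝓡 N) 𝓘(ℝ, ℝ) g x) :
    grad N (fun x => f x + g x) x = grad N f x + grad N g x :=
  grad_eq_of_forall_inner fun v => by
    have := (hf.hasMFDerivAt.add hg.hasMFDerivAt).mfderiv
    rw [inner_add_left, inner_grad, inner_grad]
    exact DFunLike.congr_fun this v

theorem grad_mul {f g : M → ℝ} {x : M} (hf : MDifferentiableAt (𝓡 N) 𝓘(ℝ, ℝ) f x)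
    (hg : MDifferentiableAt (𝓡 N) 𝓘(ℝ, ℝ) g x) :
    grad N (fun x => f x * g x) x = g x • grad N f x + f x • grad N g x :=
  grad_eq_of_forall_inner fun v => by
    have := (hf.hasMFDerivAt.mul hg.hasMFDerivAt).mfderiv
    rw [inner_add_left, real_inner_smul_left, real_inner_smul_left, inner_grad, inner_grad,
      add_comm]
    exact DFunLike.congr_fun this v

theorem grad_comp {Ψ : ℝ → ℝ} {Ψ' : ℝ} {f : M → ℝ} {x : M}
    (hf : MDifferentiableAt (𝓡 N) 𝓘(ℝ, ℝ) f x) (hΨ : HasDerivAt Ψ Ψ' (f x)) :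
    grad N (fun x => Ψ (f x)) x = Ψ' • grad N f x :=
  grad_eq_of_forall_inner fun v => by
    have h1 := (hΨ.hasFDerivAt.hasMFDerivAt.comp x hf.hasMFDerivAt).mfderiv
    rw [real_inner_smul_left, inner_grad]
    have h2 := DFunLike.congr_fun h1 v
    exact h2.trans (mul_comm (G := ℝ) _ _)

end Calculus

end

end RiemannianHardy

/-! ### Bounds for test functions, and the chain rule in W^{1,2}. -/

namespace RiemannianHardy

noncomputable section

variable {N : ℕ} {M : Type*} [TopologicalSpace M] [ChartedSpace (EuclideanSpace ℝ (Fin N)) M]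
  [IsManifold (𝓡 N) ∞ M] [RiemannianBundle (fun x : M => TangentSpace (𝓡 N) x)]

theorem IsC10.exists_bound {U : Set M} {u : M → ℝ} (hu : IsC10 N U u) :
    ∃ C, 0 ≤ C ∧ ∀ x, |u x| ≤ C := by
  obtain ⟨C, hC⟩ := hu.hasCompactSupport.exists_bound_of_continuous hu.contMDiff.continuous
  exact ⟨max C 0, le_max_right _ _, fun x => (hC x).trans (le_max_left _ _)⟩

theorem grad_eq_zero_of_notMem_tsupport {u : M → ℝ} {x : M} (hx : x ∉ tsupport u) :
    grad N u x = 0 :=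
  grad_eq_of_forall_inner fun v => by
    have h : u =ᶠ[𝓝 x] fun _ => (0 : ℝ) := notMem_tsupport_iff_eventuallyEq.1 hx
    rw [h.mfderiv_eq, mfderiv_const, inner_zero_left]
    rfl

variable [T2Space M] [MeasurableSpace M] [BorelSpace M] [SecondCountableTopology M]
  [IsContMDiffRiemannianBundle (𝓡 N) ∞
    (EuclideanSpace ℝ (Fin N)) (fun x : M => TangentSpace (𝓡 N) x)]

theorem IsC10.exists_grad_bound {U : Set M} {u : M → ℝ} (hu : IsC10 N U u) :
    ∃ C, 0 ≤ C ∧ ∀ x, ‖grad N u x‖ ≤ C := by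
  have hcs : HasCompactSupport (fun x => ‖grad N u x‖) :=
    HasCompactSupport.intro hu.hasCompactSupport fun x hx => by
      rw [grad_eq_zero_of_notMem_tsupport hx, norm_zero]
  obtain ⟨C, hC⟩ := hcs.exists_bound_of_continuous (continuous_norm_grad hu.contMDiff)
  exact ⟨max C 0, le_max_right _ _, fun x => by
    simpa using (hC x).trans (le_max_left C 0)⟩

theorem IsC10.aemeasurableField_grad {U V : Set M} {u : M → ℝ} (hu : IsC10 N V u) :
    AEMeasurableField U (grad N u) :=
  (RiemannianHardy.aemeasurableField_grad isOpen_univ hu.contMDiff.contMDiffOn).mono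
    (subset_univ _)

/-- The Riemannian volume is finite on compact sets. -/
theorem riemannianVolume_lt_top_of_isCompact {K : Set M} (hK : IsCompact K) :
    riemannianVolume N M K < ⊤ :=
  hK.measure_lt_top_of_nhdsWithin fun x _ => by
    obtain ⟨R, C, hg, -⟩ := exists_isGoodBall (N := N) x (O := univ) univ_mem
    exact ⟨chartBall N x R, mem_nhdsWithin_of_mem_nhds
      ((isOpen_chartBall x R).mem_nhds (mem_chartBall_self x hg.R_pos)), hg.volume_lt_top⟩

namespace IsW12

variable {U : Set M} {ρ : M → ℝ} {G : (x : M) → TangentSpace (𝓡 N) x}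

theorem mono (h : IsW12 N U ρ G) {V : Set M} (hVU : V ⊆ U) : IsW12 N V ρ G := by
  obtain ⟨f, h1, h2, h3, h4, h5⟩ := h.exists_approx
  have hm : (riemannianVolume N M).restrict V ≤ (riemannianVolume N M).restrict U :=
    Measure.restrict_mono hVU le_rfl
  exact ⟨h.aestronglyMeasurable.mono_measure hm, h.aemeasurableField.mono hVU,
    f, fun n => (h1 n).mono hVU, fun n => (h2 n).mono_measure hm, fun n => (h3 n).mono_measure hm,
    tendsto_of_tendsto_of_tendsto_of_le_of_le tendsto_const_nhds h4 (fun _ => bot_le)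
      fun n => eLpNorm_mono_measure _ hm,
    tendsto_of_tendsto_of_tendsto_of_le_of_le tendsto_const_nhds h5 (fun _ => bot_le)
      fun n => eLpNorm_mono_measure _ hm⟩

theorem memLp (h : IsW12 N U ρ G) : MemLp ρ 2 ((riemannianVolume N M).restrict U) := by
  obtain ⟨f, h1, h2, h3, h4, h5⟩ := h.exists_approx
  obtain ⟨n, hn⟩ := ((ENNReal.tendsto_nhds_zero.1 h4) 1 one_pos).exists
  have h6 : MemLp (fun x => f n x - ρ x) 2 ((riemannianVolume N M).restrict U) :=
    ⟨(h2 n).aestronglyMeasurable.sub h.aestronglyMeasurable, hn.trans_lt ENNReal.one_lt_top⟩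
  have := (h2 n).sub h6
  refine this.ae_eq (Eventually.of_forall fun x => ?_)
  simp

theorem aemeasurableField_approx (hU : IsOpen U) {f : M → ℝ}
    (hf : ContMDiffOn (𝓡 N) 𝓘(ℝ, ℝ) ∞ f U) : AEMeasurableField U (grad N f) :=
  RiemannianHardy.aemeasurableField_grad hU (hf.of_le (by simp))

theorem memLp_norm (h : IsW12 N U ρ G) (hU : IsOpen U) :
    MemLp (fun x => ‖G x‖) 2 ((riemannianVolume N M).restrict U) := by
  obtain ⟨f, h1, h2, h3, h4, h5⟩ := h.exists_approx
  obtain ⟨n, hn⟩ := ((ENNReal.tendsto_nhds_zero.1 h5) 1 one_pos).exists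
  have hG := h.aemeasurableField
  have hf := aemeasurableField_approx hU (h1 n)
  have h6 : MemLp (fun x => ‖grad N (f n) x - G x‖) 2 ((riemannianVolume N M).restrict U) :=
    ⟨(hf.sub hG).aestronglyMeasurable_norm hU.measurableSet, hn.trans_lt ENNReal.one_lt_top⟩
  refine ((h3 n).add h6).mono (hG.aestronglyMeasurable_norm hU.measurableSet)
    (Eventually.of_forall fun x => ?_)
  have := norm_sub_le (grad N (f n) x) (grad N (f n) x - G x)
  rw [sub_sub_cancel] at this
  simp only [Pi.add_apply, norm_norm]
  exact this.trans (le_abs_self _)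

/-- The smooth approximations of a `W^{1,2}` function can be chosen so that they converge almost
everywhere; then the chain rule holds in the limit. -/
theorem exists_approx_comp (h : IsW12 N U ρ G) (hU : IsOpen U) :
    ∃ f : ℕ → M → ℝ, (∀ n, ContMDiffOn (𝓡 N) 𝓘(ℝ, ℝ) ∞ (f n) U) ∧
      (∀ᵐ x ∂(riemannianVolume N M).restrict U, Tendsto (fun n => f n x) atTop (𝓝 (ρ x))) ∧
      Tendsto (fun n => eLpNorm (fun x => f n x - ρ x) 2 ((riemannianVolume N M).restrict U))
        atTop (𝓝 0) ∧
      Tendsto (fun n => eLpNorm (fun x => ‖grad N (f n) x - G x‖) 2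
        ((riemannianVolume N M).restrict U)) atTop (𝓝 0) ∧
      ∀ c : ℝ → ℝ, Continuous c → ∀ L : ℝ, (∀ t, |c t| ≤ L) →
        Tendsto (fun n => eLpNorm (fun x => ‖c (f n x) • grad N (f n) x - c (ρ x) • G x‖) 2
          ((riemannianVolume N M).restrict U)) atTop (𝓝 0) := by
  obtain ⟨f, h1, h2, h3, h4, h5⟩ := h.exists_approx
  set μ := (riemannianVolume N M).restrict U
  have hfm : ∀ n, AEStronglyMeasurable (f n) μ := fun n =>
    (h1 n).continuousOn.aestronglyMeasurable hU.measurableSet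
  have hmeas : TendstoInMeasure μ f atTop ρ :=
    tendstoInMeasure_of_tendsto_eLpNorm two_ne_zero hfm h.aestronglyMeasurable h4
  obtain ⟨ns, hns, hae⟩ := hmeas.exists_seq_tendsto_ae
  refine ⟨fun n => f (ns n), fun n => h1 _, hae, h4.comp hns.tendsto_atTop,
    h5.comp hns.tendsto_atTop, fun c hc L hL => ?_⟩
  have hL0 : 0 ≤ L := (abs_nonneg _).trans (hL 0)
  have hG := h.aemeasurableField
  have hGn := hG.aestronglyMeasurable_norm hU.measurableSet
  have hf := fun n => aemeasurableField_approx hU (h1 (ns n))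
  -- Splitting c(f)∇f − c(ρ)G = c(f)(∇f − G) + (c(f) − c(ρ))G: the first term is small by
  -- boundedness of c, the second by dominated convergence with majorant 2L|G|.
  set a : ℕ → M → ℝ := fun n x => L * ‖grad N (f (ns n)) x - G x‖ with ha
  set b : ℕ → M → ℝ := fun n x => |c (f (ns n) x) - c (ρ x)| * ‖G x‖ with hb
  have ham : ∀ n, AEStronglyMeasurable (a n) μ := fun n =>
    (((hf n).sub hG).aestronglyMeasurable_norm hU.measurableSet).const_mul L
  have hbm : ∀ n, AEStronglyMeasurable (b n) μ := fun n =>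
    (((hc.comp_aestronglyMeasurable (hfm _)).sub
      (hc.comp_aestronglyMeasurable h.aestronglyMeasurable)).norm).mul hGn
  have hbound : ∀ n, eLpNorm (fun x => ‖c (f (ns n) x) • grad N (f (ns n)) x - c (ρ x) • G x‖) 2 μ ≤
      eLpNorm (a n) 2 μ + eLpNorm (b n) 2 μ := fun n => by
    refine le_trans (eLpNorm_mono_real fun x => ?_) (eLpNorm_add_le (ham n) (hbm n) (by norm_num))
    rw [norm_norm]
    have : c (f (ns n) x) • grad N (f (ns n)) x - c (ρ x) • G x =
        c (f (ns n) x) • (grad N (f (ns n)) x - G x) + (c (f (ns n) x) - c (ρ x)) • G x := by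
      rw [smul_sub, sub_smul]; abel
    rw [this]
    refine (norm_add_le _ _).trans ?_
    rw [norm_smul, norm_smul]
    exact add_le_add (mul_le_mul_of_nonneg_right (hL _) (norm_nonneg _)) le_rfl
  have hat : Tendsto (fun n => eLpNorm (a n) 2 μ) atTop (𝓝 0) := by
    have : ∀ n, eLpNorm (a n) 2 μ = ‖L‖ₑ *
        eLpNorm (fun x => ‖grad N (f (ns n)) x - G x‖) 2 μ := fun n =>
      eLpNorm_const_smul L (fun x => ‖grad N (f (ns n)) x - G x‖) 2 μ
    simp only [this]
    simpa using ENNReal.Tendsto.const_mul (h5.comp hns.tendsto_atTop) (Or.inr enorm_ne_top)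
  have hbt : Tendsto (fun n => eLpNorm (b n) 2 μ) atTop (𝓝 0) := by
    rw [tendsto_eLpNorm_two_iff]
    rw [← lintegral_zero (μ := μ)]
    refine tendsto_lintegral_of_dominated_convergence' (fun x => ‖(2 * L) * ‖G x‖‖ₑ ^ 2)
      (fun n => (hbm n).enorm.pow_const 2) (fun n => Eventually.of_forall fun x => ?_) ?_ ?_
    · simp only []
      gcongr
      rw [enorm_le_iff_norm_le, hb]
      simp only [norm_mul, Real.norm_eq_abs, abs_abs]
      refine mul_le_mul_of_nonneg_right ?_ (abs_nonneg _)
      rw [abs_of_nonneg hL0, abs_of_nonneg (zero_le_two : (0 : ℝ) ≤ 2)]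
      calc _ ≤ |c (f (ns n) x)| + |c (ρ x)| := abs_sub _ _
        _ ≤ _ := by linarith [hL (f (ns n) x), hL (ρ x)]
    · rw [← eLpNorm_two_sq]
      exact ENNReal.pow_ne_top ((h.memLp_norm hU).const_mul (2 * L)).eLpNorm_ne_top
    · filter_upwards [hae] with x hx
      have e1 : Tendsto (fun n => b n x) atTop (𝓝 (|c (ρ x) - c (ρ x)| * ‖G x‖)) :=
        ((((hc.tendsto _).comp hx).sub_const _).abs).mul_const _
      have e2 := ENNReal.Tendsto.pow (n := 2) e1.enorm
      simpa using e2
  exact tendsto_of_tendsto_of_tendsto_of_le_of_le tendsto_const_nhds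
    (by simpa using hat.add hbt) (fun _ => bot_le) hbound

end IsW12

end

end RiemannianHardy

/-! ### Superharmonicity tested with u²/(ρ+ε). -/

namespace RiemannianHardy

noncomputable section

variable {N : ℕ} {M : Type*} [TopologicalSpace M] [ChartedSpace (EuclideanSpace ℝ (Fin N)) M]
  [IsManifold (𝓡 N) ∞ M] [RiemannianBundle (fun x : M => TangentSpace (𝓡 N) x)]
  [T2Space M] [MeasurableSpace M] [BorelSpace M] [SecondCountableTopology M]
  [IsContMDiffRiemannianBundle (𝓡 N) ∞
    (EuclideanSpace ℝ (Fin N)) (fun x : M => TangentSpace (𝓡 N) x)]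
  {U : Set M} {ρ : M → ℝ} {G : (x : M) → TangentSpace (𝓡 N) x}

theorem IsC10.memLp {V : Set M} {u : M → ℝ} (hu : IsC10 N V u)
    (hfin : riemannianVolume N M U < ⊤) : MemLp u 2 ((riemannianVolume N M).restrict U) := by
  have : IsFiniteMeasure ((riemannianVolume N M).restrict U) := ⟨by simpa using hfin⟩
  obtain ⟨C, -, hC⟩ := hu.exists_bound
  exact MemLp.of_bound hu.contMDiff.continuous.aestronglyMeasurable C
    (Eventually.of_forall hC)

theorem IsC10.memLp_norm_grad {V : Set M} {u : M → ℝ} (hu : IsC10 N V u)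
    (hfin : riemannianVolume N M U < ⊤) :
    MemLp (fun x => ‖grad N u x‖) 2 ((riemannianVolume N M).restrict U) := by
  have : IsFiniteMeasure ((riemannianVolume N M).restrict U) := ⟨by simpa using hfin⟩
  obtain ⟨C, -, hC⟩ := hu.exists_grad_bound
  exact MemLp.of_bound (continuous_norm_grad hu.contMDiff).aestronglyMeasurable C
    (Eventually.of_forall fun x => by simpa using hC x)

/-- The `L²` pairing with a fixed field is continuous. -/
theorem tendsto_integral_inner (hU : IsOpen U) (hG : AEMeasurableField U G)
    (hG2 : MemLp (fun x => ‖G x‖) 2 ((riemannianVolume N M).restrict U))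
    {Y : ℕ → (x : M) → TangentSpace (𝓡 N) x} {X : (x : M) → TangentSpace (𝓡 N) x}
    (hY : ∀ n, AEMeasurableField U (Y n)) (hX : AEMeasurableField U X)
    (hY2 : ∀ n, MemLp (fun x => ‖Y n x‖) 2 ((riemannianVolume N M).restrict U))
    (h : Tendsto (fun n => eLpNorm (fun x => ‖Y n x - X x‖) 2 ((riemannianVolume N M).restrict U))
      atTop (𝓝 0)) :
    Integrable (fun x => inner ℝ (G x) (X x)) ((riemannianVolume N M).restrict U) ∧
    Tendsto (fun n => ∫ x in U, inner ℝ (G x) (Y n x) ∂riemannianVolume N M) atTop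
      (𝓝 (∫ x in U, inner ℝ (G x) (X x) ∂riemannianVolume N M)) := by
  set μ := (riemannianVolume N M).restrict U
  have hUm := hU.measurableSet
  have hint : ∀ Z : (x : M) → TangentSpace (𝓡 N) x, AEMeasurableField U Z →
      MemLp (fun x => ‖Z x‖) 2 μ → Integrable (fun x => inner ℝ (G x) (Z x)) μ := fun Z hZ hZ2 => by
    refine (hG2.integrable_mul hZ2).mono (hG.aestronglyMeasurable_inner hUm hZ)
      (Eventually.of_forall fun x => ?_)
    refine (abs_real_inner_le_norm _ _).trans ?_
    simp
  have hX2 : MemLp (fun x => ‖X x‖) 2 μ := by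
    obtain ⟨n, hn⟩ := ((ENNReal.tendsto_nhds_zero.1 h) 1 one_pos).exists
    have h6 : MemLp (fun x => ‖Y n x - X x‖) 2 μ :=
      ⟨((hY n).sub hX).aestronglyMeasurable_norm hUm, hn.trans_lt ENNReal.one_lt_top⟩
    refine ((hY2 n).add h6).mono (hX.aestronglyMeasurable_norm hUm)
      (Eventually.of_forall fun x => ?_)
    have := norm_sub_le (Y n x) (Y n x - X x)
    rw [sub_sub_cancel] at this
    simp only [Pi.add_apply, norm_norm]
    exact this.trans (le_abs_self _)
  refine ⟨hint X hX hX2, tendsto_integral_of_L1 _ (hint X hX hX2).aestronglyMeasurable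
    (Eventually.of_forall fun n => hint _ (hY n) (hY2 n)) ?_⟩
  have hb : ∀ n, ∫⁻ x, ‖inner ℝ (G x) (Y n x) - inner ℝ (G x) (X x)‖ₑ ∂μ ≤
      eLpNorm (fun x => ‖G x‖) 2 μ * eLpNorm (fun x => ‖Y n x - X x‖) 2 μ := fun n => by
    refine le_trans (lintegral_mono fun x => ?_) (lintegral_mul_le_eLpNorm_mul
      hG2.aestronglyMeasurable (((hY n).sub hX).aestronglyMeasurable_norm hUm))
    rw [← inner_sub_right, enorm_norm, enorm_norm, ← ofReal_norm, ← ofReal_norm, ← ofReal_norm,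
      ← ENNReal.ofReal_mul (norm_nonneg _)]
    exact ENNReal.ofReal_le_ofReal (abs_real_inner_le_norm _ _)
  refine tendsto_of_tendsto_of_tendsto_of_le_of_le tendsto_const_nhds ?_ (fun _ => bot_le) hb
  simpa using ENNReal.Tendsto.const_mul h (Or.inr hG2.eLpNorm_ne_top)

section Reciprocal

theorem hasDerivAt_inv_add {ε : ℝ} (hε : 0 < ε) (t : ℝ) (ht : 0 ≤ t) :
    HasDerivAt (fun t => (t + ε)⁻¹) (-((t + ε) ^ 2)⁻¹) t := by
  have := ((hasDerivAt_id t).add_const ε).fun_inv (by simp; positivity)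
  simpa [neg_div, one_div] using this

end Reciprocal

/-- Testing superharmonicity with `u² / (ρ + ε)`. -/
theorem lintegral_grad_sub_add_le (hU : IsOpen U) (hfin : riemannianVolume N M U < ⊤)
    (hρ : IsW12 N U ρ G)
    (hρ0 : ∀ᵐ x ∂(riemannianVolume N M).restrict U, 0 ≤ ρ x)
    (hsuper : ∀ φ : M → ℝ, IsC10 N U φ → (∀ x, 0 ≤ φ x) →
      0 ≤ ∫ x in U, inner ℝ (G x) (grad N φ x) ∂(riemannianVolume N M))
    {u : M → ℝ} (hu : IsC10 N U u) {ε : ℝ} (hε : 0 < ε) :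
    ∫⁻ x in U, ‖grad N u x - ((1 / 2 : ℝ) * (u x / (ρ x + ε))) • G x‖ₑ ^ 2 ∂riemannianVolume N M +
      ENNReal.ofReal (1 / 4) *
        ∫⁻ x in U, ‖(u x / (ρ x + ε)) • G x‖ₑ ^ 2 ∂riemannianVolume N M ≤
      ∫⁻ x in U, ‖grad N u x‖ₑ ^ 2 ∂riemannianVolume N M := by
  obtain ⟨f, hf, -, hfρ, -, hfc⟩ := hρ.exists_approx_comp hU
  set μ := (riemannianVolume N M).restrict U with hμ
  set ψ : ℝ → ℝ := fun t => (t + ε)⁻¹ with hψ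
  set ψ' : ℝ → ℝ := fun t => -((t + ε) ^ 2)⁻¹ with hψ'
  -- The slope at 0 is negative, so the extension is nonnegative on the whole line, besides being C¹
  -- with bounded derivative. Thus u²Ψ(f n) is an admissible test function even where `f n` is
  -- negative.
  set Ψ := affineExtend ψ (ψ' 0) with hΨ
  have hd : ∀ t, HasDerivAt Ψ (ψ' (max t 0)) t :=
    hasDerivAt_affineExtend fun t ht => hasDerivAt_inv_add hε t ht
  have hpos : ∀ t : ℝ, 0 < max t 0 + ε := fun t => by positivity
  have hcont : Continuous fun t => ψ' (max t 0) := by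
    refine (Continuous.inv₀ (by fun_prop) fun t => ?_).neg
    have := hpos t
    positivity
  have hΨ1 : ContDiff ℝ 1 Ψ := contDiff_one_of_hasDerivAt hd hcont
  have hL : ∀ t, |ψ' (max t 0)| ≤ (ε ^ 2)⁻¹ := fun t => by
    simp only [hψ', abs_neg, abs_inv, abs_pow, abs_of_pos (hpos t)]
    gcongr
    linarith [le_max_right t 0]
  have hΨ0 : ∀ t, 0 ≤ Ψ t := fun t => by
    have h1 : min t 0 ≤ 0 := min_le_right _ _
    have h2 : 0 ≤ ψ (max t 0) := inv_nonneg.2 (hpos t).le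
    have h3 : ψ' 0 ≤ 0 := neg_nonpos.2 (by positivity)
    exact add_nonneg h2 (mul_nonneg_of_nonpos_of_nonpos h3 h1)
  have hv : ∀ n, IsC10 N U (fun x => u x * Ψ (f n x)) := fun n =>
    hu.mul_contMDiffOn hU (hΨ1.contMDiff.comp_contMDiffOn ((hf n).of_le (by simp)))
  have hφ : ∀ n, IsC10 N U (fun x => u x * (u x * Ψ (f n x))) := fun n =>
    hu.mul_contMDiffOn hU (hv n).contMDiff.contMDiffOn
  -- The gradient that the chain rule predicts for u²Ψ(ρ). It appears as the L² limit of the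
  -- gradients of the test functions u²Ψ(f n).
  set X : (x : M) → TangentSpace (𝓡 N) x := fun x =>
    (2 * u x * Ψ (ρ x)) • grad N u x + (u x ^ 2 * ψ' (max (ρ x) 0)) • G x with hX
  have hgrad : ∀ n, ∀ x ∈ U, grad N (fun x => u x * (u x * Ψ (f n x))) x =
      (2 * u x * Ψ (f n x)) • grad N u x + (u x ^ 2 * ψ' (max (f n x) 0)) • grad N (f n) x := by
    intro n x hx
    have e0 : MDifferentiableAt (𝓡 N) 𝓘(ℝ, ℝ) u x := hu.contMDiff.mdifferentiable (by simp) x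
    have e1 : MDifferentiableAt (𝓡 N) 𝓘(ℝ, ℝ) (f n) x :=
      ((hf n).contMDiffAt (hU.mem_nhds hx)).mdifferentiableAt (by simp)
    have e2 : MDifferentiableAt (𝓡 N) 𝓘(ℝ, ℝ) (fun x => Ψ (f n x)) x :=
      (hd _).differentiableAt.mdifferentiableAt.comp x e1
    rw [grad_mul e0 ((hv n).contMDiff.mdifferentiable (by simp) x), grad_mul e0 e2,
      grad_comp e1 (hd _)]
    module
  have hum : AEStronglyMeasurable u μ := hu.contMDiff.continuous.aestronglyMeasurable
  have hXm : AEMeasurableField U X :=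
    (hu.aemeasurableField_grad.smul ((hum.const_mul 2).mul
      (hΨ1.continuous.comp_aestronglyMeasurable hρ.aestronglyMeasurable))).add
    (hρ.aemeasurableField.smul ((hum.pow 2).mul
      (hcont.comp_aestronglyMeasurable hρ.aestronglyMeasurable)))
  obtain ⟨C, hC0, hC⟩ := hu.exists_bound
  obtain ⟨C', hC0', hC'⟩ := hu.exists_grad_bound
  have hlim : Tendsto (fun n => eLpNorm
      (fun x => ‖grad N (fun x => u x * (u x * Ψ (f n x))) x - X x‖) 2 μ) atTop (𝓝 0) := by
    set c1 : ℝ := 2 * C * C' * (ε ^ 2)⁻¹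
    set c2 : ℝ := C ^ 2
    have hA := fun n => ((hf n).continuousOn.aestronglyMeasurable (μ := riemannianVolume N M)
      hU.measurableSet).sub hρ.aestronglyMeasurable
    have hB := fun n => (((IsW12.aemeasurableField_approx hU (hf n)).smul
      (hcont.comp_aestronglyMeasurable ((hf n).continuousOn.aestronglyMeasurable
        hU.measurableSet))).sub (hρ.aemeasurableField.smul
      (hcont.comp_aestronglyMeasurable hρ.aestronglyMeasurable))).aestronglyMeasurable_norm
        hU.measurableSet
    have hle : ∀ n, eLpNorm
        (fun x => ‖grad N (fun x => u x * (u x * Ψ (f n x))) x - X x‖) 2 μ ≤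
        ‖c1‖ₑ * eLpNorm (fun x => f n x - ρ x) 2 μ + ‖c2‖ₑ * eLpNorm
          (fun x => ‖ψ' (max (f n x) 0) • grad N (f n) x - ψ' (max (ρ x) 0) • G x‖) 2 μ := by
      intro n
      rw [← eLpNorm_norm (fun x => f n x - ρ x)]
      rw [← eLpNorm_const_smul c1, ← eLpNorm_const_smul c2]
      refine le_trans (eLpNorm_mono_ae_real ?_)
        (eLpNorm_add_le ((hA n).norm.const_smul c1) ((hB n).const_smul c2) (by norm_num))
      filter_upwards [ae_restrict_mem hU.measurableSet] with x hx
      rw [norm_norm, hgrad n x hx]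
      have e : (2 * u x * Ψ (f n x)) • grad N u x +
          (u x ^ 2 * ψ' (max (f n x) 0)) • grad N (f n) x - X x =
          (2 * u x * (Ψ (f n x) - Ψ (ρ x))) • grad N u x +
          (u x ^ 2) • (ψ' (max (f n x) 0) • grad N (f n) x - ψ' (max (ρ x) 0) • G x) := by
        rw [hX]; module
      rw [e]
      refine (norm_add_le _ _).trans ?_
      rw [norm_smul, norm_smul]
      refine add_le_add ?_ ?_
      · have h1 := abs_sub_le_of_hasDerivAt hd hL (f n x) (ρ x)
        calc ‖2 * u x * (Ψ (f n x) - Ψ (ρ x))‖ * ‖grad N u x‖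
            = 2 * |u x| * |Ψ (f n x) - Ψ (ρ x)| * ‖grad N u x‖ := by
              rw [norm_mul, norm_mul]; simp
          _ ≤ 2 * C * ((ε ^ 2)⁻¹ * |f n x - ρ x|) * C' := by
              gcongr
              · exact hC x
              · exact hC' x
          _ = c1 * |f n x - ρ x| := by ring
      · simp only [Pi.smul_apply, smul_eq_mul]
        refine mul_le_mul_of_nonneg_right ?_ (norm_nonneg _)
        rw [norm_pow]
        exact pow_le_pow_left₀ (norm_nonneg _) (hC x) 2
    refine tendsto_of_tendsto_of_tendsto_of_le_of_le tendsto_const_nhds ?_ (fun _ => bot_le) hle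
    simpa using (ENNReal.Tendsto.const_mul hfρ (Or.inr enorm_ne_top)).add
      (ENNReal.Tendsto.const_mul (hfc _ hcont _ hL) (Or.inr enorm_ne_top))
  obtain ⟨hXi, hXlim⟩ := tendsto_integral_inner hU hρ.aemeasurableField (hρ.memLp_norm hU)
    (fun n => (hφ n).aemeasurableField_grad) hXm (fun n => (hφ n).memLp_norm_grad hfin) hlim
  have hX0 : 0 ≤ ∫ x in U, inner ℝ (G x) (X x) ∂riemannianVolume N M :=
    ge_of_tendsto' hXlim fun n => hsuper _ (hφ n) fun x => by
      have := hΨ0 (f n x)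
      rw [← mul_assoc]
      exact mul_nonneg (mul_self_nonneg _) this
  have hui : Integrable (fun x => ‖grad N u x‖ ^ 2) μ := (hu.memLp_norm_grad hfin).integrable_sq
  -- Completing the square: −½⟨G, X⟩ equals −u⟨G, ∇u⟩/(ρ+ε) + ½u²|G|²/(ρ+ε)². One half of the last
  -- term completes the square, the other half is the Hardy term with its factor ¼.
  have hF : (fun x => ‖grad N u x - ((1 / 2 : ℝ) * (u x / (ρ x + ε))) • G x‖ ^ 2 +
      1 / 4 * ‖(u x / (ρ x + ε)) • G x‖ ^ 2) =ᵐ[μ]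
      fun x => ‖grad N u x‖ ^ 2 - 1 / 2 * inner ℝ (G x) (X x) := by
    filter_upwards [hρ0] with x hx
    have e1 : Ψ (ρ x) = (ρ x + ε)⁻¹ := affineExtend_of_nonneg _ _ hx
    rw [hX]
    simp only [e1, max_eq_left hx, hψ']
    rw [norm_sub_sq_real, norm_smul, norm_smul, mul_pow, mul_pow, inner_add_right,
      real_inner_smul_right, real_inner_smul_right, real_inner_smul_right,
      real_inner_self_eq_norm_sq, real_inner_comm, Real.norm_eq_abs, Real.norm_eq_abs, sq_abs,
      sq_abs, ← inv_pow (ρ x + ε)]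
    ring
  have hm2 : AEMeasurable (fun x => ‖(u x / (ρ x + ε)) • G x‖ₑ ^ 2) μ := by
    have hd : AEStronglyMeasurable (fun x => u x / (ρ x + ε)) μ :=
      (hum.aemeasurable.div (hρ.aestronglyMeasurable.aemeasurable.add_const ε)).aestronglyMeasurable
    have := ((hρ.aemeasurableField.smul hd).aestronglyMeasurable_norm hU.measurableSet).enorm
    simpa only [enorm_norm] using this.pow_const 2
  calc _ = ∫⁻ x in U, ENNReal.ofReal (‖grad N u x - ((1 / 2 : ℝ) * (u x / (ρ x + ε))) • G x‖ ^ 2 +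
      1 / 4 * ‖(u x / (ρ x + ε)) • G x‖ ^ 2) ∂riemannianVolume N M := by
        rw [← lintegral_const_mul'' _ hm2, ← lintegral_add_right' _ (hm2.const_mul _)]
        refine lintegral_congr fun x => ?_
        rw [ENNReal.ofReal_add (by positivity) (by positivity), ENNReal.ofReal_mul (by norm_num),
          ENNReal.ofReal_pow (norm_nonneg _), ENNReal.ofReal_pow (norm_nonneg _), ofReal_norm,
          ofReal_norm]
    _ = ∫⁻ x in U, ENNReal.ofReal (‖grad N u x‖ ^ 2 - 1 / 2 * inner ℝ (G x) (X x))
          ∂riemannianVolume N M := lintegral_congr_ae (hF.fun_comp ENNReal.ofReal)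
    _ = ENNReal.ofReal (∫ x in U, ‖grad N u x‖ ^ 2 - 1 / 2 * inner ℝ (G x) (X x)
          ∂riemannianVolume N M) := by
        refine (ofReal_integral_eq_lintegral_ofReal (hui.sub (hXi.const_mul _)) ?_).symm
        filter_upwards [hF] with x hx
        rw [Pi.zero_apply, Pi.sub_apply, ← hx]
        positivity
    _ ≤ ENNReal.ofReal (∫ x in U, ‖grad N u x‖ ^ 2 ∂riemannianVolume N M) := by
        refine ENNReal.ofReal_le_ofReal ?_
        rw [integral_sub hui (hXi.const_mul _), integral_const_mul]
        linarith
    _ = _ := by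
        rw [ofReal_integral_eq_lintegral_ofReal hui (Eventually.of_forall fun x => by positivity)]
        refine lintegral_congr fun x => ?_
        rw [ENNReal.ofReal_pow (norm_nonneg _), ofReal_norm]

end

end RiemannianHardy

/-! ### Sobolev functions read in a chart. -/

namespace RiemannianHardy

noncomputable section

theorem memLp_of_tendsto_eLpNorm {α F : Type*} [MeasurableSpace α] {μ : Measure α}
    [NormedAddCommGroup F] {f : ℕ → α → F} {g : α → F} (hg : AEStronglyMeasurable g μ)
    (hf : ∀ n, MemLp (f n) 2 μ) (h : Tendsto (fun n => eLpNorm (f n - g) 2 μ) atTop (𝓝 0)) :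
    MemLp g 2 μ := by
  obtain ⟨n, hn⟩ := ((ENNReal.tendsto_nhds_zero.1 h) 1 one_pos).exists
  have h6 : MemLp (f n - g) 2 μ :=
    ⟨(hf n).aestronglyMeasurable.sub hg, hn.trans_lt ENNReal.one_lt_top⟩
  simpa using (hf n).sub h6

variable {N : ℕ} {M : Type*} [TopologicalSpace M] [ChartedSpace (EuclideanSpace ℝ (Fin N)) M]
  [IsManifold (𝓡 N) ∞ M] [RiemannianBundle (fun x : M => TangentSpace (𝓡 N) x)]

/-- The one-form dual to the vector field `G`, in the chart at `x₀`. -/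
def chartCovector (x₀ : M) (G : (x : M) → TangentSpace (𝓡 N) x) (y : EuclideanSpace ℝ (Fin N)) :
    EuclideanSpace ℝ (Fin N) →L[ℝ] ℝ :=
  (innerSL ℝ (G ((chartAt (EuclideanSpace ℝ (Fin N)) x₀).symm y))).comp (dsymm N x₀ y)

theorem chartCovector_apply (x₀ : M) (G : (x : M) → TangentSpace (𝓡 N) x)
    (y ξ : EuclideanSpace ℝ (Fin N)) : chartCovector x₀ G y ξ =
      inner ℝ (G ((chartAt (EuclideanSpace ℝ (Fin N)) x₀).symm y)) (dsymm N x₀ y ξ) := rfl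

theorem fderiv_comp_chart_symm_eq_chartCovector (x₀ : M) {f : M → ℝ}
    {y : EuclideanSpace ℝ (Fin N)}
    (hy : y ∈ (chartAt (EuclideanSpace ℝ (Fin N)) x₀).target)
    (hf : MDifferentiableAt (𝓡 N) 𝓘(ℝ, ℝ) f ((chartAt (EuclideanSpace ℝ (Fin N)) x₀).symm y)) :
    fderiv ℝ (f ∘ (chartAt (EuclideanSpace ℝ (Fin N)) x₀).symm) y =
      chartCovector x₀ (grad N f) y :=
  ContinuousLinearMap.ext fun ξ => fderiv_comp_chart_symm_eq_inner x₀ hy hf ξ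

theorem chartCovector_eq_sum {x₀ : M} {G : (x : M) → TangentSpace (𝓡 N) x}
    {y : EuclideanSpace ℝ (Fin N)} (hy : y ∈ (chartAt (EuclideanSpace ℝ (Fin N)) x₀).target) :
    chartCovector x₀ G y = ∑ i, (∑ j, dchart N x₀ ((chartAt (EuclideanSpace ℝ (Fin N)) x₀).symm y)
      (G ((chartAt (EuclideanSpace ℝ (Fin N)) x₀).symm y)) j * gramMatrix N x₀ y j i) •
        (EuclideanSpace.proj (𝕜 := ℝ) i : EuclideanSpace ℝ (Fin N) →L[ℝ] ℝ) := by
  ext ξ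
  rw [chartCovector_apply]
  conv_lhs => rw [← dsymm_dchart x₀ hy (G _), inner_dsymm]
  rw [Finset.sum_comm]
  have hproj : ∀ i, (EuclideanSpace.proj (𝕜 := ℝ) i : EuclideanSpace ℝ (Fin N) →L[ℝ] ℝ) ξ = ξ i :=
    fun _ => rfl
  simp only [sum_apply, smul_apply, smul_eq_mul, Finset.sum_mul, hproj]
  refine Finset.sum_congr rfl fun i _ => Finset.sum_congr rfl fun j _ => ?_
  ring

variable [T2Space M] [MeasurableSpace M] [BorelSpace M] [SecondCountableTopology M]
  [IsContMDiffRiemannianBundle (𝓡 N) ∞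
    (EuclideanSpace ℝ (Fin N)) (fun x : M => TangentSpace (𝓡 N) x)]
  {ρ : M → ℝ} {G : (x : M) → TangentSpace (𝓡 N) x}

namespace IsGoodBall

variable {x₀ : M} {R C : ℝ}

theorem norm_chartCovector_le (h : IsGoodBall (N := N) x₀ R C) {y : EuclideanSpace ℝ (Fin N)}
    (hy : y ∈ Metric.ball (chartAt (EuclideanSpace ℝ (Fin N)) x₀ x₀) R) :
    ‖chartCovector x₀ G y‖ ≤ C * ‖G ((chartAt (EuclideanSpace ℝ (Fin N)) x₀).symm y)‖ := by
  refine ContinuousLinearMap.opNorm_le_bound _ (mul_nonneg h.C_pos.le (norm_nonneg _)) fun ξ => ?_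
  rw [chartCovector_apply]
  refine (norm_inner_le_norm _ _).trans ?_
  calc _ ≤ ‖G ((chartAt (EuclideanSpace ℝ (Fin N)) x₀).symm y)‖ * (C * ‖ξ‖) :=
        mul_le_mul_of_nonneg_left (h.norm_le y (Metric.ball_subset_closedBall hy) ξ) (norm_nonneg _)
    _ = _ := by ring

/-- Evaluate the covector on the coordinates of the vector itself, which gives the squared norm, and
divide by the norm. -/
theorem norm_le_chartCovector (h : IsGoodBall (N := N) x₀ R C) {y : EuclideanSpace ℝ (Fin N)}
    (hy : y ∈ Metric.ball (chartAt (EuclideanSpace ℝ (Fin N)) x₀ x₀) R) :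
    ‖G ((chartAt (EuclideanSpace ℝ (Fin N)) x₀).symm y)‖ ≤ C * ‖chartCovector x₀ G y‖ := by
  set v := G ((chartAt (EuclideanSpace ℝ (Fin N)) x₀).symm y) with hv
  set ξ := dchart N x₀ ((chartAt (EuclideanSpace ℝ (Fin N)) x₀).symm y) v with hξ
  have hyB := Metric.ball_subset_closedBall hy
  have e1 : dsymm N x₀ y ξ = v := dsymm_dchart x₀ (h.subset_target hyB) v
  have h1 : ‖v‖ * ‖v‖ ≤ ‖chartCovector x₀ G y‖ * (C * ‖v‖) := by
    calc ‖v‖ * ‖v‖ = chartCovector x₀ G y ξ := by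
          rw [chartCovector_apply, e1, ← hv, real_inner_self_eq_norm_mul_norm]
      _ ≤ ‖chartCovector x₀ G y‖ * ‖ξ‖ :=
          (le_abs_self _).trans ((chartCovector x₀ G y).le_opNorm ξ)
      _ ≤ _ := by
          refine mul_le_mul_of_nonneg_left ?_ (norm_nonneg _)
          have := h.le_norm y hyB ξ
          rwa [e1] at this
  rcases (norm_nonneg v).eq_or_lt with h0 | h0
  · rw [← h0]; exact mul_nonneg h.C_pos.le (norm_nonneg _)
  · refine le_of_mul_le_mul_right ?_ h0
    linarith

theorem aestronglyMeasurable_comp_symm (h : IsGoodBall (N := N) x₀ R C) {F : Type*}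
    [TopologicalSpace F] [TopologicalSpace.PseudoMetrizableSpace F] {f : M → F}
    (hf : AEStronglyMeasurable f ((riemannianVolume N M).restrict (chartBall N x₀ R))) :
    AEStronglyMeasurable (fun y => f ((chartAt (EuclideanSpace ℝ (Fin N)) x₀).symm y))
      (volume.restrict (Metric.ball (chartAt (EuclideanSpace ℝ (Fin N)) x₀ x₀) R)) :=
  (hf.mono_ac h.quasiMeasurePreserving_symm).comp_aemeasurable h.aemeasurable_symm

theorem aestronglyMeasurable_chartCovector (h : IsGoodBall (N := N) x₀ R C)
    (hG : AEMeasurableField (chartBall N x₀ R) G) :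
    AEStronglyMeasurable (chartCovector x₀ G)
      (volume.restrict (Metric.ball (chartAt (EuclideanSpace ℝ (Fin N)) x₀ x₀) R)) := by
  set e := chartAt (EuclideanSpace ℝ (Fin N)) x₀
  have hsub : Metric.ball (e x₀) R ⊆ e.target :=
    Metric.ball_subset_closedBall.trans h.subset_target
  have h1 := hG x₀
  rw [inter_eq_left.2 (fun x hx => hx.1)] at h1
  have h2 := h.aestronglyMeasurable_comp_symm h1
  have h3 : AEStronglyMeasurable (fun y => ∑ i, (∑ j, dchart N x₀ (e.symm y) (G (e.symm y)) j *
      gramMatrix N x₀ y j i) • (EuclideanSpace.proj (𝕜 := ℝ) i : EuclideanSpace ℝ (Fin N) →L[ℝ] ℝ))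
      (volume.restrict (Metric.ball (e x₀) R)) := by
    refine Finset.aestronglyMeasurable_fun_sum _ fun i _ => AEStronglyMeasurable.smul_const ?_ _
    refine Finset.aestronglyMeasurable_fun_sum _ fun j _ => AEStronglyMeasurable.mul ?_ ?_
    · exact (EuclideanSpace.proj (𝕜 := ℝ) j).continuous.comp_aestronglyMeasurable h2
    · exact ((continuousOn_gramMatrix x₀ j i).mono hsub).aestronglyMeasurable
        Metric.isOpen_ball.measurableSet
  refine h3.congr ?_
  filter_upwards [ae_restrict_mem Metric.isOpen_ball.measurableSet] with y hy
  exact (chartCovector_eq_sum (hsub hy)).symm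

/-- Functions on the coordinate space that vanish off the ball are controlled by functions
on the manifold. -/
theorem eLpNorm_le (h : IsGoodBall (N := N) x₀ R C) {F F' : Type*} [NormedAddCommGroup F]
    [NormedAddCommGroup F'] {g : EuclideanSpace ℝ (Fin N) → F} {f : M → F'} {K : ℝ}
    (hf : AEStronglyMeasurable f ((riemannianVolume N M).restrict (chartBall N x₀ R)))
    (hg : ∀ y ∈ Metric.ball (chartAt (EuclideanSpace ℝ (Fin N)) x₀ x₀) R,
      ‖g y‖ ≤ K * ‖f ((chartAt (EuclideanSpace ℝ (Fin N)) x₀).symm y)‖)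
    (hg0 : ∀ y ∉ Metric.ball (chartAt (EuclideanSpace ℝ (Fin N)) x₀ x₀) R, g y = 0) :
    eLpNorm g 2 volume ≤ ENNReal.ofReal K * (ENNReal.ofReal C ^ (1 / 2 : ℝ) *
      eLpNorm f 2 ((riemannianVolume N M).restrict (chartBall N x₀ R))) := by
  rw [← eLpNorm_restrict_eq_of_support_subset (s := Metric.ball (chartAt _ x₀ x₀) R)
    fun y hy => by_contra fun hy' => hy (hg0 y hy')]
  refine (eLpNorm_le_mul_eLpNorm_of_ae_le_mul ?_ 2).trans
    (mul_le_mul_right (h.eLpNorm_comp_symm_le hf) _)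
  filter_upwards [ae_restrict_mem Metric.isOpen_ball.measurableSet] with y hy using hg y hy

/-- A localized `W^{1,2}` function read in a chart. -/
theorem hasL2WeakFDeriv (h : IsGoodBall (N := N) x₀ R C)
    (hρ : IsW12 N (chartBall N x₀ R) ρ G) {χ : EuclideanSpace ℝ (Fin N) → ℝ}
    (hχ : ContDiff ℝ 1 χ) (hχs : tsupport χ ⊆ Metric.ball (chartAt _ x₀ x₀) R)
    (hχc : HasCompactSupport χ) (hχ1 : ∀ y, |χ y| ≤ 1) :
    HasL2WeakFDeriv volume
      (fun y => χ y * ρ ((chartAt (EuclideanSpace ℝ (Fin N)) x₀).symm y))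
      (fun y => χ y • chartCovector x₀ G y +
        ρ ((chartAt (EuclideanSpace ℝ (Fin N)) x₀).symm y) • fderiv ℝ χ y) := by
  set e := chartAt (EuclideanSpace ℝ (Fin N)) x₀ with he
  set B := Metric.ball (e x₀) R with hB
  set μ := (riemannianVolume N M).restrict (chartBall N x₀ R)
  have hBm : MeasurableSet B := Metric.isOpen_ball.measurableSet
  have hW := isOpen_chartBall (N := N) x₀ R
  have hsub : B ⊆ e.target := Metric.ball_subset_closedBall.trans h.subset_target
  have hχ0 : ∀ y ∉ B, χ y = 0 := fun y hy => image_eq_zero_of_notMem_tsupport fun h' => hy (hχs h')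
  have hdχ0 : ∀ y ∉ B, fderiv ℝ χ y = 0 := fun y hy => fderiv_of_notMem_tsupport ℝ
    fun h' => hy (hχs h')
  have hdχ : Continuous (fderiv ℝ χ) := hχ.continuous_fderiv (by simp)
  obtain ⟨K, hK⟩ := (hχc.fderiv ℝ).exists_bound_of_continuous hdχ
  obtain ⟨f, h1, h2, h3, h4, h5⟩ := hρ.exists_approx
  have hmem : ∀ y ∈ B, e.symm y ∈ chartBall N x₀ R := fun y hy =>
    ⟨e.map_target (hsub hy), by rwa [mem_preimage, ← he, e.right_inv (hsub hy)]⟩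
  have hfe : ∀ n, ContDiffOn ℝ 1 (f n ∘ e.symm) B := fun n => by
    rw [← contMDiffOn_iff_contDiffOn]
    exact ((h1 n).of_le (by simp)).comp
      (((contMDiffOn_chart_symm (I := 𝓡 N) (n := ∞) (x := x₀)).of_le (by simp)).mono hsub) hmem
  have hg : ∀ n, ContDiff ℝ 1 (fun y => χ y * f n (e.symm y)) := fun n => by
    rw [contDiff_iff_contDiffAt]
    intro y
    by_cases hy : y ∈ tsupport χ
    · exact hχ.contDiffAt.mul ((hfe n).contDiffAt (Metric.isOpen_ball.mem_nhds (hχs hy)))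
    · refine contDiffAt_const (c := (0 : ℝ)) |>.congr_of_eventuallyEq ?_
      filter_upwards [notMem_tsupport_iff_eventuallyEq.1 hy] with z hz
      simp [hz]
  have hgc : ∀ n, HasCompactSupport (fun y => χ y * f n (e.symm y)) := fun n => hχc.mul_right
  have hgd : ∀ n, ∀ y ∈ B, fderiv ℝ (fun y => χ y * f n (e.symm y)) y =
      χ y • chartCovector x₀ (grad N (f n)) y + f n (e.symm y) • fderiv ℝ χ y := fun n y hy => by
    have e1 : DifferentiableAt ℝ (f n ∘ e.symm) y :=
      ((hfe n).contDiffAt (Metric.isOpen_ball.mem_nhds hy)).differentiableAt (by simp)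
    rw [← fderiv_comp_chart_symm_eq_chartCovector x₀ (hsub hy)
      (((h1 n).contMDiffAt (hW.mem_nhds (hmem y hy))).mdifferentiableAt (by simp))]
    exact fderiv_fun_mul (hχ.differentiable (by simp) y) e1
  have hgd0 : ∀ n, ∀ y ∉ B, fderiv ℝ (fun y => χ y * f n (e.symm y)) y = 0 := fun n y hy =>
    fderiv_of_notMem_tsupport ℝ fun h' => hy (hχs (tsupport_mul_subset_left h'))
  have hrm : AEStronglyMeasurable (fun y => χ y * ρ (e.symm y)) volume := by
    have hind : B.indicator (fun y => χ y * ρ (e.symm y)) = fun y => χ y * ρ (e.symm y) :=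
      indicator_eq_self.2 fun y hy => by_contra fun hy' => hy (by simp [hχ0 y hy'])
    rw [← hind, aestronglyMeasurable_indicator_iff hBm]
    exact hχ.continuous.aestronglyMeasurable.mul
      (h.aestronglyMeasurable_comp_symm hρ.aestronglyMeasurable)
  have hDm : AEStronglyMeasurable (fun y => χ y • chartCovector x₀ G y +
      ρ (e.symm y) • fderiv ℝ χ y) volume := by
    have hind : B.indicator (fun y => χ y • chartCovector x₀ G y + ρ (e.symm y) • fderiv ℝ χ y) =
        fun y => χ y • chartCovector x₀ G y + ρ (e.symm y) • fderiv ℝ χ y :=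
      indicator_eq_self.2 fun y hy => by_contra fun hy' => hy (by simp [hχ0 y hy', hdχ0 y hy'])
    rw [← hind, aestronglyMeasurable_indicator_iff hBm]
    exact (hχ.continuous.aestronglyMeasurable.smul
      (h.aestronglyMeasurable_chartCovector hρ.aemeasurableField)).add
      ((h.aestronglyMeasurable_comp_symm hρ.aestronglyMeasurable).smul hdχ.aestronglyMeasurable)
  have hm1 : ∀ n, AEStronglyMeasurable (fun x => f n x - ρ x) μ := fun n =>
    (h2 n).aestronglyMeasurable.sub hρ.aestronglyMeasurable
  have hm2 : ∀ n, AEStronglyMeasurable (fun x => ‖grad N (f n) x - G x‖) μ := fun n =>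
    ((IsW12.aemeasurableField_approx hW (h1 n)).sub hρ.aemeasurableField).aestronglyMeasurable_norm
      hW.measurableSet
  have hlim1 : Tendsto (fun n => eLpNorm ((fun y => χ y * f n (e.symm y)) -
      fun y => χ y * ρ (e.symm y)) 2 volume) atTop (𝓝 0) := by
    have hle := fun n => h.eLpNorm_le (K := 1) (hm1 n)
      (g := (fun y => χ y * f n (e.symm y)) - fun y => χ y * ρ (e.symm y))
      (fun y _ => by
        rw [Pi.sub_apply, ← mul_sub, norm_mul]
        exact mul_le_mul_of_nonneg_right (hχ1 y) (norm_nonneg _))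
      (fun y hy => by simp [hχ0 y hy])
    refine tendsto_of_tendsto_of_tendsto_of_le_of_le tendsto_const_nhds ?_ (fun _ => bot_le) hle
    simpa using ENNReal.Tendsto.const_mul h4 (Or.inr (by finiteness :
      ENNReal.ofReal C ^ (1 / 2 : ℝ) ≠ ⊤))
  have hlim2 : Tendsto (fun n => eLpNorm (fderiv ℝ (fun y => χ y * f n (e.symm y)) -
      fun y => χ y • chartCovector x₀ G y + ρ (e.symm y) • fderiv ℝ χ y) 2 volume)
      atTop (𝓝 0) := by
    have hle := fun n => h.eLpNorm_le (K := max C K) ((hm2 n).add (hm1 n).norm)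
      (g := fderiv ℝ (fun y => χ y * f n (e.symm y)) -
        fun y => χ y • chartCovector x₀ G y + ρ (e.symm y) • fderiv ℝ χ y)
      (fun y hy => by
        have e1 : chartCovector x₀ (fun x => grad N (f n) x - G x) y =
            chartCovector x₀ (grad N (f n)) y - chartCovector x₀ G y := by
          ext ξ
          simp only [chartCovector_apply, sub_apply, inner_sub_left]
        have e2 : (fderiv ℝ (fun y => χ y * f n (e.symm y)) -
            fun y => χ y • chartCovector x₀ G y + ρ (e.symm y) • fderiv ℝ χ y) y =
            χ y • chartCovector x₀ (fun x => grad N (f n) x - G x) y +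
              (f n (e.symm y) - ρ (e.symm y)) • fderiv ℝ χ y := by
          rw [Pi.sub_apply, hgd n y hy, e1]; module
        rw [e2]
        refine (norm_add_le _ _).trans ?_
        rw [norm_smul, norm_smul, Pi.add_apply,
          Real.norm_of_nonneg (add_nonneg (norm_nonneg _) (norm_nonneg _)),
          mul_add]
        refine add_le_add ?_ ?_
        · calc _ ≤ 1 * ‖chartCovector x₀ (fun x => grad N (f n) x - G x) y‖ :=
                mul_le_mul_of_nonneg_right (hχ1 y) (norm_nonneg _)
            _ ≤ C * _ := by rw [one_mul]; exact h.norm_chartCovector_le hy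
            _ ≤ _ := mul_le_mul_of_nonneg_right (le_max_left _ _) (norm_nonneg _)
        · rw [mul_comm]
          exact mul_le_mul_of_nonneg_right ((hK y).trans (le_max_right _ _)) (norm_nonneg _))
      (fun y hy => by simp [hχ0 y hy, hdχ0 y hy, hgd0 n y hy])
    have hle' := fun n => (hle n).trans (mul_le_mul_right (mul_le_mul_right
      (eLpNorm_add_le (hm2 n) (hm1 n).norm (by norm_num)) _) _)
    refine tendsto_of_tendsto_of_tendsto_of_le_of_le tendsto_const_nhds ?_ (fun _ => bot_le) hle'
    simp only [eLpNorm_norm (fun x => f _ x - ρ x)]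
    simpa using ENNReal.Tendsto.const_mul (ENNReal.Tendsto.const_mul (h5.add h4)
      (Or.inr (by finiteness : ENNReal.ofReal C ^ (1 / 2 : ℝ) ≠ ⊤)))
      (Or.inr (ENNReal.ofReal_ne_top (r := max C K)))
  exact ⟨memLp_of_tendsto_eLpNorm hrm
      (fun n => (hg n).continuous.memLp_of_hasCompactSupport (hgc n)) hlim1,
    memLp_of_tendsto_eLpNorm hDm (fun n => ((hg n).continuous_fderiv (by simp)).memLp_of_hasCompactSupport
      ((hgc n).fderiv ℝ)) hlim2, _, hg, hgc, hlim1, hlim2⟩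

end IsGoodBall

end

end RiemannianHardy

/-! ### Approximation in the energy norm with weight ρ: local form. -/

namespace RiemannianHardy

noncomputable section

variable {N : ℕ} {M : Type*} [TopologicalSpace M] [ChartedSpace (EuclideanSpace ℝ (Fin N)) M]
  [IsManifold (𝓡 N) ∞ M] [RiemannianBundle (fun x : M => TangentSpace (𝓡 N) x)]
  [MeasurableSpace M]

variable (N) in
/-- The measure `ρ dv_g` on `U`. -/
def weightedVolume (U : Set M) (ρ : M → ℝ) : Measure M :=
  ((riemannianVolume N M).restrict U).withDensity fun x => ENNReal.ofReal (ρ x)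

theorem weightedVolume_absolutelyContinuous (U : Set M) (ρ : M → ℝ) :
    weightedVolume N U ρ ≪ (riemannianVolume N M).restrict U :=
  withDensity_absolutelyContinuous _ _

theorem lintegral_weightedVolume {U : Set M} {ρ : M → ℝ}
    (hρ : AEStronglyMeasurable ρ ((riemannianVolume N M).restrict U)) (f : M → ℝ≥0∞) :
    ∫⁻ x, f x ∂weightedVolume N U ρ =
      ∫⁻ x in U, ENNReal.ofReal (ρ x) * f x ∂riemannianVolume N M :=
  lintegral_withDensity_eq_lintegral_mul_non_measurable₀ _ hρ.aemeasurable.ennreal_ofReal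
    (Eventually.of_forall fun _ => ENNReal.ofReal_lt_top) f

theorem weightedVolume_restrict {U W : Set M} (hW : MeasurableSet W) (hWU : W ⊆ U) (ρ : M → ℝ) :
    (weightedVolume N U ρ).restrict W = weightedVolume N W ρ := by
  rw [weightedVolume, restrict_withDensity hW, Measure.restrict_restrict hW, inter_eq_left.2 hWU,
    weightedVolume]

variable [BorelSpace M]

/-- The function `v` with weak gradient `X` is a limit of functions in `C₀¹(U)`, in the norm
`(∫ ρ |v|² + ∫ ρ |∇v|²)^{1/2}`. -/
structure IsWeightedLimit (U : Set M) (ρ v : M → ℝ) (X : (x : M) → TangentSpace (𝓡 N) x) :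
    Prop where
  aestronglyMeasurable : AEStronglyMeasurable v ((riemannianVolume N M).restrict U)
  aemeasurableField : AEMeasurableField U X
  exists_approx : ∃ w : ℕ → M → ℝ, (∀ k, IsC10 N U (w k)) ∧
    Tendsto (fun k => eLpNorm (fun x => w k x - v x) 2 (weightedVolume N U ρ)) atTop (𝓝 0) ∧
    Tendsto (fun k => eLpNorm (fun x => ‖grad N (w k) x - X x‖) 2 (weightedVolume N U ρ))
      atTop (𝓝 0)

theorem IsWeightedLimit.of_subset {U W : Set M} {ρ v : M → ℝ}
    {X : (x : M) → TangentSpace (𝓡 N) x} (h : IsWeightedLimit W ρ v X) (hW : MeasurableSet W)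
    (hWU : W ⊆ U) (hv : AEStronglyMeasurable v ((riemannianVolume N M).restrict U))
    (hX : AEMeasurableField U X) (hv0 : ∀ x ∉ W, v x = 0) (hX0 : ∀ x ∉ W, X x = 0) :
    IsWeightedLimit U ρ v X := by
  obtain ⟨w, h1, h2, h3⟩ := h.exists_approx
  refine ⟨hv, hX, w, fun k => (h1 k).mono hWU, ?_, ?_⟩
  · convert h2 using 2 with k
    rw [← weightedVolume_restrict hW hWU, eLpNorm_restrict_eq_of_support_subset]
    intro x hx
    by_contra hxW
    refine hx ?_
    simp only [hv0 x hxW, sub_zero]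
    exact image_eq_zero_of_notMem_tsupport fun h' => hxW ((h1 k).tsupport_subset h')
  · convert h3 using 2 with k
    rw [← weightedVolume_restrict hW hWU, eLpNorm_restrict_eq_of_support_subset]
    intro x hx
    by_contra hxW
    refine hx ?_
    simp only [hX0 x hxW, sub_zero, norm_eq_zero]
    exact grad_eq_zero_of_notMem_tsupport fun h' => hxW ((h1 k).tsupport_subset h')

variable [T2Space M] [SecondCountableTopology M]
  [IsContMDiffRiemannianBundle (𝓡 N) ∞
    (EuclideanSpace ℝ (Fin N)) (fun x : M => TangentSpace (𝓡 N) x)]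
  {U : Set M} {ρ : M → ℝ} {G : (x : M) → TangentSpace (𝓡 N) x}

theorem IsWeightedLimit.add {v v' : M → ℝ} {X X' : (x : M) → TangentSpace (𝓡 N) x}
    (hU : IsOpen U) (h : IsWeightedLimit U ρ v X) (h' : IsWeightedLimit U ρ v' X') :
    IsWeightedLimit U ρ (fun x => v x + v' x) (fun x => X x + X' x) := by
  obtain ⟨w, h1, h2, h3⟩ := h.exists_approx
  obtain ⟨w', h1', h2', h3'⟩ := h'.exists_approx
  have hac := weightedVolume_absolutelyContinuous (N := N) U ρ
  have hm : ∀ {w v : M → ℝ}, IsC10 N U w →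
      AEStronglyMeasurable v ((riemannianVolume N M).restrict U) →
      AEStronglyMeasurable (fun x => w x - v x) (weightedVolume N U ρ) := fun hw hv =>
    (hw.contMDiff.continuous.aestronglyMeasurable.sub hv).mono_ac hac
  have hm' : ∀ {w : M → ℝ} {X : (x : M) → TangentSpace (𝓡 N) x}, IsC10 N U w →
      AEMeasurableField U X →
      AEStronglyMeasurable (fun x => ‖grad N w x - X x‖) (weightedVolume N U ρ) := fun hw hX =>
    ((hw.aemeasurableField_grad.sub hX).aestronglyMeasurable_norm hU.measurableSet).mono_ac hac
  refine ⟨h.aestronglyMeasurable.add h'.aestronglyMeasurable,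
    h.aemeasurableField.add h'.aemeasurableField, fun k x => w k x + w' k x,
    fun k => (h1 k).add (h1' k), ?_, ?_⟩
  · refine tendsto_of_tendsto_of_tendsto_of_le_of_le tendsto_const_nhds
      (by simpa using h2.add h2') (fun _ => bot_le) fun k => ?_
    refine le_trans (le_of_eq ?_) (eLpNorm_add_le (hm (h1 k) h.aestronglyMeasurable)
      (hm (h1' k) h'.aestronglyMeasurable) (by norm_num))
    congr 1
    ext x
    simp only [Pi.add_apply]
    ring
  · refine tendsto_of_tendsto_of_tendsto_of_le_of_le tendsto_const_nhds
      (by simpa using h3.add h3') (fun _ => bot_le) fun k => ?_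
    refine le_trans (eLpNorm_mono_real fun x => ?_) (eLpNorm_add_le (hm' (h1 k) h.aemeasurableField)
      (hm' (h1' k) h'.aemeasurableField) (by norm_num))
    rw [grad_add ((h1 k).contMDiff.mdifferentiable (by simp) x)
      ((h1' k).contMDiff.mdifferentiable (by simp) x), norm_norm, Pi.add_apply, add_sub_add_comm]
    exact norm_add_le _ _

theorem IsW12.isFiniteMeasure_weightedVolume (hρ : IsW12 N U ρ G)
    (hfin : riemannianVolume N M U < ⊤) : IsFiniteMeasure (weightedVolume N U ρ) := by
  have : IsFiniteMeasure ((riemannianVolume N M).restrict U) := ⟨by simpa using hfin⟩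
  exact isFiniteMeasure_withDensity_ofReal (hρ.memLp.integrable (by norm_num)).2

/-- A smooth cutoff function for a compact subset of a ball. -/
theorem exists_cutoff {K : Set (EuclideanSpace ℝ (Fin N))} (hK : IsCompact K)
    {y₀ : EuclideanSpace ℝ (Fin N)} {R : ℝ} (hR : 0 < R) (hKR : K ⊆ Metric.ball y₀ R) :
    ∃ χ : EuclideanSpace ℝ (Fin N) → ℝ, ContDiff ℝ 1 χ ∧ tsupport χ ⊆ Metric.ball y₀ R ∧
      HasCompactSupport χ ∧ (∀ y, 0 ≤ χ y) ∧ (∀ y, χ y ≤ 1) ∧ ∀ y ∈ K, χ =ᶠ[𝓝 y] fun _ => 1 := by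
  obtain ⟨r, ⟨hr0, hr⟩, hKr⟩ := exists_pos_lt_subset_ball hR hK.isClosed hKR
  let b : ContDiffBump y₀ := ⟨r, (r + R) / 2, hr0, by linarith⟩
  refine ⟨b, b.contDiff, ?_, b.hasCompactSupport, fun y => b.nonneg, fun y => b.le_one,
    fun y hy => b.eventuallyEq_one_of_mem_ball (hKr hy)⟩
  rw [b.tsupport_eq]
  exact Metric.closedBall_subset_ball (by simp only [b]; linarith)

/-- The approximations are uψ(F_k), with F_k the mollifications of a cut-off ρ in coordinates. In
the gradient, the term with ∇u converges by dominated convergence and the term with ∇F_k by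
`HasL2WeakFDeriv.exists_mollification`. Bounds on ψ and on c(t)²t are asked only for t ≥ 0, since ρ
and F_k are nonnegative and ψ may be an unbounded affine extension. -/
theorem IsGoodBall.isWeightedLimit {x₀ : M} {R C : ℝ} (h : IsGoodBall (N := N) x₀ R C)
    (hρ : IsW12 N (chartBall N x₀ R) ρ G)
    (hρ0 : ∀ᵐ x ∂(riemannianVolume N M).restrict (chartBall N x₀ R), 0 ≤ ρ x)
    {ψ c : ℝ → ℝ} (hψ : ∀ t, HasDerivAt ψ (c t) t) (hc : Continuous c) {K : ℝ}
    (hcb : ∀ t, |c t| ≤ K) (hct : ∀ t, 0 ≤ t → c t ^ 2 * t ≤ K) (hψb : ∀ t, 0 ≤ t → |ψ t| ≤ K)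
    {u : M → ℝ} (hu : IsC10 N (chartBall N x₀ R) u) :
    IsWeightedLimit (chartBall N x₀ R) ρ (fun x => u x * ψ (ρ x))
      (fun x => ψ (ρ x) • grad N u x + (u x * c (ρ x)) • G x) := by
  set e := chartAt (EuclideanSpace ℝ (Fin N)) x₀ with he
  set W := chartBall N x₀ R with hWdef
  set B := Metric.ball (e x₀) R with hB
  set ν := weightedVolume N W ρ with hν
  have hW : IsOpen W := isOpen_chartBall x₀ R
  have hsub : B ⊆ e.target := Metric.ball_subset_closedBall.trans h.subset_target
  have hψ1 : ContDiff ℝ 1 ψ := contDiff_one_of_hasDerivAt hψ hc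
  have hac : ν ≪ (riemannianVolume N M).restrict W := weightedVolume_absolutelyContinuous W ρ
  have hνf : IsFiniteMeasure ν := hρ.isFiniteMeasure_weightedVolume h.volume_lt_top
  -- The cutoff is 1 near the image of the support of u, so there the cut-off function and its
  -- differential are those of ρ.
  obtain ⟨χ, hχ, hχs, hχc, hχ0, hχ1, hχK⟩ := exists_cutoff
    (hu.hasCompactSupport.isCompact.image_of_continuousOn
      (e.continuousOn.mono fun x hx => (hu.tsupport_subset hx).1)) h.R_pos
    (image_subset_iff.2 fun x hx => (hu.tsupport_subset hx).2 : e '' tsupport u ⊆ B)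
  have hweak := h.hasL2WeakFDeriv hρ hχ hχs hχc
    fun y => by rw [abs_of_nonneg (hχ0 y)]; exact hχ1 y
  set r : EuclideanSpace ℝ (Fin N) → ℝ := fun y => χ y * ρ (e.symm y) with hr
  set D : EuclideanSpace ℝ (Fin N) → EuclideanSpace ℝ (Fin N) →L[ℝ] ℝ := fun y =>
    χ y • chartCovector x₀ G y + ρ (e.symm y) • fderiv ℝ χ y with hD
  have hrs : ∀ y ∉ B, r y = 0 := fun y hy => by
    simp only [hr, image_eq_zero_of_notMem_tsupport fun h' => hy (hχs h'), zero_mul]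
  have hr0 : ∀ᵐ y, 0 ≤ r y := by
    have := (ae_restrict_iff' Metric.isOpen_ball.measurableSet).1 (h.ae_comp_symm hρ0)
    filter_upwards [this] with y hy
    by_cases hyB : y ∈ B
    · exact mul_nonneg (hχ0 y) (hy hyB)
    · exact (hrs y hyB).ge
  have hri : Integrable r := by
    rw [← integrableOn_iff_integrable_of_support_subset (s := B)
      fun y hy => by_contra fun hy' => hy (hrs y hy')]
    have : IsFiniteMeasure (volume.restrict B) := ⟨by simpa using measure_ball_lt_top⟩
    exact (hweak.memLp.restrict B).integrable (by norm_num)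
  obtain ⟨F, hF, hF0, hFr, hFD⟩ := hweak.exists_mollification hr0 hri hc hcb hct
  have hFe : ∀ k, ContMDiffOn (𝓡 N) 𝓘(ℝ, ℝ) 1 (fun x => F k (e x)) W := fun k =>
    (hF k).contMDiff.comp_contMDiffOn
      (((contMDiffOn_chart (I := 𝓡 N) (n := ∞) (x := x₀)).of_le (by simp)).mono fun x hx => hx.1)
  have hψFe : ∀ k, ContMDiffOn (𝓡 N) 𝓘(ℝ, ℝ) 1 (fun x => ψ (F k (e x))) W := fun k =>
    hψ1.contMDiff.comp_contMDiffOn (hFe k)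
  have hum : AEStronglyMeasurable u ((riemannianVolume N M).restrict W) :=
    hu.contMDiff.continuous.aestronglyMeasurable
  have hρm := hρ.aestronglyMeasurable
  have hψρ : AEStronglyMeasurable (fun x => ψ (ρ x)) ((riemannianVolume N M).restrict W) :=
    hψ1.continuous.comp_aestronglyMeasurable hρm
  have hcρ : AEStronglyMeasurable (fun x => c (ρ x)) ((riemannianVolume N M).restrict W) :=
    hc.comp_aestronglyMeasurable hρm
  have hK0 : 0 ≤ K := (abs_nonneg _).trans (hcb 0)
  have hχu : ∀ x ∈ tsupport u, χ =ᶠ[𝓝 (e x)] fun _ => 1 := fun x hx => hχK _ ⟨x, hx, rfl⟩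
  have hae : ∀ᵐ x ∂(riemannianVolume N M).restrict W,
      Tendsto (fun k => F k (e x)) atTop (𝓝 (r (e x))) := by
    refine h.ae_of_ae_comp_symm ?_
    filter_upwards [ae_restrict_of_ae hFr, ae_restrict_mem Metric.isOpen_ball.measurableSet]
      with y hy hyB
    rwa [← he, e.right_inv (hsub hyB)]
  -- Used twice: with q = u for the functions and with q = |∇u| for the first term of the gradients.
  have hdom : ∀ q : M → ℝ, Continuous q → (∃ Q, 0 ≤ Q ∧ ∀ x, |q x| ≤ Q) →
      (∀ x ∉ tsupport u, q x = 0) →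
      Tendsto (fun k => eLpNorm (fun x => q x * (ψ (F k (e x)) - ψ (ρ x))) 2 ν) atTop (𝓝 0) := by
    rintro q hq ⟨Q, hQ0, hQ⟩ hq0
    rw [tendsto_eLpNorm_two_iff, ← lintegral_zero (μ := ν)]
    refine tendsto_lintegral_of_dominated_convergence' (fun _ => ‖Q * (2 * K)‖ₑ ^ 2)
      (fun k => ?_) (fun k => ?_) ?_ ?_
    · exact (((hq.aestronglyMeasurable.mul (((hψFe k).continuousOn.aestronglyMeasurable
        hW.measurableSet).sub hψρ)).mono_ac hac).enorm.pow_const 2)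
    · filter_upwards [hac.ae_le hρ0] with x hx
      gcongr
      rw [enorm_le_iff_norm_le, Real.norm_of_nonneg (mul_nonneg hQ0 (mul_nonneg zero_le_two hK0)), norm_mul]
      refine mul_le_mul (hQ x) ?_ (norm_nonneg _) hQ0
      refine (abs_sub _ _).trans ?_
      linarith [hψb _ (hF0 k (e x)), hψb _ hx]
    · rw [lintegral_const]
      finiteness
    · filter_upwards [hac.ae_le hae] with x hx
      by_cases hxu : x ∈ tsupport u
      · have e1 : r (e x) = ρ x := by
          simp only [hr, (hχu x hxu).eq_of_nhds, one_mul, e.left_inv (hu.tsupport_subset hxu).1]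
        rw [e1] at hx
        have e2 : Tendsto (fun k => q x * (ψ (F k (e x)) - ψ (ρ x))) atTop
            (𝓝 (q x * (ψ (ρ x) - ψ (ρ x)))) :=
          (((hψ1.continuous.tendsto _).comp hx).sub_const _).const_mul _
        simpa using ENNReal.Tendsto.pow (n := 2) e2.enorm
      · simp [hq0 x hxu]
  have hXm : AEMeasurableField W (fun x => ψ (ρ x) • grad N u x + (u x * c (ρ x)) • G x) :=
    (hu.aemeasurableField_grad.smul hψρ).add (hρ.aemeasurableField.smul (hum.mul hcρ))
  refine ⟨hum.mul hψρ, hXm, fun k x => u x * ψ (F k (e x)),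
    fun k => hu.mul_contMDiffOn hW (hψFe k), ?_, ?_⟩
  · have := hdom u hu.contMDiff.continuous hu.exists_bound
      fun x hx => image_eq_zero_of_notMem_tsupport hx
    simpa only [mul_sub] using this
  obtain ⟨Q, hQ0, hQ⟩ := hu.exists_bound
  -- The error in the derivative of ψ(F_k). On the support of u its covector in coordinates is the
  -- quantity that `exists_mollification` controls with weight `r`.
  set Z : ℕ → (x : M) → TangentSpace (𝓡 N) x := fun k x =>
    c (F k (e x)) • grad N (fun x => F k (e x)) x - c (ρ x) • G x with hZ
  have hgrad : ∀ k, ∀ x ∈ W, grad N (fun x => u x * ψ (F k (e x))) x -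
      (ψ (ρ x) • grad N u x + (u x * c (ρ x)) • G x) =
      (ψ (F k (e x)) - ψ (ρ x)) • grad N u x + u x • Z k x := fun k x hx => by
    have e0 : MDifferentiableAt (𝓡 N) 𝓘(ℝ, ℝ) u x := hu.contMDiff.mdifferentiable (by simp) x
    have e1 : MDifferentiableAt (𝓡 N) 𝓘(ℝ, ℝ) (fun x => F k (e x)) x :=
      ((hFe k).contMDiffAt (hW.mem_nhds hx)).mdifferentiableAt (by simp)
    have e2 : MDifferentiableAt (𝓡 N) 𝓘(ℝ, ℝ) (fun x => ψ (F k (e x))) x :=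
      ((hψFe k).contMDiffAt (hW.mem_nhds hx)).mdifferentiableAt (by simp)
    rw [grad_mul e0 e2, grad_comp e1 (hψ _)]
    simp only [hZ]
    module
  have hZm : ∀ k, AEMeasurableField W (Z k) := fun k =>
    ((aemeasurableField_grad hW (hFe k)).smul ((hc.comp_continuousOn
      (hFe k).continuousOn).aestronglyMeasurable hW.measurableSet)).sub
      (hρ.aemeasurableField.smul hcρ)
  have hZlim : Tendsto (fun k => eLpNorm (fun x => ‖u x • Z k x‖) 2 ν) atTop (𝓝 0) := by
    rw [tendsto_eLpNorm_two_iff]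
    have hle : ∀ k, ∫⁻ x, ‖‖u x • Z k x‖‖ₑ ^ 2 ∂ν ≤ ENNReal.ofReal C *
        (ENNReal.ofReal (Q * C) ^ 2 * ∫⁻ y, ENNReal.ofReal (r y) *
          ‖c (F k y) • fderiv ℝ (F k) y - c (r y) • D y‖ₑ ^ 2) := fun k => by
      rw [hν, lintegral_weightedVolume hρm]
      refine (h.lintegral_le _).trans ?_
      refine mul_le_mul_right ?_ _
      rw [← lintegral_const_mul' _ _ (by finiteness)]
      refine (setLIntegral_mono' Metric.isOpen_ball.measurableSet fun y hy => ?_).trans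
        (setLIntegral_le_lintegral B _)
      rw [← he]
      by_cases hyu : u (e.symm y) = 0
      · simp [hyu]
      have hyt : e.symm y ∈ tsupport u := subset_tsupport _ hyu
      have hχy := hχu _ hyt
      rw [e.right_inv (hsub hy)] at hχy
      have e1 : r y = ρ (e.symm y) := by simp only [hr, hχy.eq_of_nhds, one_mul]
      have e2 : D y = chartCovector x₀ G y := by
        have : fderiv ℝ χ y = 0 := by rw [hχy.fderiv_eq]; simp
        simp only [hD, hχy.eq_of_nhds, one_smul, this, smul_zero, add_zero]
      have e3 : fderiv ℝ (F k) y = chartCovector x₀ (grad N fun x => F k (e x)) y := by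
        rw [← fderiv_comp_chart_symm_eq_chartCovector x₀ (hsub hy)
          (((hFe k).contMDiffAt (hW.mem_nhds (hu.tsupport_subset hyt))).mdifferentiableAt
            (by simp))]
        refine Filter.EventuallyEq.fderiv_eq ?_
        filter_upwards [e.open_target.mem_nhds (hsub hy)] with z hz
        simp only [Function.comp_apply, ← he, e.right_inv hz]
      have e4 : chartCovector x₀ (Z k) y =
          c (F k y) • fderiv ℝ (F k) y - c (r y) • D y := by
        ext ξ
        rw [e1, e2, e3]
        simp only [chartCovector_apply, sub_apply, smul_apply, hZ, inner_sub_left,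
          real_inner_smul_left, smul_eq_mul, ← he, e.right_inv (hsub hy)]
      rw [e1, mul_left_comm, ← mul_pow, ← e1, ← e4]
      gcongr
      rw [enorm_norm, ← ofReal_norm, ← ofReal_norm, ← ENNReal.ofReal_mul
        (mul_nonneg hQ0 h.C_pos.le)]
      refine ENNReal.ofReal_le_ofReal ?_
      rw [norm_smul, mul_assoc]
      exact mul_le_mul (hQ _) (h.norm_le_chartCovector hy) (norm_nonneg _) hQ0
    refine tendsto_of_tendsto_of_tendsto_of_le_of_le tendsto_const_nhds ?_ (fun _ => bot_le) hle
    simpa using ENNReal.Tendsto.const_mul (ENNReal.Tendsto.const_mul hFD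
      (Or.inr (by finiteness : ENNReal.ofReal (Q * C) ^ 2 ≠ ⊤))) (Or.inr (ENNReal.ofReal_ne_top (r := C)))
  obtain ⟨Q', hQ0', hQ'⟩ := hu.exists_grad_bound
  have hlim := (hdom (fun x => ‖grad N u x‖) (continuous_norm_grad hu.contMDiff)
    ⟨Q', hQ0', fun x => by simpa using hQ' x⟩
    fun x hx => by rw [grad_eq_zero_of_notMem_tsupport hx, norm_zero]).add hZlim
  refine tendsto_of_tendsto_of_tendsto_of_le_of_le tendsto_const_nhds (by simpa using hlim)
    (fun _ => bot_le) fun k => ?_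
  have hm1 : AEStronglyMeasurable (fun x => ‖grad N u x‖ * (ψ (F k (e x)) - ψ (ρ x))) ν :=
    ((continuous_norm_grad hu.contMDiff).aestronglyMeasurable.mul
      (((hψFe k).continuousOn.aestronglyMeasurable hW.measurableSet).sub hψρ)).mono_ac hac
  have hm2 : AEStronglyMeasurable (fun x => ‖u x • Z k x‖) ν :=
    (((hZm k).smul hum).aestronglyMeasurable_norm hW.measurableSet).mono_ac hac
  rw [← eLpNorm_norm (fun x => ‖grad N u x‖ * (ψ (F k (e x)) - ψ (ρ x)))]
  refine le_trans (eLpNorm_mono_ae_real ?_) (eLpNorm_add_le hm1.norm hm2 (by norm_num))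
  filter_upwards [hac.ae_le (ae_restrict_mem hW.measurableSet)] with x hx
  rw [norm_norm, hgrad k x hx, Pi.add_apply]
  refine (norm_add_le _ _).trans (add_le_add (le_of_eq ?_) le_rfl)
  rw [norm_smul, norm_mul, norm_norm, mul_comm]

end

end RiemannianHardy

/-! ### Weighted approximation on the manifold, and the inequality for Λ₁. -/

namespace RiemannianHardy

noncomputable section

variable {N : ℕ} {M : Type*} [TopologicalSpace M] [ChartedSpace (EuclideanSpace ℝ (Fin N)) M]

theorem IsC10.zero (U : Set M) : IsC10 N U (fun _ : M => (0 : ℝ)) :=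
  ⟨contMDiff_const, HasCompactSupport.zero, by
    rw [tsupport_eq_empty_iff.2 (by rfl)]; exact empty_subset _⟩

variable [IsManifold (𝓡 N) ∞ M] [T2Space M] [SecondCountableTopology M]

/-- A property of `C¹` functions with compact support in `U` that is additive and holds locally
holds for all of them. -/
theorem IsC10.induction {U : Set M} {u : M → ℝ} (hu : IsC10 N U u) {Q : (M → ℝ) → Prop}
    (h0 : Q fun _ => 0)
    (hadd : ∀ v w, IsC10 N U v → IsC10 N U w → Q v → Q w → Q fun x => v x + w x)
    (hloc : ∀ x ∈ U, ∃ V : Set M, IsOpen V ∧ x ∈ V ∧ V ⊆ U ∧ ∀ v, IsC10 N V v → Q v) : Q u := by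
  have : LocallyCompactSpace M := ChartedSpace.locallyCompactSpace (EuclideanSpace ℝ (Fin N)) M
  choose V hVo hxV hVU hQ using fun x : tsupport u => hloc x (hu.tsupport_subset x.2)
  obtain ⟨f, hf⟩ := SmoothPartitionOfUnity.exists_isSubordinate (𝓡 N) (isClosed_tsupport u) V hVo
    fun x hx => mem_iUnion_of_mem ⟨x, hx⟩ (hxV ⟨x, hx⟩)
  have hfin := f.locallyFinite.finite_nonempty_inter_compact hu.hasCompactSupport.isCompact
  have hV : ∀ i, IsC10 N (V i) (fun x => f i x * u x) := fun i =>
    ⟨((f i).contMDiff.of_le (by simp)).mul hu.contMDiff, hu.hasCompactSupport.mul_left,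
      tsupport_mul_subset_left.trans (hf i)⟩
  have hsum : ∀ T : Finset (tsupport u), IsC10 N U (fun x => ∑ i ∈ T, f i x * u x) ∧
      Q fun x => ∑ i ∈ T, f i x * u x := fun T => by
    classical
    induction T using Finset.induction_on with
    | empty => simpa using ⟨IsC10.zero U, h0⟩
    | insert i T hi ih =>
      simp only [Finset.sum_insert hi]
      exact ⟨((hV i).mono (hVU i)).add ih.1,
        hadd _ _ ((hV i).mono (hVU i)) ih.1 (hQ i _ (hV i)) ih.2⟩
  convert (hsum hfin.toFinset).2 with x
  rw [← Finset.sum_mul]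
  by_cases hx : x ∈ tsupport u
  · have h1 := f.sum_eq_one hx
    rw [finsum_eq_sum_of_support_subset (s := hfin.toFinset)] at h1
    · rw [h1, one_mul]
    · intro i hi
      simp only [Finite.coe_toFinset, mem_ofPred_eq]
      exact ⟨x, hi, hx⟩
  · rw [image_eq_zero_of_notMem_tsupport hx, mul_zero]

variable [RiemannianBundle (fun x : M => TangentSpace (𝓡 N) x)]
  [MeasurableSpace M] [BorelSpace M]
  [IsContMDiffRiemannianBundle (𝓡 N) ∞
    (EuclideanSpace ℝ (Fin N)) (fun x : M => TangentSpace (𝓡 N) x)]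
  {U : Set M} {ρ : M → ℝ} {G : (x : M) → TangentSpace (𝓡 N) x}

/-- The product of a test function with a suitable function of `ρ` is a limit of test functions
in the energy norm with weight `ρ`. -/
theorem IsC10.isWeightedLimit (hU : IsOpen U) (hρ : IsW12 N U ρ G)
    (hρ0 : ∀ᵐ x ∂(riemannianVolume N M).restrict U, 0 ≤ ρ x)
    {ψ c : ℝ → ℝ} (hψ : ∀ t, HasDerivAt ψ (c t) t) (hc : Continuous c) {K : ℝ}
    (hcb : ∀ t, |c t| ≤ K) (hct : ∀ t, 0 ≤ t → c t ^ 2 * t ≤ K) (hψb : ∀ t, 0 ≤ t → |ψ t| ≤ K)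
    {u : M → ℝ} (hu : IsC10 N U u) :
    IsWeightedLimit U ρ (fun x => u x * ψ (ρ x))
      (fun x => ψ (ρ x) • grad N u x + (u x * c (ρ x)) • G x) := by
  have hψ1 : ContDiff ℝ 1 ψ := contDiff_one_of_hasDerivAt hψ hc
  have hψρ : AEStronglyMeasurable (fun x => ψ (ρ x)) ((riemannianVolume N M).restrict U) :=
    hψ1.continuous.comp_aestronglyMeasurable hρ.aestronglyMeasurable
  have hcρ : AEStronglyMeasurable (fun x => c (ρ x)) ((riemannianVolume N M).restrict U) :=
    hc.comp_aestronglyMeasurable hρ.aestronglyMeasurable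
  have hm : ∀ v : M → ℝ, IsC10 N U v →
      AEMeasurableField U (fun x => ψ (ρ x) • grad N v x + (v x * c (ρ x)) • G x) := fun v hv =>
    (hv.aemeasurableField_grad.smul hψρ).add
      (hρ.aemeasurableField.smul (hv.contMDiff.continuous.aestronglyMeasurable.mul hcρ))
  have hgrad0 : ∀ x, grad N (fun _ : M => (0 : ℝ)) x = 0 := fun x =>
    grad_eq_zero_of_notMem_tsupport (by rw [tsupport_eq_empty_iff.2 (by rfl)]; simp)
  -- The function and its gradient are additive in u, so a partition of unity reduces to u supported
  -- in a single good ball.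
  refine hu.induction (Q := fun u => IsWeightedLimit U ρ (fun x => u x * ψ (ρ x))
      (fun x => ψ (ρ x) • grad N u x + (u x * c (ρ x)) • G x)) ?_ ?_ ?_
  · refine ⟨by simpa using aestronglyMeasurable_const, hm _ (IsC10.zero U), fun _ _ => 0,
      fun _ => IsC10.zero U, ?_, ?_⟩
    · simp
    · simp [hgrad0]
  · intro v w hv hw h1 h2
    convert h1.add hU h2 using 2 with x x
    · ring
    · rw [grad_add (hv.contMDiff.mdifferentiable (by simp) x)
        (hw.contMDiff.mdifferentiable (by simp) x)]
      module
  · intro x hx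
    obtain ⟨R, C, hg, hRU⟩ := exists_isGoodBall (N := N) x (hU.mem_nhds hx)
    refine ⟨chartBall N x R, isOpen_chartBall x R, mem_chartBall_self x hg.R_pos, hRU,
      fun v hv => ?_⟩
    refine (hg.isWeightedLimit (hρ.mono hRU) (ae_restrict_of_ae_restrict_of_subset hRU hρ0) hψ hc
      hcb hct hψb hv).of_subset (isOpen_chartBall x R).measurableSet hRU
      (hv.contMDiff.continuous.aestronglyMeasurable.mul hψρ) (hm v (hv.mono hRU)) ?_ ?_
    · intro y hy
      rw [image_eq_zero_of_notMem_tsupport fun h' => hy (hv.tsupport_subset h'), zero_mul]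
    · intro y hy
      rw [image_eq_zero_of_notMem_tsupport fun h' => hy (hv.tsupport_subset h'),
        grad_eq_zero_of_notMem_tsupport fun h' => hy (hv.tsupport_subset h'), zero_mul, zero_smul,
        smul_zero, add_zero]

/-- The inequality that defines `Λ₁`. -/
theorem Lambda1_mul_le {Ω : Set M} (hUΩ : U ⊆ Ω) (hΩ : MeasurableSet Ω)
    (hρΩ : ∀ᵐ x ∂(riemannianVolume N M).restrict Ω, 0 ≤ ρ x)
    (hρ : IsW12 N U ρ G) (hfin : riemannianVolume N M U < ⊤) {w : M → ℝ} (hw : IsC10 N U w) :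
    ENNReal.ofReal √(Lambda1 N Ω ρ) * eLpNorm w 2 (weightedVolume N U ρ) ≤
      eLpNorm (fun x => ‖grad N w x‖) 2 (weightedVolume N U ρ) := by
  set V := riemannianVolume N M with hV
  have hνf := hρ.isFiniteMeasure_weightedVolume hfin
  have hρ0 : ∀ᵐ x ∂V.restrict U, 0 ≤ ρ x := ae_restrict_of_ae_restrict_of_subset hUΩ hρΩ
  have : IsFiniteMeasure (V.restrict U) := ⟨by simpa using hfin⟩
  have hρi : Integrable ρ (V.restrict U) := hρ.memLp.integrable (by norm_num)
  have key : ∀ q : M → ℝ, Continuous q → (∃ Q, 0 ≤ Q ∧ ∀ x, |q x| ≤ Q) →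
      (∀ x ∉ tsupport w, q x = 0) →
      eLpNorm q 2 (weightedVolume N U ρ) ^ 2 = ENNReal.ofReal (∫ x in Ω, ρ x * q x ^ 2 ∂V) := by
    rintro q hq ⟨Q, hQ0, hQ⟩ hq0
    have e1 : ∫ x in Ω, ρ x * q x ^ 2 ∂V = ∫ x in U, ρ x * q x ^ 2 ∂V :=
      (setIntegral_eq_of_subset_of_forall_sdiff_eq_zero hΩ hUΩ fun x hx => by
        rw [hq0 x fun h' => hx.2 (hw.tsupport_subset h')]; simp)
    rw [eLpNorm_two_sq, lintegral_weightedVolume hρ.aestronglyMeasurable, e1,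
      ofReal_integral_eq_lintegral_ofReal]
    · refine lintegral_congr_ae ?_
      filter_upwards [hρ0] with x hx
      rw [ENNReal.ofReal_mul hx, ← ofReal_norm, ← ENNReal.ofReal_pow (norm_nonneg _),
        Real.norm_eq_abs, sq_abs]
    · refine hρi.mul_bdd (c := Q ^ 2) (hq.pow 2).aestronglyMeasurable
        (Eventually.of_forall fun x => ?_)
      rw [norm_pow]
      exact pow_le_pow_left₀ (norm_nonneg _) (hQ x) 2
    · filter_upwards [hρ0] with x hx
      exact mul_nonneg hx (sq_nonneg _)
  have hint0 : ∀ q : M → ℝ, 0 ≤ ∫ x in Ω, ρ x * q x ^ 2 ∂V := fun q => by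
    refine integral_nonneg_of_ae ?_
    filter_upwards [hρΩ] with x hx
    exact mul_nonneg hx (sq_nonneg _)
  have h1 := key w hw.contMDiff.continuous hw.exists_bound
    fun x hx => image_eq_zero_of_notMem_tsupport hx
  obtain ⟨Q', hQ0', hQ'⟩ := hw.exists_grad_bound
  have h2 := key (fun x => ‖grad N w x‖) (continuous_norm_grad hw.contMDiff)
    ⟨Q', hQ0', fun x => by simpa using hQ' x⟩
    fun x hx => by rw [grad_eq_zero_of_notMem_tsupport hx, norm_zero]
  rw [← (ENNReal.pow_right_strictMono two_ne_zero).le_iff_le]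
  rw [mul_pow, h1, h2, ← ENNReal.ofReal_pow (Real.sqrt_nonneg _)]
  -- All quotients are nonnegative, whether or not the integrals converge, since a divergent
  -- integral has the value 0. So the infimum is nonnegative and is a lower bound for each quotient.
  have hbdd : ∀ q ∈ {q : ℝ | ∃ u : M → ℝ, IsC10 N Ω u ∧ ∫ x in Ω, ρ x * u x ^ 2 ∂V ≠ 0 ∧
      q = (∫ x in Ω, ρ x * ‖grad N u x‖ ^ 2 ∂V) / ∫ x in Ω, ρ x * u x ^ 2 ∂V}, 0 ≤ q := by
    rintro q ⟨u, -, -, rfl⟩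
    exact div_nonneg (hint0 _) (hint0 _)
  have hΛ0 : 0 ≤ Lambda1 N Ω ρ := Real.sInf_nonneg hbdd
  rw [Real.sq_sqrt hΛ0, ← ENNReal.ofReal_mul hΛ0]
  refine ENNReal.ofReal_le_ofReal ?_
  -- If the denominator vanishes then `w` is not admissible for the infimum, but the inequality is
  -- trivial.
  rcases (hint0 w).eq_or_lt with h0 | h0
  · rw [← h0, mul_zero]; exact hint0 _
  · rw [← le_div_iff₀ h0]
    exact csInf_le ⟨0, hbdd⟩ ⟨w, hw.mono hUΩ, h0.ne', rfl⟩

/-- Both sides are continuous for the weighted energy norm, so the inequality passes from test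
functions to their limits. It is stated with norms, not squares, in order that the triangle
inequality suffices. -/
theorem IsWeightedLimit.Lambda1_mul_le {Ω : Set M} (hU : IsOpen U) (hUΩ : U ⊆ Ω)
    (hΩ : MeasurableSet Ω)
    (hρΩ : ∀ᵐ x ∂(riemannianVolume N M).restrict Ω, 0 ≤ ρ x)
    (hρ : IsW12 N U ρ G) (hfin : riemannianVolume N M U < ⊤) {v : M → ℝ}
    {X : (x : M) → TangentSpace (𝓡 N) x} (h : IsWeightedLimit U ρ v X) :
    ENNReal.ofReal √(Lambda1 N Ω ρ) * eLpNorm v 2 (weightedVolume N U ρ) ≤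
      eLpNorm (fun x => ‖X x‖) 2 (weightedVolume N U ρ) := by
  obtain ⟨w, h1, h2, h3⟩ := h.exists_approx
  set ν := weightedVolume N U ρ
  set Λ := ENNReal.ofReal √(Lambda1 N Ω ρ)
  have hac := weightedVolume_absolutelyContinuous (N := N) U ρ
  have hle : ∀ k, Λ * eLpNorm v 2 ν ≤ (eLpNorm (fun x => ‖X x‖) 2 ν +
      eLpNorm (fun x => ‖grad N (w k) x - X x‖) 2 ν) +
      Λ * eLpNorm (fun x => w k x - v x) 2 ν := fun k => by
    have hw := (h1 k).contMDiff.continuous.aestronglyMeasurable (μ := ν)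
    have e1 : eLpNorm v 2 ν ≤ eLpNorm (w k) 2 ν + eLpNorm (fun x => w k x - v x) 2 ν := by
      refine le_trans (le_of_eq ?_) (eLpNorm_sub_le hw
        (hw.sub (h.aestronglyMeasurable.mono_ac hac)) (by norm_num))
      congr 1
      ext x
      simp
    have e2 : eLpNorm (fun x => ‖grad N (w k) x‖) 2 ν ≤ eLpNorm (fun x => ‖X x‖) 2 ν +
        eLpNorm (fun x => ‖grad N (w k) x - X x‖) 2 ν := by
      refine le_trans (eLpNorm_mono_real fun x => ?_) (eLpNorm_add_le
        ((h.aemeasurableField.aestronglyMeasurable_norm hU.measurableSet).mono_ac hac)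
        ((((h1 k).aemeasurableField_grad.sub h.aemeasurableField).aestronglyMeasurable_norm
          hU.measurableSet).mono_ac hac) (by norm_num))
      rw [norm_norm, Pi.add_apply]
      simpa using norm_add_le (X x) (grad N (w k) x - X x)
    refine (mul_le_mul_right e1 Λ).trans ?_
    rw [mul_add]
    gcongr
    exact (RiemannianHardy.Lambda1_mul_le hUΩ hΩ hρΩ hρ hfin (h1 k)).trans e2
  have hlim : Tendsto (fun k => (eLpNorm (fun x => ‖X x‖) 2 ν +
      eLpNorm (fun x => ‖grad N (w k) x - X x‖) 2 ν) +
      Λ * eLpNorm (fun x => w k x - v x) 2 ν) atTop (𝓝 (eLpNorm (fun x => ‖X x‖) 2 ν)) := by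
    simpa using (h3.const_add (eLpNorm (fun x => ‖X x‖) 2 ν)).add
      (ENNReal.Tendsto.const_mul h2 (Or.inr (by finiteness : Λ ≠ ⊤)))
  exact ge_of_tendsto' hlim hle

end

end RiemannianHardy

/-! ### The limiting test function u/√(ρ+ε), and ε → 0. -/

namespace RiemannianHardy

noncomputable section

section RpowNegHalf

variable {ε : ℝ}

theorem hasDerivAt_inv_sqrt_add (hε : 0 < ε) (t : ℝ) (ht : 0 ≤ t) :
    HasDerivAt (fun t => (√(t + ε))⁻¹) (-(1 / 2) * ((t + ε) * √(t + ε))⁻¹) t := by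
  have h0 : 0 < t + ε := by positivity
  have hs : √(t + ε) ≠ 0 := (Real.sqrt_pos.2 h0).ne'
  have h1 := (((hasDerivAt_id t).add_const ε).sqrt h0.ne').fun_inv hs
  refine h1.congr_deriv ?_
  have h2 : √(t + ε) ^ 2 = t + ε := Real.sq_sqrt h0.le
  simp only [id, h2]
  field_simp

/-- This is the bound on c(t)²t that the weighted approximation requires; c(t)²t equals ¼ · t/(t+ε)
· (t+ε)⁻². -/
theorem inv_mul_sqrt_sq_mul_le (hε : 0 < ε) {t : ℝ} (ht : 0 ≤ t) :
    (-(1 / 2) * ((t + ε) * √(t + ε))⁻¹) ^ 2 * t ≤ (ε ^ 2)⁻¹ := by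
  have h0 : 0 < t + ε := by positivity
  have h1 : (-(1 / 2) * ((t + ε) * √(t + ε))⁻¹) ^ 2 * t =
      1 / 4 * (t / (t + ε)) * ((t + ε) ^ 2)⁻¹ := by
    rw [mul_pow, inv_pow, mul_pow, Real.sq_sqrt h0.le]
    field_simp
    ring
  have h2 : t / (t + ε) ≤ 1 := (div_le_one h0).2 (by linarith)
  rw [h1]
  calc _ ≤ 1 / 4 * 1 * (ε ^ 2)⁻¹ := by
        gcongr
        linarith
    _ ≤ _ := by
        have : 0 < (ε ^ 2)⁻¹ := by positivity
        linarith

end RpowNegHalf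

variable {N : ℕ} {M : Type*} [TopologicalSpace M] [ChartedSpace (EuclideanSpace ℝ (Fin N)) M]
  [IsManifold (𝓡 N) ∞ M] [RiemannianBundle (fun x : M => TangentSpace (𝓡 N) x)]
  [T2Space M] [MeasurableSpace M] [BorelSpace M] [SecondCountableTopology M]
  [IsContMDiffRiemannianBundle (𝓡 N) ∞
    (EuclideanSpace ℝ (Fin N)) (fun x : M => TangentSpace (𝓡 N) x)]
  {U : Set M} {ρ : M → ℝ} {G : (x : M) → TangentSpace (𝓡 N) x}

/-- The inequality that defines `Λ₁`, for the limiting test function `u / √(ρ + ε)`. -/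
theorem Lambda1_mul_lintegral_le {Ω : Set M} (hU : IsOpen U) (hUΩ : U ⊆ Ω) (hΩ : MeasurableSet Ω)
    (hρΩ : ∀ᵐ x ∂(riemannianVolume N M).restrict Ω, 0 ≤ ρ x)
    (hρ : IsW12 N U ρ G) (hfin : riemannianVolume N M U < ⊤) {u : M → ℝ} (hu : IsC10 N U u)
    {ε : ℝ} (hε : 0 < ε) :
    ENNReal.ofReal (Lambda1 N Ω ρ) * ∫⁻ x in U, ENNReal.ofReal (u x ^ 2 * (ρ x / (ρ x + ε)))
        ∂riemannianVolume N M ≤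
      ∫⁻ x in U, ‖grad N u x - ((1 / 2 : ℝ) * (u x / (ρ x + ε))) • G x‖ₑ ^ 2
        ∂riemannianVolume N M := by
  set g : ℝ → ℝ := fun t => (√(t + ε))⁻¹ with hg
  set g' : ℝ → ℝ := fun t => -(1 / 2) * ((t + ε) * √(t + ε))⁻¹ with hg'
  have hρ0 : ∀ᵐ x ∂(riemannianVolume N M).restrict U, 0 ≤ ρ x :=
    ae_restrict_of_ae_restrict_of_subset hUΩ hρΩ
  have hpos : ∀ t : ℝ, 0 < max t 0 + ε := fun t => by positivity
  have hd : ∀ t, HasDerivAt (affineExtend g (g' 0)) (g' (max t 0)) t :=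
    hasDerivAt_affineExtend fun t ht => hasDerivAt_inv_sqrt_add hε t ht
  have hc : Continuous fun t => g' (max t 0) := by
    refine continuous_const.mul (Continuous.inv₀ (by fun_prop) fun t => ?_)
    have := hpos t
    positivity
  -- The sum of three bounds, one each for c, c(t)²t and ψ, so that a single constant serves in all
  -- three conditions.
  set K : ℝ := (ε * √ε)⁻¹ + (ε ^ 2)⁻¹ + (√ε)⁻¹ with hK
  have hK1 : 0 < (ε * √ε)⁻¹ := by positivity
  have hK2 : 0 < (ε ^ 2)⁻¹ := by positivity
  have hK3 : 0 < (√ε)⁻¹ := by positivity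
  have hle : ∀ t, ε ≤ max t 0 + ε := fun t => by linarith [le_max_right t 0]
  have hlim := hu.isWeightedLimit hU hρ hρ0 hd hc (K := K)
    (fun t => by
      have h1 : ((max t 0 + ε) * √(max t 0 + ε))⁻¹ ≤ (ε * √ε)⁻¹ := by
        have := hle t
        gcongr
      have h2 : 0 < ((max t 0 + ε) * √(max t 0 + ε))⁻¹ := by
        have := hpos t
        positivity
      simp only [hg']
      rw [abs_mul, abs_of_pos h2, abs_of_neg (by norm_num)]
      linarith)
    (fun t ht => by
      rw [max_eq_left ht]
      exact (inv_mul_sqrt_sq_mul_le hε ht).trans (by linarith))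
    (fun t ht => by
      rw [affineExtend_of_nonneg _ _ ht]
      have : (√(t + ε))⁻¹ ≤ (√ε)⁻¹ := by
        gcongr
        linarith
      rw [abs_of_nonneg (by positivity)]
      linarith)
  have h := hlim.Lambda1_mul_le hU hUΩ hΩ hρΩ hρ hfin
  rw [← (ENNReal.pow_right_strictMono two_ne_zero).le_iff_le, mul_pow, eLpNorm_two_sq,
    eLpNorm_two_sq, lintegral_weightedVolume hρ.aestronglyMeasurable,
    lintegral_weightedVolume hρ.aestronglyMeasurable,
    ← ENNReal.ofReal_pow (Real.sqrt_nonneg _)] at h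
  have hΛ : ENNReal.ofReal (Lambda1 N Ω ρ) ≤ ENNReal.ofReal (√(Lambda1 N Ω ρ) ^ 2) := by
    rcases le_total 0 (Lambda1 N Ω ρ) with h0 | h0
    · rw [Real.sq_sqrt h0]
    · simp [ENNReal.ofReal_of_nonpos h0]
  refine (mul_le_mul_left hΛ _).trans (le_trans (le_of_eq ?_) (h.trans ?_))
  · congr 1
    refine lintegral_congr_ae ?_
    filter_upwards [hρ0] with x hx
    rw [affineExtend_of_nonneg _ _ hx, ← ofReal_norm, ← ENNReal.ofReal_pow (norm_nonneg _),
      ← ENNReal.ofReal_mul hx, Real.norm_eq_abs, sq_abs, mul_pow, inv_pow,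
      Real.sq_sqrt (by positivity)]
    congr 1
    ring
  · refine lintegral_mono_ae ?_
    filter_upwards [hρ0] with x hx
    have hx' : 0 < ρ x + ε := by positivity
    have hs : 0 < √(ρ x + ε) := Real.sqrt_pos.2 hx'
    -- The gradient of u/√(ρ+ε) is (ρ+ε)^{-1/2} times the field inside the square. With the weight,
    -- its squared norm gains the factor ρ/(ρ+ε) ≤ 1.
    have e1 : affineExtend g (g' 0) (ρ x) • grad N u x + (u x * g' (max (ρ x) 0)) • G x =
        (√(ρ x + ε))⁻¹ • (grad N u x - ((1 / 2 : ℝ) * (u x / (ρ x + ε))) • G x) := by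
      rw [affineExtend_of_nonneg _ _ hx, max_eq_left hx, smul_sub, smul_smul, sub_eq_add_neg,
        ← neg_smul]
      simp only [hg, hg']
      congr 2
      field_simp
    rw [e1, enorm_norm, enorm_smul, mul_pow, ← mul_assoc]
    refine mul_le_of_le_one_left bot_le ?_
    rw [← ofReal_norm, ← ENNReal.ofReal_pow (norm_nonneg _), ← ENNReal.ofReal_mul hx, norm_inv,
      Real.norm_of_nonneg hs.le, inv_pow, Real.sq_sqrt hx'.le, ENNReal.ofReal_le_one,
      ← div_eq_mul_inv, div_le_one hx']
    linarith

/-- The Hardy inequality for functions supported in `U`, provided that `ρ` does not vanish. -/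
theorem hardy_lintegral_le {Ω : Set M} (hU : IsOpen U) (hUΩ : U ⊆ Ω) (hΩ : MeasurableSet Ω)
    (hρΩ : ∀ᵐ x ∂(riemannianVolume N M).restrict Ω, 0 ≤ ρ x)
    (hρ : IsW12 N U ρ G) (hfin : riemannianVolume N M U < ⊤)
    (hsuper : ∀ φ : M → ℝ, IsC10 N U φ → (∀ x, 0 ≤ φ x) →
      0 ≤ ∫ x in U, inner ℝ (G x) (grad N φ x) ∂(riemannianVolume N M))
    (hρU : ∀ᵐ x ∂(riemannianVolume N M).restrict U, ρ x ≠ 0)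
    {u : M → ℝ} (hu : IsC10 N U u) :
    ∫⁻ x in U, (ENNReal.ofReal (Lambda1 N Ω ρ) * ENNReal.ofReal (u x ^ 2) +
        ENNReal.ofReal (1 / 4) * ‖(u x / ρ x) • G x‖ₑ ^ 2) ∂riemannianVolume N M ≤
      ∫⁻ x in U, ‖grad N u x‖ₑ ^ 2 ∂riemannianVolume N M := by
  set μ := (riemannianVolume N M).restrict U with hμ
  set Λ := ENNReal.ofReal (Lambda1 N Ω ρ)
  have hρ0 : ∀ᵐ x ∂μ, 0 ≤ ρ x := ae_restrict_of_ae_restrict_of_subset hUΩ hρΩ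
  set ε : ℕ → ℝ := fun n => 1 / ((n : ℝ) + 1) with hεdef
  have hε : ∀ n, 0 < ε n := fun n => by positivity
  have hεlim : Tendsto ε atTop (𝓝 0) := tendsto_one_div_add_atTop_nhds_zero_nat
  have hum : AEMeasurable u μ := hu.contMDiff.continuous.aemeasurable
  have hρm : AEMeasurable ρ μ := hρ.aestronglyMeasurable.aemeasurable
  have hm1 : ∀ n, AEMeasurable (fun x => ENNReal.ofReal (u x ^ 2 * (ρ x / (ρ x + ε n)))) μ :=
    fun n => ((hum.pow_const 2).mul (hρm.div (hρm.add_const _))).ennreal_ofReal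
  have hm2 : ∀ n, AEMeasurable (fun x => ‖(u x / (ρ x + ε n)) • G x‖ₑ ^ 2) μ := fun n => by
    have hd : AEStronglyMeasurable (fun x => u x / (ρ x + ε n)) μ :=
      (hum.div (hρm.add_const _)).aestronglyMeasurable
    have := ((hρ.aemeasurableField.smul hd).aestronglyMeasurable_norm hU.measurableSet).enorm
    simpa only [enorm_norm] using this.pow_const 2
  have hm : ∀ n, AEMeasurable (fun x => Λ * ENNReal.ofReal (u x ^ 2 * (ρ x / (ρ x + ε n))) +
      ENNReal.ofReal (1 / 4) * ‖(u x / (ρ x + ε n)) • G x‖ₑ ^ 2) μ := fun n =>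
    ((hm1 n).const_mul _).add ((hm2 n).const_mul _)
  have hle : ∀ n, ∫⁻ x, (Λ * ENNReal.ofReal (u x ^ 2 * (ρ x / (ρ x + ε n))) +
      ENNReal.ofReal (1 / 4) * ‖(u x / (ρ x + ε n)) • G x‖ₑ ^ 2) ∂μ ≤
      ∫⁻ x, ‖grad N u x‖ₑ ^ 2 ∂μ := fun n => by
    rw [lintegral_add_left' ((hm1 n).const_mul _), lintegral_const_mul'' _ (hm1 n),
      lintegral_const_mul'' _ (hm2 n)]
    refine le_trans (add_le_add ?_ le_rfl) (lintegral_grad_sub_add_le hU hfin hρ hρ0 hsuper hu (hε n))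
    exact Lambda1_mul_lintegral_le hU hUΩ hΩ hρΩ hρ hfin hu (hε n)
  have hlim : ∀ᵐ x ∂μ, Tendsto (fun n => Λ * ENNReal.ofReal (u x ^ 2 * (ρ x / (ρ x + ε n))) +
      ENNReal.ofReal (1 / 4) * ‖(u x / (ρ x + ε n)) • G x‖ₑ ^ 2) atTop
      (𝓝 (Λ * ENNReal.ofReal (u x ^ 2) + ENNReal.ofReal (1 / 4) * ‖(u x / ρ x) • G x‖ₑ ^ 2)) := by
    filter_upwards [hρU] with x hx
    have h0 : Tendsto (fun n => ρ x + ε n) atTop (𝓝 (ρ x)) := by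
      simpa using hεlim.const_add (ρ x)
    have h1 : Tendsto (fun n => u x ^ 2 * (ρ x / (ρ x + ε n))) atTop (𝓝 (u x ^ 2)) := by
      have := (tendsto_const_nhds (x := ρ x)).div h0 hx
      rw [div_self hx] at this
      simpa using this.const_mul (u x ^ 2)
    have h2 : Tendsto (fun n => ‖(u x / (ρ x + ε n)) • G x‖ₑ) atTop
        (𝓝 ‖(u x / ρ x) • G x‖ₑ) := by
      simp only [enorm_smul]
      exact ENNReal.Tendsto.mul_const ((tendsto_const_nhds.div h0 hx).enorm)
        (Or.inr enorm_ne_top)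
    exact (ENNReal.Tendsto.const_mul (ENNReal.tendsto_ofReal h1)
      (Or.inr ENNReal.ofReal_ne_top)).add (ENNReal.Tendsto.const_mul (ENNReal.Tendsto.pow h2)
      (Or.inr ENNReal.ofReal_ne_top))
  -- Fatou's lemma, which needs no majorant; the integrability of u²|G|²/ρ² is obtained from it and
  -- not assumed.
  calc _ = ∫⁻ x, liminf (fun n => Λ * ENNReal.ofReal (u x ^ 2 * (ρ x / (ρ x + ε n))) +
      ENNReal.ofReal (1 / 4) * ‖(u x / (ρ x + ε n)) • G x‖ₑ ^ 2) atTop ∂μ :=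
        lintegral_congr_ae (hlim.mono fun x hx => hx.liminf_eq.symm)
    _ ≤ liminf (fun n => ∫⁻ x, (Λ * ENNReal.ofReal (u x ^ 2 * (ρ x / (ρ x + ε n))) +
      ENNReal.ofReal (1 / 4) * ‖(u x / (ρ x + ε n)) • G x‖ₑ ^ 2) ∂μ) atTop :=
        lintegral_liminf_le' hm
    _ ≤ _ := (liminf_le_liminf (Eventually.of_forall hle)).trans_eq (liminf_const _)

end

end RiemannianHardy

/-! ### The energy of log ρ and the local dichotomy. -/

namespace RiemannianHardy

noncomputable section

variable {N : ℕ} {M : Type*} [TopologicalSpace M] [ChartedSpace (EuclideanSpace ℝ (Fin N)) M]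
  [IsManifold (𝓡 N) ∞ M] [RiemannianBundle (fun x : M => TangentSpace (𝓡 N) x)]

theorem IsGoodBall.mono [MeasurableSpace M] [BorelSpace M] {x₀ : M} {R C : ℝ}
    (h : IsGoodBall (N := N) x₀ R C) {r : ℝ} (hr : 0 < r)
    (hrR : r ≤ R) : IsGoodBall (N := N) x₀ r C :=
  have hsub := Metric.closedBall_subset_closedBall (x := chartAt (EuclideanSpace ℝ (Fin N)) x₀ x₀)
    hrR
  ⟨hr, h.C_pos, hsub.trans h.subset_target, fun y hy => h.norm_le y (hsub hy),
    fun y hy => h.le_norm y (hsub hy), fun y hy => h.det_le y (hsub hy),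
    fun y hy => h.le_det y (hsub hy)⟩

theorem chartBall_mono (x₀ : M) {r R : ℝ} (hrR : r ≤ R) : chartBall N x₀ r ⊆ chartBall N x₀ R :=
  inter_subset_inter_right _ (preimage_mono (Metric.ball_subset_ball hrR))

theorem hasDerivAt_log_add_sub {ε : ℝ} (hε : 0 < ε) (t : ℝ) (ht : 0 ≤ t) :
    HasDerivAt (fun t => Real.log (t + ε) - Real.log ε) (t + ε)⁻¹ t := by
  have h0 : t + ε ≠ 0 := by positivity
  simpa using (((hasDerivAt_id t).add_const ε).log h0).sub_const (Real.log ε)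

variable [T2Space M] [MeasurableSpace M] [BorelSpace M] [SecondCountableTopology M]
  [IsContMDiffRiemannianBundle (𝓡 N) ∞
    (EuclideanSpace ℝ (Fin N)) (fun x : M => TangentSpace (𝓡 N) x)]
  {U : Set M} {ρ : M → ℝ} {G : (x : M) → TangentSpace (𝓡 N) x}

theorem IsGoodBall.exists_isC10 {x₀ : M} {R C : ℝ} (h : IsGoodBall (N := N) x₀ R C) {r : ℝ}
    (hr : 0 < r) (hrR : r < R) : ∃ u : M → ℝ, IsC10 N (chartBall N x₀ R) u ∧
      ∀ x ∈ chartBall N x₀ r, u x = 1 := by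
  set e := chartAt (EuclideanSpace ℝ (Fin N)) x₀ with he
  have hext : ∀ x, extChartAt (𝓡 N) x₀ x = e x := fun x => by simp [he]
  let f : SmoothBumpFunction (𝓡 N) x₀ :=
    { rIn := r
      rOut := (r + R) / 2
      rIn_pos := hr
      rIn_lt_rOut := by linarith
      closedBall_subset := fun y hy => by
        have := h.subset_target (Metric.closedBall_subset_closedBall (by linarith) hy.1)
        simpa [he] using this }
  refine ⟨f, ⟨f.contMDiff.of_le (by simp), f.hasCompactSupport, fun x hx => ?_⟩, fun x hx => ?_⟩
  · obtain ⟨y, hy, rfl⟩ := f.tsupport_subset_symm_image_closedBall hx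
    have hyR : y ∈ Metric.ball (e x₀) R :=
      Metric.closedBall_subset_ball (by simp only [f]; linarith) hy.1
    have hyt := h.subset_target (Metric.ball_subset_closedBall hyR)
    have e1 : (extChartAt (𝓡 N) x₀).symm y = e.symm y := by simp [he]
    rw [e1]
    exact ⟨e.map_target hyt, by rw [mem_preimage, ← he, e.right_inv hyt]; exact hyR⟩
  · have hdist : dist (extChartAt (𝓡 N) x₀ x) (extChartAt (𝓡 N) x₀ x₀) ≤ r := by
      rw [hext, hext]
      exact le_of_lt hx.2
    exact f.one_of_dist_le hx.1 hdist

/-- The logarithm of a nonnegative supersolution has finite energy, so a nonnegative supersolution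
either vanishes near a point or is positive there. -/
theorem IsGoodBall.ae_eq_zero_or_ae_ne_zero {x₀ : M} {R C : ℝ} (hR : 0 < R)
    (h : IsGoodBall (N := N) x₀ (4 * R) C) (hU : IsOpen U) (hWU : chartBall N x₀ (4 * R) ⊆ U)
    (hfin : riemannianVolume N M U < ⊤) (hρ : IsW12 N U ρ G)
    (hρ0 : ∀ᵐ x ∂(riemannianVolume N M).restrict U, 0 ≤ ρ x)
    (hsuper : ∀ φ : M → ℝ, IsC10 N U φ → (∀ x, 0 ≤ φ x) →
      0 ≤ ∫ x in U, inner ℝ (G x) (grad N φ x) ∂(riemannianVolume N M)) :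
    (∀ᵐ x ∂(riemannianVolume N M).restrict (chartBall N x₀ R), ρ x = 0) ∨
      ∀ᵐ x ∂(riemannianVolume N M).restrict (chartBall N x₀ R), ρ x ≠ 0 := by
  set e := chartAt (EuclideanSpace ℝ (Fin N)) x₀ with he
  have h1 : IsGoodBall (N := N) x₀ R C := h.mono hR (by linarith)
  have h3 : IsGoodBall (N := N) x₀ (3 * R) C := h.mono (by linarith) (by linarith)
  -- The cutoff is 1 on the ball of radius 3R because the oscillation over the ball of radius R is
  -- estimated by the derivative over the ball of radius 3R; radius 4R leaves room for its support.
  obtain ⟨u, hu, hu1⟩ := h.exists_isC10 (r := 3 * R) (by linarith) (by linarith)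
  replace hu := hu.mono hWU
  set W := chartBall N x₀ (3 * R) with hW
  have hWo : IsOpen W := isOpen_chartBall x₀ _
  have hWU3 : W ⊆ U := (chartBall_mono x₀ (by linarith)).trans hWU
  have hWU1 : chartBall N x₀ R ⊆ U := (chartBall_mono x₀ (by linarith)).trans hWU
  set μ := (riemannianVolume N M).restrict U with hμ
  set μW := (riemannianVolume N M).restrict W with hμW
  have hμle : μW ≤ μ := Measure.restrict_mono hWU3 le_rfl
  have hsub : Metric.ball (e x₀) (3 * R) ⊆ e.target :=
    Metric.ball_subset_closedBall.trans h3.subset_target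
  have hmem : ∀ y ∈ Metric.ball (e x₀) (3 * R), e.symm y ∈ W := fun y hy =>
    ⟨e.map_target (hsub hy), by rwa [mem_preimage, ← he, e.right_inv (hsub hy)]⟩
  obtain ⟨f, hf, hfae, -, -, hfc⟩ := hρ.exists_approx_comp hU
  set ε : ℕ → ℝ := fun j => 1 / ((j : ℝ) + 1) with hεdef
  have hε : ∀ j, 0 < ε j := fun j => by positivity
  have hεlim : Tendsto ε atTop (𝓝 0) := tendsto_one_div_add_atTop_nhds_zero_nat
  set c : ℕ → ℝ → ℝ := fun j t => (max t 0 + ε j)⁻¹ with hcdef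
  have hc : ∀ j, Continuous (c j) := fun j => Continuous.inv₀ (by fun_prop) fun t =>
    (add_pos_of_nonneg_of_pos (le_max_right t 0) (hε j)).ne'
  -- Subtracting log ε makes the function vanish at 0 without changing its derivative. It is this
  -- normalization that separates {ρ = 0} from {ρ > 0} as ε → 0.
  set L : ℕ → ℝ → ℝ := fun j => affineExtend (fun t => Real.log (t + ε j) - Real.log (ε j))
    (0 + ε j)⁻¹ with hL
  have hd : ∀ j t, HasDerivAt (L j) (c j t) t := fun j =>
    hasDerivAt_affineExtend (g' := fun t => (t + ε j)⁻¹) fun t ht => hasDerivAt_log_add_sub (hε j) t ht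
  have hcb : ∀ j t, |c j t| ≤ (ε j)⁻¹ := fun j t => by
    have h0 := le_max_right t 0
    have := hε j
    rw [abs_of_nonneg (by positivity)]
    exact inv_anti₀ this (by linarith)
  have hL1 : ∀ j, ContDiff ℝ 1 (L j) := fun j => contDiff_one_of_hasDerivAt (hd j) (hc j)
  set E : ℝ≥0∞ := (4 * ∫⁻ x in U, ‖grad N u x‖ₑ ^ 2 ∂riemannianVolume N M) ^ (1 / 2 : ℝ) with hE
  have hEt : E ≠ ⊤ := by
    have : ∫⁻ x in U, ‖grad N u x‖ₑ ^ 2 ∂riemannianVolume N M ≠ ⊤ := by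
      have h2 := (hu.memLp_norm_grad hfin).eLpNorm_ne_top
      have h3 := eLpNorm_two_sq (ν := μ) (fun x => ‖grad N u x‖)
      simp only [enorm_norm] at h3
      rw [← h3]
      exact ENNReal.pow_ne_top h2
    finiteness
  -- Drop the square in `lintegral_grad_sub_add_le` and use u = 1 on `W`: what remains is
  -- ∫|G|²/(ρ+ε)² ≤ 4∫|∇u|², uniformly in ε.
  have henergy : ∀ j, eLpNorm (fun x => ‖c j (ρ x) • G x‖) 2 μW ≤ E := fun j => by
    have hA := le_add_self.trans (lintegral_grad_sub_add_le hU hfin hρ hρ0 hsuper hu (hε j))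
    have h4 : ENNReal.ofReal (1 / 4) = 4⁻¹ := by
      rw [ENNReal.ofReal_div_of_pos (by norm_num)]; simp
    rw [h4, ENNReal.inv_mul_le_iff (by simp) (by simp)] at hA
    have h5 : eLpNorm (fun x => ‖c j (ρ x) • G x‖) 2 μW ^ 2 ≤
        4 * ∫⁻ x in U, ‖grad N u x‖ₑ ^ 2 ∂riemannianVolume N M := by
      refine le_trans ?_ hA
      rw [eLpNorm_two_sq]
      refine le_trans (lintegral_mono_ae ?_) (lintegral_mono' hμle le_rfl)
      filter_upwards [ae_restrict_mem hWo.measurableSet,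
        ae_restrict_of_ae_restrict_of_subset hWU3 hρ0] with x hx hx0
      have e1 : c j (ρ x) = (ρ x + ε j)⁻¹ := by simp only [hcdef, max_eq_left hx0]
      rw [hu1 x hx, enorm_norm, e1, one_div]
    calc _ = (eLpNorm (fun x => ‖c j (ρ x) • G x‖) 2 μW ^ 2) ^ (1 / 2 : ℝ) := by
          rw [← ENNReal.rpow_natCast, ← ENNReal.rpow_mul]; simp
      _ ≤ _ := ENNReal.rpow_le_rpow h5 (by norm_num)
  have hfW : ∀ n, ContMDiffOn (𝓡 N) 𝓘(ℝ, ℝ) 1 (f n) W := fun n =>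
    ((hf n).of_le (by simp)).mono hWU3
  have hwd : ∀ j n, ContDiffOn ℝ 1 (fun y => L j (f n (e.symm y)))
      (Metric.ball (e x₀) (3 * R)) := fun j n => by
    refine (hL1 j).comp_contDiffOn ?_
    rw [← contMDiffOn_iff_contDiffOn]
    exact (hfW n).comp
      (((contMDiffOn_chart_symm (I := 𝓡 N) (n := ∞) (x := x₀)).of_le (by simp)).mono hsub) hmem
  have hfderiv : ∀ j n, ∀ y ∈ Metric.ball (e x₀) (3 * R),
      fderiv ℝ (fun y => L j (f n (e.symm y))) y =
        chartCovector x₀ (fun x => c j (f n x) • grad N (f n) x) y := fun j n y hy => by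
    have e1 : MDifferentiableAt (𝓡 N) 𝓘(ℝ, ℝ) (f n) (e.symm y) :=
      ((hfW n).contMDiffAt (hWo.mem_nhds (hmem y hy))).mdifferentiableAt (by simp)
    have e2 : MDifferentiableAt (𝓡 N) 𝓘(ℝ, ℝ) (fun x => L j (f n x)) (e.symm y) :=
      (hd j _).differentiableAt.mdifferentiableAt.comp _ e1
    refine (fderiv_comp_chart_symm_eq_chartCovector x₀ (hsub hy) e2).trans ?_
    ext ξ
    rw [chartCovector_apply, chartCovector_apply, ← he, grad_comp e1 (hd j _)]
  set V := eLpNorm (fun _ : EuclideanSpace ℝ (Fin N) => (1 : ℝ)) 2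
    (volume.restrict (Metric.ball (e x₀) (3 * R))) with hV
  have hVt : V ≠ ⊤ := by
    have : IsFiniteMeasure (volume.restrict (Metric.ball (e x₀) (3 * R))) :=
      ⟨by simpa using measure_ball_lt_top⟩
    exact (memLp_const (p := 2) (1 : ℝ)).eLpNorm_ne_top
  -- The Cauchy–Schwarz factor V passes from L² to L¹, and the powers of C from the manifold to
  -- coordinates. The summand 1 absorbs the error of the n-th approximation, which for each j is at
  -- most 1 for large n.
  have hK : V * (ENNReal.ofReal C * (ENNReal.ofReal C ^ (1 / 2 : ℝ) * (E + 1))) ≠ ⊤ := by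
    finiteness
  have hdich := RiemannianHardy.ae_eq_zero_or_ae_ne_zero (μ := volume) (r := fun y => ρ (e.symm y))
    (x₀ := e x₀) hR hwd (W := fun j y => L j (ρ (e.symm y))) ?_ hK ?_ ?_ ?_
  · exact hdich.imp h1.ae_of_ae_comp_symm h1.ae_of_ae_comp_symm
  · intro j
    filter_upwards [h1.ae_comp_symm (ae_restrict_of_ae_restrict_of_subset hWU1 hfae)] with y hy
    exact ((hL1 j).continuous.tendsto _).comp hy
  · intro j
    have hlim := hfc (c j) (hc j) _ (hcb j)
    filter_upwards [ENNReal.tendsto_nhds_zero.1 hlim 1 one_pos] with n hn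
    have hfn := (IsW12.aemeasurableField_approx hU (hf n)).smul
      ((hc j).comp_aestronglyMeasurable ((hf n).continuousOn.aestronglyMeasurable hU.measurableSet))
    have hgn := hρ.aemeasurableField.smul ((hc j).comp_aestronglyMeasurable hρ.aestronglyMeasurable)
    have hm : AEStronglyMeasurable (fun x => ‖c j (f n x) • grad N (f n) x‖) μW :=
      (hfn.aestronglyMeasurable_norm hU.measurableSet).mono_measure hμle
    have hE1 : eLpNorm (fun x => ‖c j (f n x) • grad N (f n) x‖) 2 μW ≤ E + 1 := by
      refine le_trans (eLpNorm_mono_real fun x => ?_) ((eLpNorm_add_le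
        ((hgn.aestronglyMeasurable_norm hU.measurableSet).mono_measure hμle)
        (((hfn.sub hgn).aestronglyMeasurable_norm hU.measurableSet).mono_measure hμle)
        (by norm_num)).trans (add_le_add (henergy j) ((eLpNorm_mono_measure _ hμle).trans hn)))
      rw [norm_norm, Pi.add_apply]
      simpa using norm_add_le (c j (ρ x) • G x) (c j (f n x) • grad N (f n) x - c j (ρ x) • G x)
    have hbound : eLpNorm (fderiv ℝ (fun y => L j (f n (e.symm y)))) 2
        (volume.restrict (Metric.ball (e x₀) (3 * R))) ≤
        ENNReal.ofReal C * (ENNReal.ofReal C ^ (1 / 2 : ℝ) * (E + 1)) := by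
      refine (eLpNorm_le_mul_eLpNorm_of_ae_le_mul (g := (fun x => ‖c j (f n x) • grad N (f n) x‖) ∘
        e.symm) (c := C) ?_ 2).trans (mul_le_mul_right ((h3.eLpNorm_comp_symm_le hm).trans
          (mul_le_mul_right hE1 _)) _)
      filter_upwards [ae_restrict_mem Metric.isOpen_ball.measurableSet] with y hy
      rw [hfderiv j n y hy, Function.comp_apply, norm_norm]
      exact h3.norm_chartCovector_le hy
    have hcs := lintegral_mul_le_eLpNorm_mul (f := fun _ : EuclideanSpace ℝ (Fin N) => (1 : ℝ))
      (aestronglyMeasurable_const (μ := volume.restrict (Metric.ball (e x₀) (3 * R))))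
      (((hwd j n).continuousOn_fderiv_of_isOpen Metric.isOpen_ball le_rfl).aestronglyMeasurable
        Metric.isOpen_ball.measurableSet)
    simp only [enorm_one, one_mul] at hcs
    exact hcs.trans (mul_le_mul_right hbound V)
  · intro j
    refine Eventually.of_forall fun y hy => ?_
    simp only [hL, hy]
    rw [affineExtend_of_nonneg _ _ le_rfl]
    simp
  · filter_upwards [h1.ae_comp_symm (ae_restrict_of_ae_restrict_of_subset hWU1 hρ0)] with y hy hy0
    rw [← he] at hy
    have hpos : 0 < ρ (e.symm y) := lt_of_le_of_ne hy (Ne.symm hy0)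
    simp only [hL, affineExtend_of_nonneg _ _ hy, sub_eq_add_neg]
    have hlog : Tendsto (fun j => Real.log (ρ (e.symm y) + ε j)) atTop
        (𝓝 (Real.log (ρ (e.symm y)))) := by
      have := hεlim.const_add (ρ (e.symm y))
      rw [add_zero] at this
      exact this.log hpos.ne'
    refine hlog.add_atTop (tendsto_neg_atBot_atTop.comp (Real.tendsto_log_nhdsGT_zero.comp ?_))
    exact tendsto_nhdsWithin_iff.2 ⟨hεlim, Eventually.of_forall hε⟩

end

end RiemannianHardy

/-! ### The strong maximum principle, from local to global. -/

namespace RiemannianHardy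

noncomputable section

theorem ae_restrict_of_locally_ae {α : Type*} [TopologicalSpace α] [SecondCountableTopology α]
    [MeasurableSpace α] [OpensMeasurableSpace α] {μ : Measure α} {A : Set α} (hA : IsOpen A)
    {p : α → Prop} (h : ∀ x ∈ A, ∃ W : Set α, IsOpen W ∧ x ∈ W ∧ ∀ᵐ y ∂μ.restrict W, p y) :
    ∀ᵐ y ∂μ.restrict A, p y := by
  rw [ae_restrict_iff' hA.measurableSet, ae_iff]
  refine measure_null_of_locally_null _ fun x hx => ?_
  simp only [Classical.not_imp] at hx
  obtain ⟨W, hW, hxW, hp⟩ := h x hx.1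
  rw [ae_restrict_iff' hW.measurableSet, ae_iff] at hp
  refine ⟨_, ?_, hp⟩
  filter_upwards [self_mem_nhdsWithin, mem_nhdsWithin_of_mem_nhds (hW.mem_nhds hxW)] with y hy hyW
  simp only [Classical.not_imp] at hy ⊢
  exact ⟨hyW, hy.2⟩

variable {N : ℕ} {M : Type*} [TopologicalSpace M] [ChartedSpace (EuclideanSpace ℝ (Fin N)) M]
  [IsManifold (𝓡 N) ∞ M] [RiemannianBundle (fun x : M => TangentSpace (𝓡 N) x)]
  [T2Space M] [MeasurableSpace M] [BorelSpace M] [SecondCountableTopology M]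
  [IsContMDiffRiemannianBundle (𝓡 N) ∞
    (EuclideanSpace ℝ (Fin N)) (fun x : M => TangentSpace (𝓡 N) x)]
  {Ω : Set M} {ρ : M → ℝ} {G : (x : M) → TangentSpace (𝓡 N) x}

theorem riemannianVolume_pos_of_isOpen {W : Set M} (hW : IsOpen W) (hne : W.Nonempty) :
    0 < riemannianVolume N M W := by
  obtain ⟨x, hx⟩ := hne
  obtain ⟨R, C, hg, hRW⟩ := exists_isGoodBall (N := N) x (hW.mem_nhds hx)
  exact hg.volume_pos.trans_le (measure_mono hRW)

theorem IsWeaklySuperharmonic.integral_nonneg (h : IsWeaklySuperharmonic N Ω G)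
    (hΩ : IsOpen Ω) {U : Set M} (hUΩ : U ⊆ Ω) {φ : M → ℝ} (hφ : IsC10 N U φ)
    (hφ0 : ∀ x, 0 ≤ φ x) :
    0 ≤ ∫ x in U, inner ℝ (G x) (grad N φ x) ∂(riemannianVolume N M) := by
  refine (h φ (hφ.mono hUΩ) hφ0).trans_eq
    (setIntegral_eq_of_subset_of_forall_sdiff_eq_zero hΩ.measurableSet hUΩ fun x hx => ?_)
  rw [grad_eq_zero_of_notMem_tsupport fun h' => hx.2 (hφ.tsupport_subset h'), inner_zero_right]

theorem exists_isOpen_isCompact_closure (hΩ : IsOpen Ω) {K : Set M} (hK : IsCompact K)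
    (hKΩ : K ⊆ Ω) : ∃ U : Set M, IsOpen U ∧ K ⊆ U ∧ closure U ⊆ Ω ∧ IsCompact (closure U) ∧
      riemannianVolume N M U < ⊤ := by
  have : LocallyCompactSpace M := ChartedSpace.locallyCompactSpace (EuclideanSpace ℝ (Fin N)) M
  obtain ⟨U, hU, hKU, hUΩ, hUc⟩ := exists_open_between_and_isCompact_closure hK hΩ hKΩ
  exact ⟨U, hU, hKU, hUΩ, hUc,
    (measure_mono subset_closure).trans_lt (riemannianVolume_lt_top_of_isCompact hUc)⟩

/-- The strong maximum principle for weak supersolutions, in the almost everywhere sense. -/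
theorem IsWeaklySuperharmonic.ae_ne_zero (hΩ : IsOpen Ω) (hρ : IsW12Loc N Ω ρ G)
    (hρ0 : ∀ᵐ x ∂(riemannianVolume N M).restrict Ω, 0 ≤ ρ x) (hsuper : IsWeaklySuperharmonic N Ω G)
    (hne : ∀ x ∈ Ω, ¬ ∀ᵐ y ∂(riemannianVolume N M).restrict (connectedComponentIn Ω x), ρ y = 0) :
    ∀ᵐ x ∂(riemannianVolume N M).restrict Ω, ρ x ≠ 0 := by
  set V := riemannianVolume N M
  have hloc : ∀ x ∈ Ω, ∃ W : Set M, IsOpen W ∧ x ∈ W ∧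
      ((∀ᵐ y ∂V.restrict W, ρ y = 0) ∨ ∀ᵐ y ∂V.restrict W, ρ y ≠ 0) := fun x hx => by
    obtain ⟨U, hU, hxU, hUΩ, hUc, hfin⟩ := exists_isOpen_isCompact_closure (N := N) hΩ
      isCompact_singleton (singleton_subset_iff.2 hx)
    have hUΩ' := subset_closure.trans hUΩ
    obtain ⟨R, C, hg, hRU⟩ := exists_isGoodBall (N := N) x (hU.mem_nhds (hxU rfl))
    have hR : 4 * (R / 4) = R := by ring
    rw [← hR] at hg hRU
    have hR4 : 0 < R / 4 := by linarith [hg.R_pos]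
    exact ⟨chartBall N x (R / 4), isOpen_chartBall x _, mem_chartBall_self x hR4,
      hg.ae_eq_zero_or_ae_ne_zero hR4 hU hRU hfin (hρ U hU hUc hUΩ)
        (ae_restrict_of_ae_restrict_of_subset hUΩ' hρ0)
        fun φ hφ hφ0 => hsuper.integral_nonneg hΩ hUΩ' hφ hφ0⟩
  -- The union of all open sets on which ρ vanishes almost everywhere, and of all those on which it
  -- is almost everywhere nonzero. By the local dichotomy they cover Ω.
  set A : Set M := ⋃₀ {W | IsOpen W ∧ ∀ᵐ y ∂V.restrict W, ρ y = 0} with hA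
  set A' : Set M := ⋃₀ {W | IsOpen W ∧ ∀ᵐ y ∂V.restrict W, ρ y ≠ 0} with hA'
  have hAo : IsOpen A := isOpen_sUnion fun W hW => hW.1
  have hAo' : IsOpen A' := isOpen_sUnion fun W hW => hW.1
  have hcover : Ω ⊆ A ∪ A' := fun x hx => by
    obtain ⟨W, hW, hxW, h | h⟩ := hloc x hx
    · exact Or.inl ⟨W, ⟨hW, h⟩, hxW⟩
    · exact Or.inr ⟨W, ⟨hW, h⟩, hxW⟩
  -- On an overlap both properties would hold almost everywhere, but nonempty open sets have
  -- positive volume.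
  have hdisj : Disjoint A A' := by
    rw [Set.disjoint_left]
    rintro x ⟨W, ⟨hW, hWρ⟩, hxW⟩ ⟨W', ⟨hW', hWρ'⟩, hxW'⟩
    refine (riemannianVolume_pos_of_isOpen (N := N) (hW.inter hW') ⟨x, hxW, hxW'⟩).ne' ?_
    rw [← Measure.restrict_eq_zero, ← ae_eq_bot, ← Filter.eventually_false_iff_eq_bot]
    filter_upwards [ae_restrict_of_ae_restrict_of_subset inter_subset_left hWρ,
      ae_restrict_of_ae_restrict_of_subset inter_subset_right hWρ'] with y hy hy'
    exact hy' hy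
  have hAρ : ∀ᵐ y ∂V.restrict A, ρ y = 0 := ae_restrict_of_locally_ae hAo
    fun x ⟨W, hW, hxW⟩ => ⟨W, hW.1, hxW, hW.2⟩
  have hAρ' : ∀ᵐ y ∂V.restrict A', ρ y ≠ 0 := ae_restrict_of_locally_ae hAo'
    fun x ⟨W, hW, hxW⟩ => ⟨W, hW.1, hxW, hW.2⟩
  refine ae_restrict_of_ae_restrict_of_subset (fun x hx => ?_) hAρ'
  -- If a point lies in `A`, its connected component in Ω lies in `A`, so ρ vanishes almost
  -- everywhere on that component.
  refine (hcover hx).resolve_left fun hxA => hne x hx ?_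
  refine ae_restrict_of_ae_restrict_of_subset ?_ hAρ
  exact isPreconnected_connectedComponentIn.subset_left_of_subset_union hAo hAo' hdisj
    ((connectedComponentIn_subset Ω x).trans hcover) ⟨x, mem_connectedComponentIn hx, hxA⟩

end

end RiemannianHardy

/-! ### The theorem, by localization to a neighbourhood of the support of u. -/

theorem mainTheorem12 {N : ℕ} {M : Type*} [EMetricSpace M] [CompleteSpace M]
    [SecondCountableTopology M] [MeasurableSpace M] [BorelSpace M]
    [ChartedSpace (EuclideanSpace ℝ (Fin N)) M] [IsManifold (𝓡 N) ∞ M]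
    [RiemannianBundle (fun x : M => TangentSpace (𝓡 N) x)]
    [IsContMDiffRiemannianBundle (𝓡 N) ∞ (EuclideanSpace ℝ (Fin N))
      (fun x : M => TangentSpace (𝓡 N) x)]
    [IsRiemannianManifold (𝓡 N) M]
    (Ω : Set M) (hΩ : IsOpen Ω)
    (ρ : M → ℝ) (G : (x : M) → TangentSpace (𝓡 N) x)
    (hρ : RiemannianHardy.IsW12Loc N Ω ρ G)
    (hρ_nonneg : ∀ᵐ x ∂(RiemannianHardy.riemannianVolume N M).restrict Ω, 0 ≤ ρ x)
    (hρ_super : RiemannianHardy.IsWeaklySuperharmonic N Ω G)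
    (hρ_nontrivial : ∀ x ∈ Ω,
      ¬ ∀ᵐ y ∂(RiemannianHardy.riemannianVolume N M).restrict (connectedComponentIn Ω x), ρ y = 0)
    (hΛ : 0 < RiemannianHardy.Lambda1 N Ω ρ)
    (u : M → ℝ) (hu : RiemannianHardy.IsC10 N Ω u) :
    IntegrableOn (fun x => u x ^ 2 / ρ x ^ 2 * ‖G x‖ ^ 2) Ω
      (RiemannianHardy.riemannianVolume N M) ∧
    (1 / 4) * (∫ x in Ω, u x ^ 2 / ρ x ^ 2 * ‖G x‖ ^ 2 ∂(RiemannianHardy.riemannianVolume N M)) +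
        RiemannianHardy.Lambda1 N Ω ρ * (∫ x in Ω, u x ^ 2 ∂(RiemannianHardy.riemannianVolume N M))
      ≤ ∫ x in Ω, ‖RiemannianHardy.grad N u x‖ ^ 2 ∂(RiemannianHardy.riemannianVolume N M) := by
  set V := RiemannianHardy.riemannianVolume N M
  -- The Sobolev regularity of ρ is only local, so all analysis takes place on a relatively compact
  -- `U` containing the support of u, while Λ₁ remains that of Ω.
  obtain ⟨U, hU, huU, hUΩ, hUc, hfin⟩ := RiemannianHardy.exists_isOpen_isCompact_closure (N := N) hΩ
    hu.hasCompactSupport.isCompact hu.tsupport_subset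
  have hUΩ' := subset_closure.trans hUΩ
  have hW := hρ U hU hUc hUΩ
  replace hu : RiemannianHardy.IsC10 N U u := ⟨hu.contMDiff, hu.hasCompactSupport, huU⟩
  have hne := hρ_super.ae_ne_zero hΩ hρ hρ_nonneg hρ_nontrivial
  have hmain := RiemannianHardy.hardy_lintegral_le hU hUΩ' hΩ.measurableSet hρ_nonneg hW hfin
    (fun φ hφ hφ0 => hρ_super.integral_nonneg hΩ hUΩ' hφ hφ0)
    (ae_restrict_of_ae_restrict_of_subset hUΩ' hne) hu
  have hu0 : ∀ x ∈ Ω \ U, u x = 0 := fun x hx =>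
    image_eq_zero_of_notMem_tsupport fun h' => hx.2 (huU h')
  have hg0 : ∀ x ∈ Ω \ U, RiemannianHardy.grad N u x = 0 := fun x hx =>
    RiemannianHardy.grad_eq_zero_of_notMem_tsupport fun h' => hx.2 (huU h')
  have hint : ∀ {q : M → ℝ}, (∀ x ∈ Ω \ U, q x = 0) → ∫ x in Ω, q x ∂V = ∫ x in U, q x ∂V :=
    fun hq => setIntegral_eq_of_subset_of_forall_sdiff_eq_zero hΩ.measurableSet hUΩ' hq
  rw [hint (q := fun x => u x ^ 2 / ρ x ^ 2 * ‖G x‖ ^ 2) fun x hx => by simp [hu0 x hx],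
    hint (q := fun x => u x ^ 2) fun x hx => by simp [hu0 x hx],
    hint (q := fun x => ‖RiemannianHardy.grad N u x‖ ^ 2) fun x hx => by simp [hg0 x hx]]
  have hum : AEMeasurable u (V.restrict U) := hu.contMDiff.continuous.aemeasurable
  have hρm : AEMeasurable ρ (V.restrict U) := hW.aestronglyMeasurable.aemeasurable
  have hGm : AEMeasurable (fun x => ‖G x‖) (V.restrict U) :=
    (hW.aemeasurableField.aestronglyMeasurable_norm hU.measurableSet).aemeasurable
  have hqm : AEMeasurable (fun x => u x ^ 2 / ρ x ^ 2 * ‖G x‖ ^ 2) (V.restrict U) :=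
    ((hum.pow_const 2).div (hρm.pow_const 2)).mul (hGm.pow_const 2)
  have hq : ∀ x, ‖(u x / ρ x) • G x‖ₑ ^ 2 = ENNReal.ofReal (u x ^ 2 / ρ x ^ 2 * ‖G x‖ ^ 2) :=
    fun x => by
      rw [← ofReal_norm, ← ENNReal.ofReal_pow (norm_nonneg _), norm_smul, mul_pow,
        Real.norm_eq_abs, sq_abs, div_pow]
  have hgi : Integrable (fun x => ‖RiemannianHardy.grad N u x‖ ^ 2) (V.restrict U) :=
    (hu.memLp_norm_grad hfin).integrable_sq
  have hui : Integrable (fun x => u x ^ 2) (V.restrict U) := (hu.memLp hfin).integrable_sq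
  have hg : ∫⁻ x in U, ‖RiemannianHardy.grad N u x‖ₑ ^ 2 ∂V = ENNReal.ofReal (∫ x in U, ‖RiemannianHardy.grad N u x‖ ^ 2 ∂V) := by
    rw [ofReal_integral_eq_lintegral_ofReal hgi (Eventually.of_forall fun x => sq_nonneg _)]
    refine lintegral_congr fun x => ?_
    rw [ENNReal.ofReal_pow (norm_nonneg _), ofReal_norm]
  simp only [hq] at hmain
  rw [lintegral_add_left' ((hum.pow_const 2).ennreal_ofReal.const_mul _),
    lintegral_const_mul'' _ (hum.pow_const 2).ennreal_ofReal,
    lintegral_const_mul'' _ hqm.ennreal_ofReal, hg,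
    ← ofReal_integral_eq_lintegral_ofReal hui (Eventually.of_forall fun x => sq_nonneg _)] at hmain
  have hq0 : 0 ≤ᵐ[V.restrict U] fun x => u x ^ 2 / ρ x ^ 2 * ‖G x‖ ^ 2 :=
    Eventually.of_forall fun x => by positivity
  -- Finiteness comes from the inequality between lower integrals itself, whose right side is
  -- finite; only then can it be restated with Bochner integrals.
  have hqi : IntegrableOn (fun x => u x ^ 2 / ρ x ^ 2 * ‖G x‖ ^ 2) U V := by
    refine ⟨hqm.aestronglyMeasurable, ?_⟩
    rw [hasFiniteIntegral_iff_ofReal hq0]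
    have h1 := (le_add_self.trans hmain).trans_lt ENNReal.ofReal_lt_top
    exact ENNReal.lt_top_of_mul_ne_top_right h1.ne (by simp)
  refine ⟨hqi.of_forall_sdiff_eq_zero hΩ.measurableSet fun x hx => by simp [hu0 x hx], ?_⟩
  rw [← ofReal_integral_eq_lintegral_ofReal hqi hq0, ← ENNReal.ofReal_mul hΛ.le,
    ← ENNReal.ofReal_mul (by norm_num), ← ENNReal.ofReal_add
      (mul_nonneg hΛ.le (integral_nonneg fun x => sq_nonneg _))
      (mul_nonneg (by norm_num) (integral_nonneg_of_ae hq0)),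
    ENNReal.ofReal_le_ofReal_iff (integral_nonneg fun x => sq_nonneg _)] at hmain
  linarith
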